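/- **Model.** Fix $\Lambda_0,\beta,\alpha_{\rm L},\alpha_{\rm N},G_{\rm A},\tau>0$, $g_{\rm A},\theta_{\rm A}\ge 0$, a noise power $\sigma^2\ge 0$, and a measurable $P_{\rm L}:[0,\infty)\to[0,1]$; put $P_{\rm N}=1-P_{\rm L}$. For $z>0$ let $$f_{\rm L}(z)=2\pi z\Lambda_0P_{\rm L}(z)e^{-2\pi\Lambda_0\int_0^zP_{\rm L}(t)t\,dt},\qquad f_{\rm N}(z)=2\pi z\Lambda_0P_{\rm N}(z)e^{-2\pi\Lambda_0\int_0^zP_{\rm N}(t)t\,dt}.$$ Tier $0$ is a homogeneous Poisson point process $\phi_0$ of intensity $\Lambda_0$ on $\mathbb R^2$. At hop $j+1$ each transmitter $x\in\phi_j$ serves a cluster of $k_j\ge 1$ points, whose displacements from $x$ are i.i.d. (over all points of all clusters and hops, and independent of $\phi_0$) and isotropic with length density $$f_{\rm L}(z)e^{-2\pi\Lambda_0\int_0^{z^{\alpha_{\rm L}/\alpha_{\rm N}}}P_{\rm N}(t)t\,dt}+f_{\rm N}(z)e^{-2\pi\Lambda_0\int_0^{z^{\alpha_{\rm N}/\alpha_{\rm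 L}}}P_{\rm L}(t)t\,dt};$$ $\phi_{j+1}$ consists of one point of each cluster, selected irrespective of the positions. Fix $i\ge0$ with $\theta_{\rm A}k_i\le2\pi$. A receiver (an AP of tier $i+1$) is located at a point $y\in\mathbb R^2$, which is taken as the origin. Independently of the positions and of each other, the transmitters $x_b\in\phi_i$ have i.i.d. nonnegative fadings $h_b$ and i.i.d. gains $\mathbb G_b(k_i)$, equal to $G_{\rm A}^2$, $G_{\rm A}g_{\rm A}$, $g_{\rm A}^2$ with probabilities $\rho^2$, $2\rho(1-\rho)$, $(1-\rho)^2$, $\rho=\theta_{\rm A}k_i/(2\pi)$; given the positions, the link from $x_b$ is, independently over the links and of the $h_b$ and $\mathbb G_b$, LOS with probability $P_{\rm L}(|x_b|)$ and then has path loss $\ell(|x_b|)=\beta|x_b|^{-\alpha_{\rm L}}$, and is otherwise NLOS with $\ell(|x_b|)=\beta|x_b|^{-\alpha_{\rm N}}$. The receiver is served by the (a.s. unique) $x_0\in\phi_i$ with the largest $\ell(|x_b|)$, and $$\mathrm{SINR}(k_i)=\frac{h_0G_{\rm A}^2\ell(|x_0|)}{\sigma^2+\sum_{x_b\in\phi_i\setminus\{x_0\}}h_b\mathbb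 G_b(k_i)\ell(|x_b|)}$$ (it is $0$ if the interference is infinite). Let $\mathcal C(\tau,k_i)=\mathbb P(\mathrm{SINR}(k_i)>\tau)$, and let $\mathcal C_{\rm L}(\tau,r,k_i)$ and $\mathcal C_{\rm N}(\tau,r,k_i)$ be the conditional probabilities of $\mathrm{SINR}(k_i)>\tau$ given that $|x_0|=r$ and $x_0$ is LOS, respectively NLOS. **Theorem.** Both integrands below are integrable, and $$\mathcal C(\tau,k_i)=\int_0^\infty\frac{f_{\rm L}(r)f_{\rm N}(r^{\alpha_{\rm L}/\alpha_{\rm N}})}{2\pi r^{\alpha_{\rm L}/\alpha_{\rm N}}\Lambda_0P_{\rm N}(r^{\alpha_{\rm L}/\alpha_{\rm N}})}\,\mathcal C_{\rm L}(\tau,r,k_i)\,dr+\int_0^\infty\frac{f_{\rm L}(r^{\alpha_{\rm N}/\alpha_{\rm L}})f_{\rm N}(r)}{2\pi r^{\alpha_{\rm N}/\alpha_{\rm L}}\Lambda_0P_{\rm L}(r^{\alpha_{\rm N}/\alpha_{\rm L}})}\,\mathcal C_{\rm N}(\tau,r,k_i)\,dr,$$ where a quotient $f_\bullet(z)/(2\pi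 z\Lambda_0P_\bullet(z))$ with $P_\bullet(z)=0$ is read as $e^{-2\pi\Lambda_0\int_0^zP_\bullet(t)t\,dt}$. Under Rayleigh fading ($h_b$ exponential with mean $1$), for almost every $r>0$ at which the respective factor in front is positive, $$\mathcal C_{\rm L}(\tau,r,k_i)=e^{-\frac{r^{\alpha_{\rm L}}\tau\sigma^2}{G_{\rm A}^2\beta}}\mathcal L_{\mathcal I_{\rm L}}\!\Big(\frac{r^{\alpha_{\rm L}}\tau}{G_{\rm A}^2\beta},k_i\Big),\qquad \mathcal C_{\rm N}(\tau,r,k_i)=e^{-\frac{r^{\alpha_{\rm N}}\tau\sigma^2}{G_{\rm A}^2\beta}}\mathcal L_{\mathcal I_{\rm N}}\!\Big(\frac{r^{\alpha_{\rm N}}\tau}{G_{\rm A}^2\beta},k_i\Big),$$ so that the formula for $\mathcal C(\tau,k_i)$ holds with these expressions. Here, with $\mathcal G_\bullet(s,t,k_i)=\mathbb E\big[e^{-s\beta h\,\mathbb G(k_i)\,t^{-\alpha_\bullet}}\big]$, $$\mathcal L_{\mathcal I_{\rm L}}(s,k_i)=\exp\Big(-2\pi\Lambda_0\!\int_{r}^\infty\![1-\mathcal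 G_{\rm L}(s,t,k_i)]P_{\rm L}(t)t\,dt\Big)\exp\Big(-2\pi\Lambda_0\!\int_{r^{\alpha_{\rm L}/\alpha_{\rm N}}}^\infty\![1-\mathcal G_{\rm N}(s,t,k_i)]P_{\rm N}(t)t\,dt\Big),$$ $$\mathcal L_{\mathcal I_{\rm N}}(s,k_i)=\exp\Big(-2\pi\Lambda_0\!\int_{r}^\infty\![1-\mathcal G_{\rm N}(s,t,k_i)]P_{\rm N}(t)t\,dt\Big)\exp\Big(-2\pi\Lambda_0\!\int_{r^{\alpha_{\rm N}/\alpha_{\rm L}}}^\infty\![1-\mathcal G_{\rm L}(s,t,k_i)]P_{\rm L}(t)t\,dt\Big),$$ with $e^{-\infty}=0$ where an integral diverges. -/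

import Mathlib

open MeasureTheory ProbabilityTheory Set
open scoped ENNReal

noncomputable section

/-- The plane `ℝ²` with its Euclidean norm and Lebesgue measure. -/
abbrev Plane : Type := EuclideanSpace ℝ (Fin 2)

/-! ### Point processes -/

/-- The number of points of the enumerated point process `{X 0, X 1, …}` in `A`. -/
def pointCount {Ω : Type*} (X : ℕ → Ω → Plane) (A : Set Plane) (ω : Ω) : ℕ∞ :=
  {n : ℕ | X n ω ∈ A}.encard

/-- `{X 0, X 1, …}` is a homogeneous Poisson point process of intensity `Λ` on the plane: the
counts of pairwise disjoint Borel sets of finite area are independent Poisson variables whose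
means are `Λ` times the areas. -/
structure IsHomogeneousPPP {Ω : Type*} [MeasurableSpace Ω] (μ : Measure Ω)
    (X : ℕ → Ω → Plane) (Λ : ℝ) : Prop where
  measurable : ∀ n, Measurable (X n)
  law : ∀ (m : ℕ) (A : Fin m → Set Plane) (c : Fin m → ℕ),
    (∀ l, MeasurableSet (A l)) → (∀ l, volume (A l) < ⊤) →
    Pairwise (fun l l' => Disjoint (A l) (A l')) →
    μ (⋂ l, {ω | pointCount X (A l) ω = (c l : ℕ∞)}) =
      ∏ l, poissonMeasure (Λ * (volume (A l)).toReal).toNNReal {c l}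

/-! ### Deterministic parameters -/

/-- The parameters of the network. -/
structure NetworkParams where
  /-- intensity of tier 0 -/
  Λ₀ : ℝ
  /-- intercept of the path loss -/
  β : ℝ
  /-- line-of-sight path loss exponent -/
  αL : ℝ
  /-- non-line-of-sight path loss exponent -/
  αN : ℝ
  /-- standard deviation of the noise; the noise power is `σ ^ 2` -/
  σ : ℝ
  /-- main lobe gain -/
  GA : ℝ
  /-- side lobe gain -/
  gA : ℝ
  /-- main lobe width, in radians -/
  θA : ℝ
  /-- probability that a link of length `r` is line-of-sight -/
  PL : ℝ → ℝ
  Λ₀_pos : 0 < Λ₀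
  β_pos : 0 < β
  αL_pos : 0 < αL
  αN_pos : 0 < αN
  GA_pos : 0 < GA
  gA_nonneg : 0 ≤ gA
  θA_nonneg : 0 ≤ θA
  PL_measurable : Measurable PL
  PL_nonneg : ∀ r, 0 ≤ r → 0 ≤ PL r
  PL_le_one : ∀ r, 0 ≤ r → PL r ≤ 1

namespace NetworkParams

/-- The probability that a link of length `r` is non-line-of-sight. -/
def PN (p : NetworkParams) (r : ℝ) : ℝ := 1 - p.PL r

/-- The probability that there is no LOS transmitter within distance `z`. -/
def voidL (p : NetworkParams) (z : ℝ) : ℝ :=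
  Real.exp (-(2 * Real.pi * p.Λ₀ * ∫ r in (0 : ℝ)..z, p.PL r * r))

/-- The probability that there is no NLOS transmitter within distance `z`. -/
def voidN (p : NetworkParams) (z : ℝ) : ℝ :=
  Real.exp (-(2 * Real.pi * p.Λ₀ * ∫ r in (0 : ℝ)..z, p.PN r * r))

/-- `f_L`, the density of the distance to the nearest LOS transmitter. -/
def fL (p : NetworkParams) (z : ℝ) : ℝ :=
  2 * Real.pi * z * p.Λ₀ * p.PL z * p.voidL z

/-- `f_N`, the density of the distance to the nearest NLOS transmitter. -/
def fN (p : NetworkParams) (z : ℝ) : ℝ :=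
  2 * Real.pi * z * p.Λ₀ * p.PN z * p.voidN z

/-- The density of the distance between a receiver and its transmitter. -/
def fLink (p : NetworkParams) (z : ℝ) : ℝ :=
  p.fL z * p.voidN (z ^ (p.αL / p.αN)) + p.fN z * p.voidL (z ^ (p.αN / p.αL))

/-- The isotropic law on the plane whose norm has density `fLink`. -/
def displacementLaw (p : NetworkParams) : Measure Plane :=
  volume.withDensity fun v => ENNReal.ofReal (p.fLink ‖v‖ / (2 * Real.pi * ‖v‖))

/-- The law of the transceiver beamforming gain `𝔾(k)` of an interfering link. -/
def gainLaw (p : NetworkParams) (k : ℕ) : Measure ℝ :=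
  ENNReal.ofReal ((p.θA * k / (2 * Real.pi)) ^ 2) • Measure.dirac (p.GA ^ 2) +
  ENNReal.ofReal (p.θA * k / Real.pi * (1 - p.θA * k / (2 * Real.pi))) •
    Measure.dirac (p.GA * p.gA) +
  ENNReal.ofReal ((1 - p.θA * k / (2 * Real.pi)) ^ 2) • Measure.dirac (p.gA ^ 2)

open Classical in
/-- The quotient `f_N(z) / (2 π z Λ₀ P_N(z))`. Where `P_N(z) = 0`, so that it reads `0 / 0`, it
stands for the value that remains when the common factor is cancelled. -/
def quotN (p : NetworkParams) (z : ℝ) : ℝ :=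
  if p.PN z = 0 then p.voidN z else p.fN z / (2 * Real.pi * z * p.Λ₀ * p.PN z)

open Classical in
/-- The quotient `f_L(z) / (2 π z Λ₀ P_L(z))`, with the same reading where `P_L(z) = 0`. -/
def quotL (p : NetworkParams) (z : ℝ) : ℝ :=
  if p.PL z = 0 then p.voidL z else p.fL z / (2 * Real.pi * z * p.Λ₀ * p.PL z)

/-- The factor in front of the LOS conditional coverage probability. -/
def weightL (p : NetworkParams) (r : ℝ) : ℝ := p.fL r * p.quotN (r ^ (p.αL / p.αN))

/-- The factor in front of the NLOS conditional coverage probability. -/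
def weightN (p : NetworkParams) (r : ℝ) : ℝ := p.fN r * p.quotL (r ^ (p.αN / p.αL))

/-- `E[exp (- s β h 𝔾(k) r ^ (-α))]` for independent `h ∼ F` and `𝔾(k)`. With `α = αL` this is
`𝒢_L(s, r, k)`, with `α = αN` it is `𝒢_N(s, r, k)`. -/
def gainTransform (p : NetworkParams) (F : Measure ℝ) (k : ℕ) (α s r : ℝ) : ℝ :=
  ∫ q : ℝ × ℝ, Real.exp (-(s * p.β * q.1 * q.2 * r ^ (-α))) ∂(F.prod (p.gainLaw k))

open Classical in
/-- `e ^ (-x)` for `x ∈ [0, ∞]`, with `e ^ (-∞) = 0`. -/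
def expNeg (x : ℝ≥0∞) : ℝ := if x = ⊤ then 0 else Real.exp (-x.toReal)

/-- `exp (- 2 π Λ₀ ∫_{a}^{∞} [1 - 𝒢_L(s, r, k)] P_L(r) r dr)`. -/
def expL (p : NetworkParams) (F : Measure ℝ) (k : ℕ) (a s : ℝ) : ℝ :=
  expNeg (ENNReal.ofReal (2 * Real.pi * p.Λ₀) *
    ∫⁻ r in Ioi a, ENNReal.ofReal ((1 - p.gainTransform F k p.αL s r) * p.PL r * r))

/-- `exp (- 2 π Λ₀ ∫_{a}^{∞} [1 - 𝒢_N(s, r, k)] P_N(r) r dr)`. -/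
def expN (p : NetworkParams) (F : Measure ℝ) (k : ℕ) (a s : ℝ) : ℝ :=
  expNeg (ENNReal.ofReal (2 * Real.pi * p.Λ₀) *
    ∫⁻ r in Ioi a, ENNReal.ofReal ((1 - p.gainTransform F k p.αN s r) * p.PN r * r))

/-- The Laplace transform at `s` of the interference when the serving AP is LOS at distance
`d`. -/
def laplaceL (p : NetworkParams) (F : Measure ℝ) (k : ℕ) (d s : ℝ) : ℝ :=
  p.expL F k d s * p.expN F k (d ^ (p.αL / p.αN)) s

/-- The Laplace transform at `s` of the interference when the serving AP is NLOS at distance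
`d`. -/
def laplaceN (p : NetworkParams) (F : Measure ℝ) (k : ℕ) (d s : ℝ) : ℝ :=
  p.expN F k d s * p.expL F k (d ^ (p.αN / p.αL)) s

/-- The closed form of `C_L(τ, r, k)`. -/
def coverL (p : NetworkParams) (F : Measure ℝ) (τ r : ℝ) (k : ℕ) : ℝ :=
  Real.exp (-(r ^ p.αL * τ * p.σ ^ 2 / (p.GA ^ 2 * p.β))) *
    p.laplaceL F k r (r ^ p.αL * τ / (p.GA ^ 2 * p.β))

/-- The closed form of `C_N(τ, r, k)`. -/
def coverN (p : NetworkParams) (F : Measure ℝ) (τ r : ℝ) (k : ℕ) : ℝ :=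
  Real.exp (-(r ^ p.αN * τ * p.σ ^ 2 / (p.GA ^ 2 * p.β))) *
    p.laplaceN F k r (r ^ p.αN * τ / (p.GA ^ 2 * p.β))

end NetworkParams

/-! ### The random network -/

/-- The random ingredients of the network, where `k j` is the spatial
multiplexing gain of hop `j + 1`. -/
structure Network (Ω : Type*) (k : ℕ → ℕ) where
  /-- the APs of tier 0 -/
  X₀ : ℕ → Ω → Plane
  /-- `D j n l`: displacement of the `l`-th point of the cluster of the `n`-th transmitter of
  hop `j + 1` from that transmitter -/
  D : (j : ℕ) → ℕ → Fin (k j) → Ω → Plane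
  /-- which point of that cluster is scheduled to transmit at the next hop -/
  sel : (j : ℕ) → ℕ → Fin (k j)
  /-- blockage variables of the links from the transmitters to the receiver -/
  U : ℕ → Ω → ℝ
  /-- channel fading of these links -/
  h : ℕ → Ω → ℝ
  /-- beamforming gains of these links, when they are interfering links -/
  G : ℕ → Ω → ℝ

namespace Network

variable {Ω : Type*} {k : ℕ → ℕ}

/-- `φ_j`, the transmitters of hop `j + 1`: tier 0 for `j = 0`, afterwards one point of each
cluster of the previous hop. -/
def φ (N : Network Ω k) : ℕ → ℕ → Ω → Plane
  | 0 => N.X₀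
  | j + 1 => fun n ω => φ N j n ω + N.D j n (N.sel j n) ω

/-- The joint law of the random ingredients, with fading law `F`, up to hop `i + 1`: tier 0 is a
homogeneous Poisson process, the displacements of the hops `1, …, i` are i.i.d., the marks
`(U, h, G)` of the links of hop `i + 1` are i.i.d. with independent components (`U` uniform on
`[0, 1]`), and these three groups of variables are independent. -/
structure IsModel [MeasurableSpace Ω] (N : Network Ω k) (μ : Measure Ω) (p : NetworkParams)
    (F : Measure ℝ) (i : ℕ) : Prop where
  tier_zero : IsHomogeneousPPP μ N.X₀ p.Λ₀
  measurable_D : ∀ j < i, ∀ n l, Measurable (N.D j n l)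
  law_D : ∀ j < i, ∀ n l, μ.map (N.D j n l) = p.displacementLaw
  iIndep_D : iIndepFun
    (fun (q : Σ j : Fin i, ℕ × Fin (k j)) => N.D q.1 q.2.1 q.2.2) μ
  measurable_U : ∀ n, Measurable (N.U n)
  measurable_h : ∀ n, Measurable (N.h n)
  measurable_G : ∀ n, Measurable (N.G n)
  law_marks : ∀ n, μ.map (fun ω => (N.U n ω, N.h n ω, N.G n ω)) =
    (volume.restrict (Icc (0 : ℝ) 1)).prod (F.prod (p.gainLaw (k i)))
  iIndep_marks : iIndepFun (fun n ω => (N.U n ω, N.h n ω, N.G n ω)) μ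
  indep_D : IndepFun (fun ω n => N.X₀ n ω)
    (fun ω (q : Σ j : Fin i, ℕ × Fin (k j)) => N.D q.1 q.2.1 q.2.2 ω) μ
  indep_marks : IndepFun
    (fun ω => ((fun n => N.X₀ n ω),
      (fun (q : Σ j : Fin i, ℕ × Fin (k j)) => N.D q.1 q.2.1 q.2.2 ω)))
    (fun ω n => (N.U n ω, N.h n ω, N.G n ω)) μ

section Receiver

variable (N : Network Ω k) (p : NetworkParams) (i : ℕ) (y : Plane)

/-- The distance of the `n`-th transmitter of hop `i + 1` from the receiver at `y`. -/
def dist (n : ℕ) (ω : Ω) : ℝ := ‖N.φ i n ω - y‖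

/-- The link from the `n`-th transmitter is line-of-sight; given the positions of the
transmitters this has probability `P_L` of the link length, independently over the links. -/
def los (n : ℕ) (ω : Ω) : Prop := N.U n ω < p.PL (N.dist i y n ω)

open Classical in
/-- The path loss `ℓ` of the link from the `n`-th transmitter. -/
def pathLoss (n : ℕ) (ω : Ω) : ℝ :=
  p.β * N.dist i y n ω ^ (-(if N.los p i y n ω then p.αL else p.αN))

/-- The index of the AP that serves the receiver: the (almost surely unique) transmitter of hop
`i + 1` from which the receiver gets the largest average power. -/
def serving (ω : Ω) : ℕ := sInf {n | ∀ m, N.pathLoss p i y m ω ≤ N.pathLoss p i y n ω}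

/-- The distance `|x₀|` of the serving AP. -/
def servingDist (ω : Ω) : ℝ := N.dist i y (N.serving p i y ω) ω

/-- The serving AP is line-of-sight. -/
def servingLos (ω : Ω) : Prop := N.los p i y (N.serving p i y ω) ω

open Classical in
/-- The interference at the receiver (possibly infinite). -/
def interference (ω : Ω) : ℝ≥0∞ :=
  ∑' n, if n = N.serving p i y ω then 0
    else ENNReal.ofReal (N.h n ω * N.G n ω * N.pathLoss p i y n ω)

/-- The SINR of the receiver. -/
def SINR (ω : Ω) : ℝ≥0∞ :=
  ENNReal.ofReal (N.h (N.serving p i y ω) ω * p.GA ^ 2 *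
      N.pathLoss p i y (N.serving p i y ω) ω) /
    (ENNReal.ofReal (p.σ ^ 2) + N.interference p i y ω)

variable [MeasurableSpace Ω] (μ : Measure Ω)

/-- The coverage probability `P(SINR > τ)`. -/
def coverage (τ : ℝ) : ℝ := μ.real {ω | ENNReal.ofReal τ < N.SINR p i y ω}

/-- The conditional coverage probability `P(SINR > τ | |x₀| = r, x₀ is LOS)` for `b = True`, and
`P(SINR > τ | |x₀| = r, x₀ is NLOS)` for `b = False`. -/
def condCoverage [IsFiniteMeasure μ] (τ r : ℝ) (b : Prop) : ℝ :=
  (condDistrib (N.SINR p i y) (fun ω => (N.servingDist p i y ω, N.servingLos p i y ω)) μ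
    (r, b)).real (Ioi (ENNReal.ofReal τ))

end Receiver

end Network

end

open Filter Topology
open scoped NNReal

/-! ### The exponential `x ↦ e ^ (-x)` on `[0, ∞]` -/

/-! A link is treated as one point `(length, U, h, G)`. The transmitters of hop `i + 1` are the
points of tier 0, each shifted by a sum of displacements; these sums are i.i.d. over the points and
independent of tier 0. Lebesgue measure is translation invariant, so such shifts keep a homogeneous
Poisson process homogeneous with the same intensity (`map_add_prod_volume`). Hence the links form a
Poisson process whose intensity is `2πΛ₀ r dr` times the law of the marks
(`Network.IsModel.isPoissonEnum_link`). "Poisson" is expressed through the Laplace functional `E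
exp(-∑ f(Zₙ)) = exp(-∫ (1 - e^{-f}) dν)` with `f` valued in `[0, ∞]`, a form that passes easily
through marking and mapping.

The main tool is a reduced Campbell formula,
`IsPoissonEnum.tsum_lintegral_mul_expNeg_others_of_level`: `E ∑ₙ u(Zₙ) exp(-∑_{m≠n} v(T Zₙ, Zₘ)) = ∫
u(z) exp(-∫ (1 - e^{-v(T z, z')}) ν(dz')) ν(dz)`. It comes from differentiating the Laplace
functional. Take `T` to be the path loss and `v` to be `shadow`: at level `a` it is `∞` on links
with larger path loss and `c h G ℓ / a` on the others. The exponential is then the indicator that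
link `n` is the best one, times `e^{-(c / ℓₙ) I}` with `I` the interference. One formula thus yields
void probabilities and Laplace transforms together. In the exponent, the links beating a LOS link at
distance `r` are the LOS links closer than `r` and the NLOS links closer than `r ^ (αL / αN)`, and
symmetrically for NLOS (`expNeg_levelExponent_los`, `expNeg_levelExponent_nlos`).

The best link is almost surely unique, so events about the serving link become sums over `n`
(`ae_best_iff`, `measure_serving`). With `c = 0` the formula gives the joint law of length and type
of the serving link, with densities `weightL` and `weightN`; disintegrating the coverage event over
it gives the first identity, and integrability follows because the integrals are probabilities.
Under Rayleigh fading the fading of the best link is independent of everything else, so the coverage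
event may be replaced by `e^{-τ(σ² + I)/(GA² ℓ)}` (`lintegral_rayleigh`), and the formula with `c =
τ / GA²` gives a second density for the same event. The two densities have equal integrals over
every Borel set of lengths, hence agree almost everywhere, and a positive weight can be cancelled.
-/

/-- `e ^ (-x)` for `x ∈ [0, ∞]`, with values in `[0, 1] ⊆ [0, ∞]`. -/
noncomputable def ENNReal.expNeg (x : ℝ≥0∞) : ℝ≥0∞ := EReal.exp (-(x : EReal))

namespace ENNReal

@[simp] lemma expNeg_zero : expNeg 0 = 1 := by simp [expNeg]

@[simp] lemma expNeg_top : expNeg ⊤ = 0 := by simp [expNeg]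

lemma expNeg_antitone : Antitone expNeg := fun x y h => by
  simpa [expNeg] using h

lemma expNeg_le_one (x : ℝ≥0∞) : expNeg x ≤ 1 := by
  simpa using expNeg_antitone (zero_le (a := x))

lemma expNeg_ne_top (x : ℝ≥0∞) : expNeg x ≠ ⊤ := ne_top_of_le_ne_top one_ne_top (expNeg_le_one x)

lemma expNeg_eq_zero_iff {x : ℝ≥0∞} : expNeg x = 0 ↔ x = ⊤ := by
  simp [expNeg]

lemma expNeg_eq_one_iff {x : ℝ≥0∞} : expNeg x = 1 ↔ x = 0 := by
  refine ⟨fun h => ?_, fun h => by simp [h]⟩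
  have : EReal.exp (-(x : EReal)) = EReal.exp 0 := by simpa [expNeg] using h
  simpa using EReal.exp_strictMono.injective this

@[fun_prop]
lemma continuous_expNeg : Continuous expNeg :=
  continuous_exp.comp (continuous_neg.comp continuous_coe_ennreal_ereal)

@[fun_prop]
lemma measurable_expNeg : Measurable expNeg := continuous_expNeg.measurable

lemma expNeg_add (x y : ℝ≥0∞) : expNeg (x + y) = expNeg x * expNeg y := by
  rw [expNeg, EReal.coe_ennreal_add, EReal.neg_add, sub_eq_add_neg, EReal.exp_add]
  · rfl
  · left; simp
  · right; simp

lemma expNeg_sum {ι : Type*} (s : Finset ι) (f : ι → ℝ≥0∞) :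
    expNeg (∑ i ∈ s, f i) = ∏ i ∈ s, expNeg (f i) := by
  classical
  induction s using Finset.induction_on with
  | empty => simp
  | insert a s ha ih => rw [Finset.sum_insert ha, Finset.prod_insert ha, expNeg_add, ih]

lemma expNeg_coe (x : ℝ≥0) : expNeg x = ENNReal.ofReal (Real.exp (-(x : ℝ))) := by
  rw [expNeg, ← EReal.exp_coe]; rfl

lemma expNeg_ofReal {x : ℝ} (hx : 0 ≤ x) :
    expNeg (ENNReal.ofReal x) = ENNReal.ofReal (Real.exp (-x)) := by
  rw [ENNReal.ofReal, expNeg_coe, Real.coe_toNNReal x hx]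

lemma expNeg_mul_natCast (x : ℝ≥0∞) (n : ℕ) : expNeg (x * n) = expNeg x ^ n := by
  induction n with
  | zero => simp
  | succ n ih => rw [Nat.cast_succ, mul_add, mul_one, expNeg_add, ih, pow_succ]

lemma ofReal_expNeg (x : ℝ≥0∞) : ENNReal.ofReal (NetworkParams.expNeg x) = expNeg x := by
  unfold NetworkParams.expNeg
  split_ifs with h
  · simp [h]
  · lift x to ℝ≥0 using h
    rw [expNeg_coe]; rfl

/-- The inverse of `expNeg` on `[0, 1]`. -/
noncomputable def negLog (y : ℝ≥0∞) : ℝ≥0∞ := (-(ENNReal.log y)).toENNReal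

lemma expNeg_negLog {y : ℝ≥0∞} (hy : y ≤ 1) : expNeg (negLog y) = y := by
  have h : 0 ≤ -(ENNReal.log y) := by
    rw [EReal.le_neg, neg_zero]
    simpa using ENNReal.log_monotone hy
  rw [expNeg, negLog, EReal.coe_toENNReal h, neg_neg, ENNReal.exp_log]

@[fun_prop]
lemma measurable_negLog : Measurable negLog :=
  (measurable_log.neg).ereal_toENNReal

lemma tendsto_prod_expNeg (f : ℕ → ℝ≥0∞) :
    Tendsto (fun K => ∏ n ∈ Finset.range K, expNeg (f n)) atTop (𝓝 (expNeg (∑' n, f n))) := by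
  simp_rw [← expNeg_sum]
  exact (continuous_expNeg.tendsto _).comp (ENNReal.tendsto_nat_tsum f)

/-- Removing a finite term from the exponent. -/
lemma expNeg_tsum_ite {f : ℕ → ℝ≥0∞} (n : ℕ) :
    expNeg (∑' m, f m) = expNeg (f n) * expNeg (∑' m, if m = n then 0 else f m) := by
  rw [← expNeg_add]; congr 1
  convert ENNReal.tsum_eq_add_tsum_ite (f := f) n

end ENNReal

open ENNReal (expNeg)

/-! ### Laplace functionals of Poisson processes -/

/-- `{Z 0, Z 1, …}` is a Poisson process with intensity measure `ν`, in the sense of its Laplace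
functional. -/
structure IsPoissonEnum {Ω E : Type*} [MeasurableSpace Ω] [MeasurableSpace E] (μ : Measure Ω)
    (Z : ℕ → Ω → E) (ν : Measure E) : Prop where
  measurable : ∀ n, Measurable (Z n)
  laplace : ∀ f : E → ℝ≥0∞, Measurable f →
    ∫⁻ ω, expNeg (∑' n, f (Z n ω)) ∂μ = expNeg (∫⁻ z, (1 - expNeg (f z)) ∂ν)

/-- The generating function `E s^N = e^{-(1-s) r}` at `s = e^{-a}`. The value `a = ∞` is included:
then `s = 0` and both sides are the probability of no point. -/
lemma lintegral_expNeg_mul_poissonMeasure (r : ℝ≥0) (a : ℝ≥0∞) :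
    ∫⁻ n, expNeg (a * (n : ℕ)) ∂(poissonMeasure r) = expNeg ((1 - expNeg a) * r) := by
  obtain ⟨s, hs⟩ : ∃ s : ℝ≥0, expNeg a = s :=
    ⟨_, (ENNReal.coe_toNNReal (ENNReal.expNeg_ne_top a)).symm⟩
  have hs1 : (s : ℝ) ≤ 1 := by
    have := ENNReal.expNeg_le_one a
    rw [hs] at this; exact_mod_cast this
  have h2 : (1 - (s : ℝ≥0∞)) * r = ENNReal.ofReal ((1 - s) * r) := by
    rw [ENNReal.ofReal_mul (by linarith), ENNReal.ofReal_sub _ s.coe_nonneg]; simp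
  rw [poissonMeasure, lintegral_sum_measure]
  simp_rw [lintegral_smul_measure, lintegral_dirac, ENNReal.expNeg_mul_natCast, hs]
  rw [h2, ENNReal.expNeg_ofReal (mul_nonneg (by linarith) r.coe_nonneg)]
  have h3 : ∀ n : ℕ, ENNReal.ofReal (Real.exp (-r) * r ^ n / n.factorial) • (s : ℝ≥0∞) ^ n =
      ENNReal.ofReal (Real.exp (-r) * ((s * r : ℝ) ^ n / n.factorial)) := by
    intro n
    rw [smul_eq_mul, ← ENNReal.ofReal_coe_nnreal, ← ENNReal.ofReal_pow s.coe_nonneg,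
      ← ENNReal.ofReal_mul (by positivity)]
    congr 1; rw [mul_pow]; ring
  simp_rw [h3]
  have h4 : HasSum (fun n : ℕ => Real.exp (-r) * ((s * r : ℝ) ^ n / n.factorial))
      (Real.exp (-((1 - s) * r))) := by
    have h := (NormedSpace.expSeries_div_hasSum_exp (s * r : ℝ)).mul_left (Real.exp (-r))
    rw [← Real.exp_eq_exp_ℝ, ← Real.exp_add] at h
    rwa [show -((1 - s : ℝ) * r) = -r + s * r by ring]
  rw [← ENNReal.ofReal_tsum_of_nonneg (fun n => by positivity) h4.summable, h4.tsum_eq]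

lemma tsum_indicator_eq_pointCount {Ω : Type*} (X : ℕ → Ω → Plane) (A : Set Plane) (ω : Ω) :
    ∑' n, A.indicator (fun _ => (1 : ℝ≥0∞)) (X n ω) = (pointCount X A ω : ℝ≥0∞) := by
  rw [pointCount, ← ENNReal.tsum_set_one, tsum_subtype {n | X n ω ∈ A} (fun _ => (1 : ℝ≥0∞))]
  rfl

/-! ### From Poisson counts to the Laplace functional of the homogeneous process -/

section Homogeneous

variable {Ω : Type*} [MeasurableSpace Ω] {μ : Measure Ω}
  {X : ℕ → Ω → Plane} {Λ : ℝ}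

lemma measurable_pointCount (hX : ∀ n, Measurable (X n)) {A : Set Plane} (hA : MeasurableSet A) :
    Measurable (fun ω => (pointCount X A ω : ℝ≥0∞)) := by
  simp_rw [← tsum_indicator_eq_pointCount]
  exact Measurable.tsum fun n => (measurable_const.indicator hA).comp (hX n)

lemma IsHomogeneousPPP.law_fintype (h : IsHomogeneousPPP μ X Λ) {ι : Type*} [Fintype ι]
    (A : ι → Set Plane) (c : ι → ℕ) (hA : ∀ l, MeasurableSet (A l))
    (hfin : ∀ l, volume (A l) < ⊤) (hd : Pairwise (fun l l' => Disjoint (A l) (A l'))) :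
    μ (⋂ l, {ω | pointCount X (A l) ω = (c l : ℕ∞)}) =
      ∏ l, poissonMeasure (Λ * (volume (A l)).toReal).toNNReal {c l} := by
  let e := (Fintype.equivFin ι).symm
  have := h.law (Fintype.card ι) (A ∘ e) (c ∘ e) (fun l => hA _) (fun l => hfin _)
    (fun l l' hl => hd (e.injective.ne hl))
  simp only [Function.comp] at this
  rw [e.surjective.iInter_comp (fun l => {ω | pointCount X (A l) ω = (c l : ℕ∞)}),
    e.prod_comp (fun l => poissonMeasure (Λ * (volume (A l)).toReal).toNNReal {c l})] at this
  exact this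

variable [IsProbabilityMeasure μ]

/-- The Poisson masses of the finite values already add up to `1`, so nothing is left for the value
`∞`. -/
lemma IsHomogeneousPPP.ae_pointCount_lt_top (h : IsHomogeneousPPP μ X Λ) {A : Set Plane}
    (hA : MeasurableSet A) (hfin : volume A < ⊤) : ∀ᵐ ω ∂μ, pointCount X A ω ≠ ⊤ := by
  have hm := measurable_pointCount h.measurable hA
  have hms : ∀ c : ℕ, MeasurableSet {ω | pointCount X A ω = (c : ℕ∞)} := fun c => by
    have : {ω | pointCount X A ω = (c : ℕ∞)} =
        (fun ω => (pointCount X A ω : ℝ≥0∞)) ⁻¹' {(c : ℝ≥0∞)} := by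
      ext ω; simp only [mem_ofPred_eq, mem_preimage, mem_singleton_iff]
      rw [← ENat.toENNReal_coe, ENat.toENNReal_inj]
    rw [this]; exact hm (measurableSet_singleton _)
  have h1 : μ (⋃ c : ℕ, {ω | pointCount X A ω = (c : ℕ∞)}) = 1 := by
    rw [measure_iUnion _ hms]
    · have h2 : ∀ c : ℕ, μ {ω | pointCount X A ω = (c : ℕ∞)} =
          poissonMeasure (Λ * (volume A).toReal).toNNReal {c} := fun c => by
        have := h.law 1 (fun _ => A) (fun _ => c) (fun _ => hA) (fun _ => hfin)
          (fun l l' hl => absurd (Subsingleton.elim l l') hl)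
        simpa [iInter_const] using this
      simp_rw [h2]
      rw [← measure_iUnion (fun a b hab => by simpa using hab) fun c => measurableSet_singleton c]
      have : ⋃ i : ℕ, ({i} : Set ℕ) = univ := by ext; simp
      rw [this, measure_univ]
    · intro a b hab
      refine Set.disjoint_left.2 fun ω ha hb => hab ?_
      simp only [mem_ofPred_eq] at ha hb
      exact_mod_cast ha.symm.trans hb
  have h2 := (prob_compl_eq_zero_iff (μ := μ) (MeasurableSet.iUnion hms)).2 h1
  filter_upwards [compl_mem_ae_iff.2 h2] with ω hω
  simp only [compl_compl, mem_iUnion, mem_ofPred_eq] at hω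
  obtain ⟨c, hc⟩ := hω
  simp [hc]

lemma IsHomogeneousPPP.lintegral_expNeg_sum (h : IsHomogeneousPPP μ X Λ) (hΛ : 0 ≤ Λ)
    {ι : Type*} [Fintype ι]
    (A : ι → Set Plane) (hA : ∀ l, MeasurableSet (A l)) (a : ι → ℝ≥0∞)
    (hfin : ∀ l, volume (A l) < ⊤) (hd : Pairwise (fun l l' => Disjoint (A l) (A l'))) :
    ∫⁻ ω, expNeg (∑ l, a l * (pointCount X (A l) ω : ℝ≥0∞)) ∂μ =
      expNeg (∑ l, (1 - expNeg (a l)) * (ENNReal.ofReal Λ * volume (A l))) := by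
  classical
  let r : ι → ℝ≥0 := fun l => (Λ * (volume (A l)).toReal).toNNReal
  -- `toNat` sends an infinite count to `0`; this affects a null set only.
  let N : ι → Ω → ℕ := fun l ω => (pointCount X (A l) ω).toNat
  have hNfin : ∀ᵐ ω ∂μ, ∀ l, pointCount X (A l) ω ≠ ⊤ :=
    ae_all_iff.2 fun l => h.ae_pointCount_lt_top (hA l) (hfin l)
  have hNm : ∀ l, Measurable (N l) := fun l => by
    have h1 : N l = fun ω => ⌊(pointCount X (A l) ω : ℝ≥0∞).toReal⌋₊ := by
      funext ω
      simp only [N]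
      cases hp : pointCount X (A l) ω with
      | top => simp
      | coe n => simp
    rw [h1]
    exact Nat.measurable_floor.comp (measurable_pointCount h.measurable (hA l)).ennreal_toReal
  have hmap : μ.map (fun ω l => N l ω) = Measure.pi fun l => poissonMeasure (r l) := by
    refine Measure.ext_of_singleton fun c => ?_
    rw [Measure.map_apply (measurable_pi_lambda _ hNm) (measurableSet_singleton _),
      Measure.pi_singleton, ← h.law_fintype A c hA hfin hd]
    refine measure_congr ?_
    filter_upwards [hNfin] with ω hω
    apply propext
    change (fun l => N l ω) = c ↔ ω ∈ ⋂ l, {ω | pointCount X (A l) ω = (c l : ℕ∞)}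
    simp only [mem_iInter, mem_ofPred_eq, funext_iff, N]
    refine forall_congr' fun l => ?_
    lift pointCount X (A l) ω to ℕ using hω l with n
    simp
  have h1 : ∫⁻ ω, expNeg (∑ l, a l * (pointCount X (A l) ω : ℝ≥0∞)) ∂μ =
      ∫⁻ x, ∏ l, expNeg (a l * (x l : ℕ)) ∂(Measure.pi fun l => poissonMeasure (r l)) := by
    rw [← hmap, lintegral_map (by fun_prop) (measurable_pi_lambda _ hNm)]
    refine lintegral_congr_ae ?_
    filter_upwards [hNfin] with ω hω
    rw [← ENNReal.expNeg_sum]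
    refine congrArg expNeg (Finset.sum_congr rfl fun l _ => ?_)
    lift pointCount X (A l) ω to ℕ using hω l with n
    simp
  have hi := iIndepFun_pi (μ := fun l => poissonMeasure (r l))
    (X := fun l (n : ℕ) => expNeg (a l * n)) (fun l => by fun_prop)
  rw [h1, lintegral_prod_eq_prod_lintegral_of_indepFun _
    (fun l (x : ι → ℕ) => expNeg (a l * (x l : ℕ))) hi (fun l => by fun_prop), ENNReal.expNeg_sum]
  refine Finset.prod_congr rfl fun l _ => ?_
  rw [(measurePreserving_eval (fun l => poissonMeasure (r l)) l).lintegral_comp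
    (f := fun n : ℕ => expNeg (a l * n)) (by fun_prop), lintegral_expNeg_mul_poissonMeasure]
  congr 2
  change ENNReal.ofReal (Λ * (volume (A l)).toReal) = _
  rw [ENNReal.ofReal_mul hΛ, ENNReal.ofReal_toReal (hfin l).ne]

/-- A simple function sees the process only through the counts of its level sets, which are disjoint
and so have independent Poisson counts. -/
lemma IsHomogeneousPPP.laplace_simpleFunc (h : IsHomogeneousPPP μ X Λ) (hΛ : 0 ≤ Λ)
    (f : SimpleFunc Plane ℝ≥0∞) (hf : volume (Function.support f) < ⊤) :
    ∫⁻ ω, expNeg (∑' n, f (X n ω)) ∂μ =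
      expNeg (∫⁻ z, (1 - expNeg (f z)) ∂(ENNReal.ofReal Λ • volume)) := by
  classical
  -- The value `0` is left out: its level set has infinite area and contributes nothing to either
  -- side.
  let ι := {y // y ∈ f.range.erase 0}
  let A : ι → Set Plane := fun y => f ⁻¹' {y.1}
  have hA : ∀ y, MeasurableSet (A y) := fun y => f.measurableSet_preimage _
  have hfin : ∀ y, volume (A y) < ⊤ := fun y => by
    refine lt_of_le_of_lt (measure_mono fun z hz => ?_) hf
    have hz' : f z = y.1 := hz
    simpa [hz'] using (Finset.mem_erase.1 y.2).1
  have hd : Pairwise (fun l l' : ι => Disjoint (A l) (A l')) := fun l l' hl => by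
    refine Set.disjoint_left.2 fun z h1 h2 => hl (Subtype.ext ?_)
    exact (show f z = l.1 from h1).symm.trans (show f z = l'.1 from h2)
  -- Applied below with `g = id` for the sum over points and with `g = 1 - e^{-·}` for the intensity
  -- integral.
  have hdec : ∀ (g : ℝ≥0∞ → ℝ≥0∞), g 0 = 0 → ∀ z,
      g (f z) = ∑ y : ι, g y.1 * (A y).indicator (fun _ => 1) z := by
    intro g hg z
    by_cases hz : f z = 0
    · rw [hz, hg, eq_comm]
      refine Finset.sum_eq_zero fun y _ => ?_
      have : z ∉ A y := fun hy =>
        (Finset.mem_erase.1 y.2).1 ((show f z = y.1 from hy).symm.trans hz)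
      simp [this]
    · have hmem : f z ∈ f.range.erase 0 := Finset.mem_erase.2 ⟨hz, f.mem_range_self z⟩
      rw [Finset.sum_eq_single (⟨f z, hmem⟩ : ι)]
      · have : z ∈ A ⟨f z, hmem⟩ := rfl
        simp [this]
      · intro y _ hy
        have : z ∉ A y := fun hzy => hy (Subtype.ext (show f z = y.1 from hzy).symm)
        simp [this]
      · simp
  have h1 : ∀ ω, ∑' n, f (X n ω) = ∑ y : ι, y.1 * (pointCount X (A y) ω : ℝ≥0∞) := fun ω => by
    simp_rw [← tsum_indicator_eq_pointCount, ← ENNReal.tsum_mul_left]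
    rw [← Summable.tsum_finsetSum fun _ _ => ENNReal.summable]
    exact tsum_congr fun n => hdec id rfl _
  have h2 : ∫⁻ z, (1 - expNeg (f z)) ∂(ENNReal.ofReal Λ • volume) =
      ∑ y : ι, (1 - expNeg y.1) * (ENNReal.ofReal Λ * volume (A y)) := by
    rw [lintegral_smul_measure]
    simp_rw [hdec (fun t => 1 - expNeg t) (by simp)]
    rw [lintegral_finsetSum _ fun y _ => (measurable_const.indicator (hA y)).const_mul _,
      smul_eq_mul, Finset.mul_sum]
    refine Finset.sum_congr rfl fun y _ => ?_
    rw [lintegral_const_mul _ (measurable_const.indicator (hA y)), lintegral_indicator_const (hA y)]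
    ring
  simp_rw [h1]
  rw [h2]
  exact h.lintegral_expNeg_sum hΛ A hA _ hfin hd

/-- A homogeneous Poisson process has the Laplace functional of a Poisson process. -/
lemma IsHomogeneousPPP.isPoissonEnum (h : IsHomogeneousPPP μ X Λ) (hΛ : 0 ≤ Λ) :
    IsPoissonEnum μ X (ENNReal.ofReal Λ • volume) := by
  refine ⟨h.measurable, fun f hf => ?_⟩
  -- Cutting the approximants off to growing balls gives them supports of finite area while keeping
  -- them increasing to `f`.
  let g : ℕ → SimpleFunc Plane ℝ≥0∞ := fun k =>
    (SimpleFunc.eapprox f k).restrict (Metric.ball 0 k)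
  have hgv : ∀ k z, g k z = (Metric.ball (0 : Plane) k).indicator (SimpleFunc.eapprox f k) z :=
    fun k z => by simp only [g]; rw [SimpleFunc.restrict_apply _ measurableSet_ball]
  have hmono : ∀ z, Monotone fun k => g k z := fun z k l hkl => by
    simp only [hgv]
    refine (indicator_le_indicator (SimpleFunc.monotone_eapprox f hkl z)).trans ?_
    exact indicator_le_indicator_of_subset (Metric.ball_subset_ball (by exact_mod_cast hkl))
      (fun _ => zero_le) z
  have hlim : ∀ z, Tendsto (fun k => g k z) atTop (𝓝 (f z)) := fun z => by
    have h1 : Tendsto (fun k => SimpleFunc.eapprox f k z) atTop (𝓝 (f z)) := by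
      have := tendsto_atTop_iSup fun k l hkl => SimpleFunc.monotone_eapprox f hkl z
      rwa [SimpleFunc.iSup_eapprox_apply hf] at this
    refine h1.congr' ?_
    obtain ⟨K, hK⟩ := exists_nat_gt ‖z‖
    filter_upwards [eventually_ge_atTop K] with k hk
    rw [hgv, indicator_of_mem]
    rw [mem_ball_zero_iff]
    exact hK.trans_le (by exact_mod_cast hk)
  have hs : ∀ k, ∫⁻ ω, expNeg (∑' n, g k (X n ω)) ∂μ =
      expNeg (∫⁻ z, (1 - expNeg (g k z)) ∂(ENNReal.ofReal Λ • volume)) := fun k => by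
    refine h.laplace_simpleFunc hΛ _ (lt_of_le_of_lt (measure_mono fun z hz => ?_)
      (measure_ball_lt_top (x := (0 : Plane)) (r := k)))
    rw [Function.mem_support, hgv] at hz
    exact mem_of_indicator_ne_zero hz
  have hL : Tendsto (fun k => ∫⁻ ω, expNeg (∑' n, g k (X n ω)) ∂μ) atTop
      (𝓝 (∫⁻ ω, expNeg (∑' n, f (X n ω)) ∂μ)) := by
    refine tendsto_lintegral_of_dominated_convergence (fun _ => 1)
      (fun k => ?_) (fun k => ae_of_all _ fun _ => ENNReal.expNeg_le_one _) (by simp)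
      (ae_of_all _ fun ω => (ENNReal.continuous_expNeg.tendsto _).comp ?_)
    · exact ENNReal.measurable_expNeg.comp
        (Measurable.tsum fun n => (g k).measurable.comp (h.measurable n))
    · have := lintegral_tendsto_of_tendsto_of_monotone (μ := Measure.count)
        (f := fun k n => g k (X n ω)) (F := fun n => f (X n ω)) (fun k => by fun_prop)
        (ae_of_all _ fun n => hmono _) (ae_of_all _ fun n => hlim _)
      simpa [lintegral_count] using this
  have hR : Tendsto (fun k => expNeg (∫⁻ z, (1 - expNeg (g k z)) ∂(ENNReal.ofReal Λ • volume)))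
      atTop (𝓝 (expNeg (∫⁻ z, (1 - expNeg (f z)) ∂(ENNReal.ofReal Λ • volume)))) := by
    refine (ENNReal.continuous_expNeg.tendsto _).comp
      (lintegral_tendsto_of_tendsto_of_monotone (fun k => ?_) (ae_of_all _ fun z k l hkl => ?_)
        (ae_of_all _ fun z => ?_))
    · have := (g k).measurable
      fun_prop
    · exact tsub_le_tsub_left (ENNReal.expNeg_antitone (hmono z hkl)) _
    · exact ENNReal.Tendsto.sub tendsto_const_nhds
        ((ENNReal.continuous_expNeg.tendsto _).comp (hlim z)) (Or.inl ENNReal.one_ne_top)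
  simp_rw [hs] at hL
  exact tendsto_nhds_unique hL hR

end Homogeneous

/-- Finite products factor by independence, and dominated convergence passes to infinitely many
factors. Writing the infinite product as `expNeg` of a sum of `negLog`s puts it back into the shape
of a Laplace functional. -/
lemma lintegral_infinitePi_expNeg_tsum {S : Type*} [MeasurableSpace S] (κ : Measure S)
    [IsProbabilityMeasure κ] (f : ℕ → S → ℝ≥0∞) (hf : ∀ n, Measurable (f n)) :
    ∫⁻ m, expNeg (∑' n, f n (m n)) ∂(Measure.infinitePi fun _ : ℕ => κ) =
      expNeg (∑' n, ENNReal.negLog (∫⁻ s, expNeg (f n s) ∂κ)) := by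
  have hle : ∀ n, ∫⁻ s, expNeg (f n s) ∂κ ≤ 1 := fun n => by
    refine (lintegral_mono fun s => ENNReal.expNeg_le_one _).trans ?_
    simp
  have h1 : ∀ K, ∫⁻ m, ∏ n ∈ Finset.range K, expNeg (f n (m n))
      ∂(Measure.infinitePi fun _ : ℕ => κ) =
        ∏ n ∈ Finset.range K, expNeg (ENNReal.negLog (∫⁻ s, expNeg (f n s) ∂κ)) := fun K => by
    have hi := iIndepFun_infinitePi (P := fun _ : ℕ => κ) (X := fun n s => expNeg (f n s))
      (fun n => by have := hf n; fun_prop)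
    rw [lintegral_prod_eq_prod_lintegral_of_indepFun _ _ hi
      (fun n => by have := hf n; fun_prop)]
    refine Finset.prod_congr rfl fun n _ => ?_
    rw [ENNReal.expNeg_negLog (hle n)]
    exact (measurePreserving_eval_infinitePi (fun _ : ℕ => κ) n).lintegral_comp
      (f := fun s => expNeg (f n s)) (by have := hf n; fun_prop)
  refine tendsto_nhds_unique (f := fun K => ∫⁻ m, ∏ n ∈ Finset.range K, expNeg (f n (m n))
      ∂(Measure.infinitePi fun _ : ℕ => κ)) (l := atTop) ?_ ?_
  · refine tendsto_lintegral_of_dominated_convergence (fun _ => 1) (fun K => ?_)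
      (fun K => ae_of_all _ fun m => Finset.prod_le_one' fun n _ => ENNReal.expNeg_le_one _)
      (by simp) (ae_of_all _ fun m => ENNReal.tendsto_prod_expNeg _)
    exact Finset.measurable_prod _ fun n _ => by have := hf n; fun_prop
  · simp_rw [h1]
    exact ENNReal.tendsto_prod_expNeg _

/-- Difference quotients of `t ↦ 1 - e^{-xt}` at `0` along `t = 2⁻ᵏ`. Dyadic steps are chosen
because the quotients then increase in `k`, so the Laplace functional can be differentiated under
the integral by monotone convergence. -/
lemma ENNReal.tendsto_two_pow_mul_one_sub_expNeg (x : ℝ≥0∞) :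
    Tendsto (fun k : ℕ => 2 ^ k * (1 - expNeg (x * (2 ^ k)⁻¹))) atTop (𝓝 x) := by
  by_cases hx : x = ⊤
  · subst hx
    have : ∀ k : ℕ, (⊤ : ℝ≥0∞) * (2 ^ k)⁻¹ = ⊤ := fun k => ENNReal.top_mul (by simp)
    simp only [this, expNeg_top, tsub_zero, mul_one]
    exact ENNReal.tendsto_pow_atTop_nhds_top_iff.2 (by norm_num)
  · lift x to ℝ≥0 using hx
    have hd : HasDerivAt (fun t : ℝ => 1 - Real.exp (-(x * t))) x 0 := by
      have := (((hasDerivAt_id (0 : ℝ)).const_mul (x : ℝ)).neg.exp).const_sub 1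
      simpa using this
    have h1 := hd.tendsto_slope_zero_right
    have h2 : Tendsto (fun k : ℕ => ((2 : ℝ) ^ k)⁻¹) atTop (𝓝[>] 0) := by
      refine tendsto_nhdsWithin_iff.2 ⟨?_, .of_forall fun k => by simp⟩
      exact tendsto_inv_atTop_zero.comp (tendsto_pow_atTop_atTop_of_one_lt (by norm_num))
    have h3 := (ENNReal.continuous_ofReal.tendsto _).comp (h1.comp h2)
    simp only [ENNReal.ofReal_coe_nnreal] at h3
    refine h3.congr fun k => ?_
    have e1 : (x : ℝ≥0∞) * (2 ^ k)⁻¹ = ENNReal.ofReal (x * ((2 : ℝ) ^ k)⁻¹) := by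
      rw [ENNReal.ofReal_mul x.coe_nonneg, ENNReal.ofReal_inv_of_pos (by positivity),
        ENNReal.ofReal_pow (by norm_num)]
      simp
    rw [e1, ENNReal.expNeg_ofReal (by positivity)]
    simp only [Function.comp, zero_add, mul_zero, neg_zero, Real.exp_zero, sub_self, sub_zero,
      inv_inv, smul_eq_mul]
    rw [ENNReal.ofReal_mul (by positivity), ENNReal.ofReal_pow (by norm_num),
      ENNReal.ofReal_sub _ (Real.exp_nonneg _)]
    simp

lemma ENNReal.monotone_two_pow_mul_one_sub_expNeg (x : ℝ≥0∞) :
    Monotone (fun k : ℕ => 2 ^ k * (1 - expNeg (x * (2 ^ k)⁻¹))) := by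
  refine monotone_nat_of_le_succ fun k => ?_
  have h1 : x * (2 ^ k)⁻¹ = x * (2 ^ (k + 1))⁻¹ + x * (2 ^ (k + 1))⁻¹ := by
    rw [← mul_add, pow_succ, ENNReal.mul_inv (by simp) (by simp), ← mul_add,
      ENNReal.inv_two_add_inv_two, mul_one]
  -- Halving the step replaces `1 - q²` by `2 (1 - q)`, where `q` is the exponential at the half
  -- step.
  have h2 : ∀ q : ℝ≥0∞, q ≤ 1 → 1 - q * q ≤ 2 * (1 - q) := fun q hq => by
    lift q to ℝ≥0 using ne_top_of_le_ne_top ENNReal.one_ne_top hq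
    have hq' : q ≤ 1 := by exact_mod_cast hq
    have : 1 - q * q ≤ 2 * (1 - q) := by
      rw [← NNReal.coe_le_coe, NNReal.coe_mul, NNReal.coe_sub hq',
        NNReal.coe_sub (by nlinarith [q.2])]
      push_cast
      nlinarith [sq_nonneg ((q : ℝ) - 1)]
    exact_mod_cast this
  simp only [h1, expNeg_add]
  rw [pow_succ, mul_assoc]
  gcongr
  exact h2 _ (expNeg_le_one _)

/-! ### Marking, mapping and Campbell formulas -/

section Poisson

variable {Ω E : Type*} [MeasurableSpace Ω] [MeasurableSpace E] {μ : Measure Ω}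
  {Z : ℕ → Ω → E} {ν : Measure E}

/-- Independent marking of a Poisson process. -/
lemma IsPoissonEnum.marked (hZ : IsPoissonEnum μ Z ν) [SFinite ν] {S : Type*} [MeasurableSpace S]
    {M : ℕ → Ω → S} (hM : ∀ n, Measurable (M n)) (κ : Measure S) [IsProbabilityMeasure κ]
    (hmap : μ.map (fun ω => ((fun n => Z n ω), fun n => M n ω)) =
      (μ.map fun ω n => Z n ω).prod (Measure.infinitePi fun _ => κ)) :
    IsPoissonEnum μ (fun n ω => (Z n ω, M n ω)) (ν.prod κ) := by
  refine ⟨fun n => (hZ.measurable n).prodMk (hM n), fun f hf => ?_⟩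
  have hZm : Measurable fun ω n => Z n ω := measurable_pi_lambda _ hZ.measurable
  have hMm : Measurable fun ω n => M n ω := measurable_pi_lambda _ hM
  have hg : Measurable fun x => ∫⁻ s, expNeg (f (x, s)) ∂κ :=
    (ENNReal.measurable_expNeg.comp hf).lintegral_prod_right'
  have hle : ∀ x, ∫⁻ s, expNeg (f (x, s)) ∂κ ≤ 1 := fun x => by
    refine (lintegral_mono fun s => ENNReal.expNeg_le_one _).trans ?_
    simp
  have hΦ : Measurable fun q : (ℕ → E) × (ℕ → S) => expNeg (∑' n, f (q.1 n, q.2 n)) :=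
    ENNReal.measurable_expNeg.comp (Measurable.tsum fun n => hf.comp (by fun_prop))
  calc ∫⁻ ω, expNeg (∑' n, f (Z n ω, M n ω)) ∂μ
      = ∫⁻ q, expNeg (∑' n, f (q.1 n, q.2 n)) ∂((μ.map fun ω n => Z n ω).prod
          (Measure.infinitePi fun _ => κ)) := by
        rw [← hmap, lintegral_map hΦ (hZm.prodMk hMm)]
    -- Given the points, the marks average out point by point; what remains is an exponential of a
    -- sum over the unmarked process.
    _ = ∫⁻ x, expNeg (∑' n, ENNReal.negLog (∫⁻ s, expNeg (f (x n, s)) ∂κ))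
          ∂(μ.map fun ω n => Z n ω) := by
        rw [lintegral_prod _ hΦ.aemeasurable]
        refine lintegral_congr fun x => ?_
        exact lintegral_infinitePi_expNeg_tsum κ (fun n s => f (x n, s))
          fun n => hf.comp (by fun_prop)
    _ = ∫⁻ ω, expNeg (∑' n, ENNReal.negLog (∫⁻ s, expNeg (f (Z n ω, s)) ∂κ)) ∂μ := by
        rw [lintegral_map _ hZm]
        exact ENNReal.measurable_expNeg.comp (Measurable.tsum fun n =>
          ENNReal.measurable_negLog.comp (hg.comp (measurable_pi_apply n)))
    _ = expNeg (∫⁻ x, (1 - ∫⁻ s, expNeg (f (x, s)) ∂κ) ∂ν) := by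
        rw [hZ.laplace (fun x => ENNReal.negLog (∫⁻ s, expNeg (f (x, s)) ∂κ))
          (ENNReal.measurable_negLog.comp hg)]
        simp_rw [ENNReal.expNeg_negLog (hle _)]
    _ = _ := by
        rw [lintegral_prod _ (by fun_prop)]
        congr 1
        refine lintegral_congr fun x => ?_
        rw [lintegral_sub (by fun_prop) (ne_top_of_le_ne_top ENNReal.one_ne_top (hle x))
          (ae_of_all _ fun s => ENNReal.expNeg_le_one _)]
        simp

lemma IsPoissonEnum.mapped (hZ : IsPoissonEnum μ Z ν) {E' : Type*} [MeasurableSpace E']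
    {T : E → E'} (hT : Measurable T) : IsPoissonEnum μ (fun n ω => T (Z n ω)) (ν.map T) := by
  refine ⟨fun n => hT.comp (hZ.measurable n), fun f hf => ?_⟩
  rw [hZ.laplace (fun z => f (T z)) (hf.comp hT), lintegral_map (by fun_prop) hT]

/-- Two weighted sums over an enumerated family agree on all functions as soon as they agree on
indicators of sets of finite measure. -/
lemma tsum_lintegral_eq_of_indicator [SigmaFinite ν] (hZ : ∀ n, Measurable (Z n))
    {D : ℕ → Ω → ℝ≥0∞} (hD : ∀ n, Measurable (D n)) {R : E → ℝ≥0∞} (hR : Measurable R)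
    (h : ∀ A, MeasurableSet A → ν A < ⊤ →
      ∑' n, ∫⁻ ω, A.indicator 1 (Z n ω) * D n ω ∂μ = ∫⁻ z in A, R z ∂ν)
    {u : E → ℝ≥0∞} (hu : Measurable u) :
    ∑' n, ∫⁻ ω, u (Z n ω) * D n ω ∂μ = ∫⁻ z, u z * R z ∂ν := by
  -- `M B = ∑ₙ E[1_B(Zₙ) Dₙ]`. The hypothesis identifies it with the density `R` on sets of finite
  -- measure, hence everywhere by σ-finiteness.
  let M : Measure E := Measure.sum fun n => (μ.withDensity (D n)).map (Z n)
  have hM : ∀ w : E → ℝ≥0∞, Measurable w →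
      ∫⁻ z, w z ∂M = ∑' n, ∫⁻ ω, w (Z n ω) * D n ω ∂μ := fun w hw => by
    rw [lintegral_sum_measure]
    refine tsum_congr fun n => ?_
    rw [lintegral_map hw (hZ n), lintegral_withDensity_eq_lintegral_mul _ (hD n)
      (g := fun ω => w (Z n ω)) (hw.comp (hZ n))]
    exact lintegral_congr fun ω => mul_comm _ _
  have hMν : M = ν.withDensity R := by
    refine (Measure.ext_iff_of_iUnion_eq_univ (iUnion_spanningSets ν)).2 fun j => ?_
    ext B hB
    have hj := measurableSet_spanningSets ν j
    rw [Measure.restrict_apply hB, Measure.restrict_apply hB, withDensity_apply _ (hB.inter hj),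
      ← h _ (hB.inter hj)
        ((measure_mono inter_subset_right).trans_lt (measure_spanningSets_lt_top ν j)),
      ← hM _ (measurable_one.indicator (hB.inter hj)), lintegral_indicator_one (hB.inter hj)]
  rw [← hM u hu, hMν, lintegral_withDensity_eq_lintegral_mul _ hR hu]
  exact lintegral_congr fun z => mul_comm _ _

lemma IsPoissonEnum.measurable_tsum (hZ : IsPoissonEnum μ Z ν) {f : E → ℝ≥0∞}
    (hf : Measurable f) : Measurable fun ω => ∑' n, f (Z n ω) :=
  Measurable.tsum fun n => hf.comp (hZ.measurable n)

/-- Differentiate the Laplace functional at `f + t 1_A` in `t` at `0+`: the left side brings down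
the number of points in `A`, the right side brings down `∫_A e^{-f} dν`. -/
lemma IsPoissonEnum.lintegral_count_mul_expNeg (hZ : IsPoissonEnum μ Z ν) {f : E → ℝ≥0∞}
    (hf : Measurable f) {A : Set E} (hA : MeasurableSet A) (hfin : ν A < ⊤) :
    ∫⁻ ω, (∑' n, A.indicator 1 (Z n ω)) * expNeg (∑' n, f (Z n ω)) ∂μ =
      (∫⁻ z in A, expNeg (f z) ∂ν) * expNeg (∫⁻ z, (1 - expNeg (f z)) ∂ν) := by
  set C := expNeg (∫⁻ z, (1 - expNeg (f z)) ∂ν) with hC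
  set c := ∫⁻ z in A, expNeg (f z) ∂ν with hc
  have hcfin : c ≠ ⊤ := by
    refine ne_top_of_le_ne_top hfin.ne ?_
    refine (lintegral_mono fun z => ENNReal.expNeg_le_one _).trans ?_
    simp
  let N : Ω → ℝ≥0∞ := fun ω => ∑' n, A.indicator 1 (Z n ω)
  have hind : Measurable (A.indicator (1 : E → ℝ≥0∞)) := measurable_one.indicator hA
  have hNm : Measurable N := hZ.measurable_tsum hind
  have hSm := hZ.measurable_tsum hf
  -- the Laplace functional at `f + t 1_A`
  have hL : ∀ t : ℝ≥0∞, ∫⁻ ω, expNeg (∑' n, f (Z n ω)) * expNeg (N ω * t) ∂μ =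
      C * expNeg ((1 - expNeg t) * c) := fun t => by
    have h1 := hZ.laplace (fun z => f z + A.indicator 1 z * t) (by fun_prop)
    have h2 : ∀ ω, expNeg (∑' n, (f (Z n ω) + A.indicator 1 (Z n ω) * t)) =
        expNeg (∑' n, f (Z n ω)) * expNeg (N ω * t) := fun ω => by
      rw [ENNReal.tsum_add, ENNReal.expNeg_add, ENNReal.tsum_mul_right]
    -- On `A` this is `1 - pq = (1 - p) + (1 - q) p` with `p = e^{-f}` and `q = e^{-t}`, which
    -- isolates the dependence on `t`.
    have h3 : ∀ z, 1 - expNeg (f z + A.indicator 1 z * t) =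
        (1 - expNeg (f z)) + (1 - expNeg t) * A.indicator (fun z => expNeg (f z)) z := fun z => by
      by_cases hz : z ∈ A
      · simp only [hz, indicator_of_mem, Pi.one_apply, one_mul, ENNReal.expNeg_add]
        have e1 := ENNReal.expNeg_le_one (f z)
        have e2 := ENNReal.expNeg_le_one t
        generalize expNeg (f z) = p at e1 ⊢
        generalize expNeg t = q at e2 ⊢
        lift p to ℝ≥0 using ne_top_of_le_ne_top ENNReal.one_ne_top e1
        lift q to ℝ≥0 using ne_top_of_le_ne_top ENNReal.one_ne_top e2
        have e1' : p ≤ 1 := by exact_mod_cast e1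
        have e2' : q ≤ 1 := by exact_mod_cast e2
        have : 1 - p * q = (1 - p) + (1 - q) * p := by
          rw [← NNReal.coe_inj, NNReal.coe_add, NNReal.coe_mul, NNReal.coe_sub e1',
            NNReal.coe_sub e2', NNReal.coe_sub (mul_le_one' e1' e2')]
          push_cast; ring
        exact_mod_cast this
      · simp [hz]
    simp_rw [h2, h3] at h1
    rw [h1, lintegral_add_left (by fun_prop), ENNReal.expNeg_add, lintegral_const_mul _
      (Measurable.indicator (by fun_prop) hA), lintegral_indicator hA]
  have hL0 : ∫⁻ ω, expNeg (∑' n, f (Z n ω)) ∂μ = C := hZ.laplace f hf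
  have hdiff : ∀ t : ℝ≥0∞, ∫⁻ ω, expNeg (∑' n, f (Z n ω)) * (1 - expNeg (N ω * t)) ∂μ =
      C * (1 - expNeg ((1 - expNeg t) * c)) := fun t => by
    have e : ∀ ω, expNeg (∑' n, f (Z n ω)) * (1 - expNeg (N ω * t)) =
        expNeg (∑' n, f (Z n ω)) - expNeg (∑' n, f (Z n ω)) * expNeg (N ω * t) := fun ω => by
      rw [ENNReal.mul_sub fun _ _ => ENNReal.expNeg_ne_top _, mul_one]
    simp_rw [e]
    rw [lintegral_sub (by fun_prop) (hL t ▸ ENNReal.mul_ne_top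
      (ENNReal.expNeg_ne_top _) (ENNReal.expNeg_ne_top _))
      (ae_of_all _ fun ω => mul_le_of_le_one_right' (ENNReal.expNeg_le_one _)), hL, hL0,
      ENNReal.mul_sub fun _ _ => ENNReal.expNeg_ne_top _, mul_one]
  have hlimL : Tendsto (fun k : ℕ => ∫⁻ ω, expNeg (∑' n, f (Z n ω)) *
      (2 ^ k * (1 - expNeg (N ω * (2 ^ k)⁻¹))) ∂μ) atTop
      (𝓝 (∫⁻ ω, expNeg (∑' n, f (Z n ω)) * N ω ∂μ)) := by
    refine lintegral_tendsto_of_tendsto_of_monotone (fun k => by fun_prop)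
      (ae_of_all _ fun ω k l hkl => ?_) (ae_of_all _ fun ω => ?_)
    · exact mul_le_mul' le_rfl (ENNReal.monotone_two_pow_mul_one_sub_expNeg (N ω) hkl)
    · exact ENNReal.Tendsto.const_mul (ENNReal.tendsto_two_pow_mul_one_sub_expNeg _)
        (Or.inr (ENNReal.expNeg_ne_top _))
  have hlimR : Tendsto (fun k : ℕ => C * (2 ^ k *
      (1 - expNeg ((1 - expNeg ((2 ^ k)⁻¹)) * c)))) atTop (𝓝 (C * c)) := by
    refine ENNReal.Tendsto.const_mul ?_ (Or.inr (ENNReal.expNeg_ne_top _))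
    clear_value c
    lift c to ℝ≥0 using hcfin
    have hd : HasDerivAt (fun t : ℝ => 1 - Real.exp (-((1 - Real.exp (-t)) * c))) c 0 := by
      have := (((((hasDerivAt_id (0 : ℝ)).neg.exp).const_sub 1).mul_const
        (c : ℝ)).neg.exp).const_sub 1
      simpa using this
    have h1 := hd.tendsto_slope_zero_right
    have h2 : Tendsto (fun k : ℕ => ((2 : ℝ) ^ k)⁻¹) atTop (𝓝[>] 0) := by
      refine tendsto_nhdsWithin_iff.2 ⟨?_, .of_forall fun k => by simp⟩
      exact tendsto_inv_atTop_zero.comp (tendsto_pow_atTop_atTop_of_one_lt (by norm_num))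
    have h3 := (ENNReal.continuous_ofReal.tendsto _).comp (h1.comp h2)
    simp only [ENNReal.ofReal_coe_nnreal] at h3
    refine h3.congr fun k => ?_
    have e1 : ((2 : ℝ≥0∞) ^ k)⁻¹ = ENNReal.ofReal (((2 : ℝ) ^ k)⁻¹) := by
      rw [ENNReal.ofReal_inv_of_pos (by positivity), ENNReal.ofReal_pow (by norm_num)]
      simp
    have hp : 0 ≤ 1 - Real.exp (-((2 : ℝ) ^ k)⁻¹) := by
      rw [sub_nonneg, Real.exp_le_one_iff, neg_nonpos]; positivity
    have e2 : (1 - expNeg ((2 ^ k)⁻¹)) * (c : ℝ≥0∞) =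
        ENNReal.ofReal ((1 - Real.exp (-((2 : ℝ) ^ k)⁻¹)) * c) := by
      rw [e1, ENNReal.expNeg_ofReal (by positivity), ENNReal.ofReal_mul hp,
        ENNReal.ofReal_sub _ (Real.exp_nonneg _)]
      simp
    rw [e2, ENNReal.expNeg_ofReal (by positivity)]
    simp only [Function.comp, zero_add, neg_zero, Real.exp_zero, sub_self, sub_zero, zero_mul,
      inv_inv, smul_eq_mul]
    rw [ENNReal.ofReal_mul (by positivity), ENNReal.ofReal_pow (by norm_num),
      ENNReal.ofReal_sub _ (Real.exp_nonneg _)]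
    simp
  have hk : ∀ k : ℕ, ∫⁻ ω, expNeg (∑' n, f (Z n ω)) *
      (2 ^ k * (1 - expNeg (N ω * (2 ^ k)⁻¹))) ∂μ =
      C * (2 ^ k * (1 - expNeg ((1 - expNeg ((2 ^ k)⁻¹)) * c))) := fun k => by
    simp_rw [mul_left_comm _ ((2 : ℝ≥0∞) ^ k)]
    rw [lintegral_const_mul _ (by fun_prop), hdiff]
  simp_rw [hk] at hlimL
  have := tendsto_nhds_unique hlimL hlimR
  rw [mul_comm c C, ← this]
  exact lintegral_congr fun ω => mul_comm _ _

variable [SigmaFinite ν]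

/-- Passes from counts in sets of finite measure to arbitrary weights. The chosen point still
contributes to the exponent here, whence the factor `e^{-f(z)}` on the right. -/
lemma IsPoissonEnum.tsum_lintegral_mul_expNeg (hZ : IsPoissonEnum μ Z ν) {f : E → ℝ≥0∞}
    (hf : Measurable f) {w : E → ℝ≥0∞} (hw : Measurable w) :
    ∑' n, ∫⁻ ω, w (Z n ω) * expNeg (∑' m, f (Z m ω)) ∂μ =
      (∫⁻ z, w z * expNeg (f z) ∂ν) * expNeg (∫⁻ z, (1 - expNeg (f z)) ∂ν) := by
  have hSm := hZ.measurable_tsum hf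
  rw [tsum_lintegral_eq_of_indicator hZ.measurable (ν := ν)
    (R := fun z => expNeg (f z) * expNeg (∫⁻ z, (1 - expNeg (f z)) ∂ν))
    (fun n => by fun_prop) (by fun_prop) (fun A hA hfin => ?_) hw,
    ← lintegral_mul_const _ (by fun_prop)]
  · simp_rw [mul_assoc]
  · rw [lintegral_mul_const _ (by fun_prop), ← hZ.lintegral_count_mul_expNeg hf hA hfin,
      ← lintegral_tsum]
    · simp_rw [ENNReal.tsum_mul_right]
    · intro n
      exact (((measurable_one.indicator hA).comp (hZ.measurable n)).mul (by fun_prop)).aemeasurable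

/-- The Campbell formula. -/
lemma IsPoissonEnum.tsum_lintegral (hZ : IsPoissonEnum μ Z ν) {w : E → ℝ≥0∞}
    (hw : Measurable w) : ∑' n, ∫⁻ ω, w (Z n ω) ∂μ = ∫⁻ z, w z ∂ν := by
  simpa using hZ.tsum_lintegral_mul_expNeg (f := 0) measurable_zero hw

/-- The reduced Campbell formula for an exponential functional of the remaining points. -/
lemma IsPoissonEnum.tsum_lintegral_mul_expNeg_others (hZ : IsPoissonEnum μ Z ν) {f : E → ℝ≥0∞}
    (hf : Measurable f) {u : E → ℝ≥0∞} (hu : Measurable u) (huf : ∀ z, u z ≠ 0 → f z ≠ ⊤) :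
    ∑' n, ∫⁻ ω, u (Z n ω) * expNeg (∑' m, if m = n then 0 else f (Z m ω)) ∂μ =
      (∫⁻ z, u z ∂ν) * expNeg (∫⁻ z, (1 - expNeg (f z)) ∂ν) := by
  -- Dividing the weight by `e^{-f}` cancels the contribution of the chosen point itself; this needs
  -- `f` finite wherever the weight is nonzero.
  have key : ∀ z, u z * (expNeg (f z))⁻¹ * expNeg (f z) = u z := fun z => by
    by_cases hz : u z = 0
    · simp [hz]
    · rw [mul_assoc, ENNReal.inv_mul_cancel, mul_one]
      · rw [Ne, ENNReal.expNeg_eq_zero_iff]; exact huf z hz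
      · exact ENNReal.expNeg_ne_top _
  have h := hZ.tsum_lintegral_mul_expNeg hf (w := fun z => u z * (expNeg (f z))⁻¹) (by fun_prop)
  simp_rw [key] at h
  rw [← h]
  refine tsum_congr fun n => lintegral_congr fun ω => ?_
  rw [ENNReal.expNeg_tsum_ite (f := fun m => f (Z m ω)) n, ← mul_assoc, key]

lemma measurable_tsum_others (hZ : ∀ n, Measurable (Z n)) {f : E → E → ℝ≥0∞}
    (hf : Measurable (Function.uncurry f)) (n : ℕ) :
    Measurable fun ω => ∑' m, if m = n then 0 else f (Z n ω) (Z m ω) := by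
  refine Measurable.tsum fun m => ?_
  split_ifs
  · exact measurable_const
  · exact hf.comp ((hZ n).prodMk (hZ m))

/-- The reduced Campbell formula when the functional of the remaining points depends on the chosen
point through countably many classes. -/
lemma IsPoissonEnum.tsum_lintegral_mul_expNeg_others_of_countable (hZ : IsPoissonEnum μ Z ν)
    {I : Type*} [Countable I] [MeasurableSpace I] [MeasurableSingletonClass I]
    {c : E → I} (hc : Measurable c) {v : I → E → ℝ≥0∞} (hv : ∀ j, Measurable (v j))
    {u : E → ℝ≥0∞} (hu : Measurable u) (huv : ∀ z, u z ≠ 0 → v (c z) z ≠ ⊤) :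
    ∑' n, ∫⁻ ω, u (Z n ω) * expNeg (∑' m, if m = n then 0 else v (c (Z n ω)) (Z m ω)) ∂μ =
      ∫⁻ z, u z * expNeg (∫⁻ z', (1 - expNeg (v (c z) z')) ∂ν) ∂ν := by
  classical
  have hcj : ∀ j, MeasurableSet (c ⁻¹' {j}) := fun j => hc (measurableSet_singleton j)
  have hsum : ∀ (g : I → ℝ≥0∞) (z : E),
      ∑' j, (c ⁻¹' {j}).indicator u z * g j = u z * g (c z) := fun g z => by
    rw [tsum_eq_single (c z)]
    · simp
    · intro j hj
      have : z ∉ c ⁻¹' {j} := fun h => hj (h : c z = j).symm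
      simp [this]
  -- Within one class the exponent no longer depends on the chosen point, so the formula for a fixed
  -- function applies.
  have hj : ∀ j, ∑' n, ∫⁻ ω, (c ⁻¹' {j}).indicator u (Z n ω) *
      expNeg (∑' m, if m = n then 0 else v j (Z m ω)) ∂μ =
      ∫⁻ z, (c ⁻¹' {j}).indicator u z * expNeg (∫⁻ z', (1 - expNeg (v j z')) ∂ν) ∂ν := fun j => by
    rw [hZ.tsum_lintegral_mul_expNeg_others (hv j) (hu.indicator (hcj j)),
      lintegral_mul_const _ (hu.indicator (hcj j))]
    intro z hz
    rw [indicator_apply_ne_zero] at hz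
    have h1 : c z = j := hz.1
    rw [← h1]; exact huv z hz.2
  have hm : ∀ j n, Measurable fun ω => (c ⁻¹' {j}).indicator u (Z n ω) *
      expNeg (∑' m, if m = n then 0 else v j (Z m ω)) := fun j n => by
    refine ((hu.indicator (hcj j)).comp (hZ.measurable n)).mul
      (ENNReal.measurable_expNeg.comp ?_)
    exact measurable_tsum_others hZ.measurable (f := fun _ => v j)
      ((hv j).comp measurable_snd) n
  have hs := tsum_congr (L := .unconditional I) hj
  have hm' : ∀ j, Measurable fun z => (c ⁻¹' {j}).indicator u z *
      expNeg (∫⁻ z', (1 - expNeg (v j z')) ∂ν) := fun j =>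
    (hu.indicator (hcj j)).mul measurable_const
  rw [ENNReal.tsum_comm, ← lintegral_tsum fun j => (hm' j).aemeasurable] at hs
  simp_rw [hsum (fun j => expNeg (∫⁻ z', (1 - expNeg (v j z')) ∂ν))] at hs
  rw [← hs]
  refine tsum_congr fun n => ?_
  rw [← lintegral_tsum fun j => (hm j n).aemeasurable]
  refine lintegral_congr fun ω => ?_
  rw [hsum (fun j => expNeg (∑' m, if m = n then 0 else v j (Z m ω)))]

end Poisson

/-! ### Dyadic approximation from above -/

/-- The least multiple of `2⁻ᵏ` that exceeds `x`. -/
noncomputable def dyadicAbove (k : ℕ) (j : ℕ) : ℝ := (j + 1) / 2 ^ k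

/-- Strictness holds at dyadic points too. It keeps the exponent of the chosen point at the rounded
level finite, as the reduced Campbell formula requires. -/
lemma lt_dyadicAbove (k : ℕ) (x : ℝ) : x < dyadicAbove k ⌊2 ^ k * x⌋₊ := by
  rw [dyadicAbove, lt_div_iff₀ (by positivity), mul_comm]
  exact Nat.lt_floor_add_one _

lemma antitone_dyadicAbove (x : ℝ) : Antitone fun k => dyadicAbove k ⌊2 ^ k * x⌋₊ := by
  refine antitone_nat_of_succ_le fun k => ?_
  have h : ⌊2 ^ (k + 1) * x⌋₊ + 1 ≤ 2 * (⌊2 ^ k * x⌋₊ + 1) := by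
    refine Nat.succ_le_of_lt ((Nat.floor_lt' (by omega)).2 ?_)
    have := Nat.lt_floor_add_one (2 ^ k * x)
    push_cast
    rw [pow_succ]
    linarith
  have h' : ((⌊2 ^ (k + 1) * x⌋₊ : ℝ) + 1) ≤ 2 * (⌊2 ^ k * x⌋₊ + 1) := by exact_mod_cast h
  simp only [dyadicAbove]
  have e : (2 : ℝ) ^ (k + 1) = 2 * 2 ^ k := pow_succ' 2 k
  generalize (⌊2 ^ (k + 1) * x⌋₊ : ℝ) = p at h' ⊢
  rw [e, div_le_div_iff₀ (by positivity) (by positivity), mul_left_comm, ← mul_assoc]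
  gcongr

lemma tendsto_dyadicAbove {x : ℝ} (hx : 0 ≤ x) :
    Tendsto (fun k => dyadicAbove k ⌊2 ^ k * x⌋₊) atTop (𝓝[>] x) := by
  refine tendsto_nhdsWithin_iff.2 ⟨?_, .of_forall fun k => lt_dyadicAbove k x⟩
  have h2 : Tendsto (fun k : ℕ => x + ((2 : ℝ) ^ k)⁻¹) atTop (𝓝 (x + 0)) :=
    tendsto_const_nhds.add
      (tendsto_inv_atTop_zero.comp (tendsto_pow_atTop_atTop_of_one_lt (by norm_num)))
  rw [add_zero] at h2
  refine tendsto_of_tendsto_of_tendsto_of_le_of_le tendsto_const_nhds h2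
    (fun k => (lt_dyadicAbove k x).le) fun k => ?_
  have := Nat.floor_le (a := 2 ^ k * x) (by positivity)
  change dyadicAbove k ⌊2 ^ k * x⌋₊ ≤ x + ((2 : ℝ) ^ k)⁻¹
  rw [dyadicAbove, div_le_iff₀ (by positivity), add_mul, inv_mul_cancel₀ (by positivity)]
  linarith

lemma ENNReal.tendsto_tsum_of_monotone {f : ℕ → ℕ → ℝ≥0∞} {g : ℕ → ℝ≥0∞}
    (hf : ∀ m, Monotone fun k => f k m) (h : ∀ m, Tendsto (fun k => f k m) atTop (𝓝 (g m))) :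
    Tendsto (fun k => ∑' m, f k m) atTop (𝓝 (∑' m, g m)) := by
  simp_rw [← lintegral_count]
  exact lintegral_tendsto_of_tendsto_of_monotone (fun k => measurable_from_nat.aemeasurable)
    (ae_of_all _ hf) (ae_of_all _ h)

lemma ENNReal.tendsto_tsum_of_dominated {f : ℕ → ℕ → ℝ≥0∞} {g b : ℕ → ℝ≥0∞}
    (hb : ∀ k m, f k m ≤ b m) (hfin : ∑' m, b m ≠ ⊤)
    (h : ∀ m, Tendsto (fun k => f k m) atTop (𝓝 (g m))) :
    Tendsto (fun k => ∑' m, f k m) atTop (𝓝 (∑' m, g m)) := by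
  simp_rw [← lintegral_count]
  exact tendsto_lintegral_of_dominated_convergence b (fun k => measurable_from_nat)
    (fun k => ae_of_all _ (hb k)) (by rwa [lintegral_count]) (ae_of_all _ h)

/-! ### The Campbell formula with a real level; finiteness and separation of points -/

section Poisson

variable {Ω E : Type*} [MeasurableSpace Ω] [MeasurableSpace E] {μ : Measure Ω}
  {Z : ℕ → Ω → E} {ν : Measure E} [SigmaFinite ν]

/-- The reduced Campbell formula for an exponential functional of the remaining points that
depends on the chosen point through a real level. -/
lemma IsPoissonEnum.tsum_lintegral_mul_expNeg_others_of_level (hZ : IsPoissonEnum μ Z ν)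
    {T : E → ℝ} (hT : Measurable T) (hT0 : ∀ z, 0 ≤ T z) {v : ℝ → E → ℝ≥0∞}
    (hv : Measurable (Function.uncurry v)) (hfin : ∀ a z, T z < a → v a z ≠ ⊤)
    (hanti : ∀ z, Antitone fun a => v a z)
    (hcont : ∀ z a, 0 ≤ a → ContinuousWithinAt (fun a => v a z) (Ioi a) a)
    {u : E → ℝ≥0∞} (hu : Measurable u) :
    ∑' n, ∫⁻ ω, u (Z n ω) * expNeg (∑' m, if m = n then 0 else v (T (Z n ω)) (Z m ω)) ∂μ =
      ∫⁻ z, u z * expNeg (∫⁻ z', (1 - expNeg (v (T z) z')) ∂ν) ∂ν := by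
  have hvm : ∀ a, Measurable (v a) := fun a => hv.comp measurable_prodMk_left
  have hvT : Measurable (Function.uncurry fun z z' => v (T z) z') :=
    hv.comp ((hT.comp measurable_fst).prodMk measurable_snd)
  refine tsum_lintegral_eq_of_indicator hZ.measurable (fun n => ?_) ?_ (fun A hA hAfin => ?_) hu
  · exact ENNReal.measurable_expNeg.comp
      (measurable_tsum_others hZ.measurable (f := fun z z' => v (T z) z') hvT n)
  · refine ENNReal.measurable_expNeg.comp (Measurable.lintegral_prod_right ?_)
    exact measurable_const.sub (ENNReal.measurable_expNeg.comp hvT)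
  have hind : Measurable (A.indicator (1 : E → ℝ≥0∞)) := measurable_one.indicator hA
  have hTk : ∀ k : ℕ, Measurable fun z => ⌊2 ^ k * T z⌋₊ := fun k =>
    Nat.measurable_floor.comp (by fun_prop)
  -- Rounding the level up to the grid `2⁻ᵏ` leaves countably many classes; right continuity and
  -- monotonicity in the level then carry the formula to the limit.
  have hk := fun k : ℕ => hZ.tsum_lintegral_mul_expNeg_others_of_countable (hTk k)
    (v := fun j => v (dyadicAbove k j)) (fun j => hvm _) hind
    (fun z _ => hfin _ _ (lt_dyadicAbove k (T z)))
  have hmono : ∀ z (a : ℝ), Monotone fun k => v (dyadicAbove k ⌊2 ^ k * a⌋₊) z :=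
    fun z a k l hkl => hanti z (antitone_dyadicAbove a hkl)
  have hlim : ∀ z a, 0 ≤ a →
      Tendsto (fun k => v (dyadicAbove k ⌊2 ^ k * a⌋₊) z) atTop (𝓝 (v a z)) :=
    fun z a ha => (hcont z a ha).tendsto.comp (tendsto_dyadicAbove ha)
  have hL : Tendsto (fun k : ℕ => ∑' n, ∫⁻ ω, A.indicator 1 (Z n ω) *
      expNeg (∑' m, if m = n then 0 else v (dyadicAbove k ⌊2 ^ k * T (Z n ω)⌋₊) (Z m ω)) ∂μ) atTop
      (𝓝 (∑' n, ∫⁻ ω, A.indicator 1 (Z n ω) *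
        expNeg (∑' m, if m = n then 0 else v (T (Z n ω)) (Z m ω)) ∂μ)) := by
    -- The Campbell formula supplies the summable dominating sequence `P(Zₙ ∈ A)`.
    have hsum : ∑' n, ∫⁻ ω, A.indicator 1 (Z n ω) ∂μ = ν A := by
      rw [hZ.tsum_lintegral hind, lintegral_indicator_one hA]
    have hn : ∀ n, ∫⁻ ω, A.indicator 1 (Z n ω) ∂μ ≠ ⊤ := fun n =>
      ne_top_of_le_ne_top (hsum ▸ hAfin.ne) (ENNReal.le_tsum n)
    have hle : ∀ (y : ℝ≥0∞) (ω : Ω) n, A.indicator (1 : E → ℝ≥0∞) (Z n ω) * expNeg y ≤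
        A.indicator 1 (Z n ω) := fun y ω n => mul_le_of_le_one_right' (ENNReal.expNeg_le_one _)
    refine ENNReal.tendsto_tsum_of_dominated (b := fun n => ∫⁻ ω, A.indicator 1 (Z n ω) ∂μ)
      (fun k n => lintegral_mono fun ω => hle _ ω n) (hsum ▸ hAfin.ne) fun n => ?_
    refine tendsto_lintegral_of_dominated_convergence (fun ω => A.indicator 1 (Z n ω))
      (fun k => ?_) (fun k => ae_of_all _ fun ω => hle _ ω n) (hn n) (ae_of_all _ fun ω => ?_)
    · refine (hind.comp (hZ.measurable n)).mul (ENNReal.measurable_expNeg.comp ?_)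
      refine measurable_tsum_others hZ.measurable
        (f := fun z z' => v (dyadicAbove k ⌊2 ^ k * T z⌋₊) z') ?_ n
      refine hv.comp (Measurable.prodMk ?_ measurable_snd)
      exact (measurable_from_nat (f := dyadicAbove k)).comp ((hTk k).comp measurable_fst)
    · refine ENNReal.Tendsto.const_mul ((ENNReal.continuous_expNeg.tendsto _).comp ?_)
        (Or.inr (ne_top_of_le_ne_top ENNReal.one_ne_top (indicator_le_self' (by simp) _)))
      refine ENNReal.tendsto_tsum_of_monotone (fun m k l hkl => ?_) fun m => ?_
      · dsimp only
        split_ifs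
        · exact le_rfl
        · exact hmono _ _ hkl
      · split_ifs
        · exact tendsto_const_nhds
        · exact hlim _ _ (hT0 _)
  have hR : Tendsto (fun k : ℕ => ∫⁻ z, A.indicator 1 z *
      expNeg (∫⁻ z', (1 - expNeg (v (dyadicAbove k ⌊2 ^ k * T z⌋₊) z')) ∂ν) ∂ν) atTop
      (𝓝 (∫⁻ z, A.indicator 1 z * expNeg (∫⁻ z', (1 - expNeg (v (T z) z')) ∂ν) ∂ν)) := by
    refine tendsto_lintegral_of_dominated_convergence (A.indicator 1)
      (fun k => ?_) (fun k => ae_of_all _ fun z => mul_le_of_le_one_right'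
        (ENNReal.expNeg_le_one _)) (by rw [lintegral_indicator_one hA]; exact hAfin.ne)
      (ae_of_all _ fun z => ?_)
    · refine hind.mul (ENNReal.measurable_expNeg.comp (Measurable.lintegral_prod_right ?_))
      refine measurable_const.sub (ENNReal.measurable_expNeg.comp (hv.comp
        (Measurable.prodMk ?_ measurable_snd)))
      exact (measurable_from_nat (f := dyadicAbove k)).comp ((hTk k).comp measurable_fst)
    · refine ENNReal.Tendsto.const_mul ((ENNReal.continuous_expNeg.tendsto _).comp ?_)
        (Or.inr (ne_top_of_le_ne_top ENNReal.one_ne_top (indicator_le_self' (by simp) _)))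
      refine lintegral_tendsto_of_tendsto_of_monotone
        (fun k => by have := hvm (dyadicAbove k ⌊2 ^ k * T z⌋₊); fun_prop)
        (ae_of_all _ fun z' k l hkl => ?_) (ae_of_all _ fun z' => ?_)
      · exact tsub_le_tsub_left (ENNReal.expNeg_antitone (hmono _ _ hkl)) _
      · exact ENNReal.Tendsto.sub tendsto_const_nhds
          ((ENNReal.continuous_expNeg.tendsto _).comp (hlim z' _ (hT0 z)))
          (Or.inl ENNReal.one_ne_top)
  simp_rw [hk] at hL
  rw [tendsto_nhds_unique hL hR, ← lintegral_indicator hA]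
  refine lintegral_congr fun z => ?_
  by_cases hz : z ∈ A <;> simp [hz]

/-- By the Campbell formula the mean number of points in `A` is `ν A`, so the number itself is
almost surely finite. -/
lemma IsPoissonEnum.ae_finite (hZ : IsPoissonEnum μ Z ν) {A : Set E} (hA : MeasurableSet A)
    (hfin : ν A < ⊤) : ∀ᵐ ω ∂μ, {n | Z n ω ∈ A}.Finite := by
  have hind : Measurable (A.indicator (1 : E → ℝ≥0∞)) := measurable_one.indicator hA
  have h := hZ.tsum_lintegral hind
  have hm : ∀ n, Measurable fun ω => A.indicator (1 : E → ℝ≥0∞) (Z n ω) :=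
    fun n => hind.comp (hZ.measurable n)
  rw [lintegral_indicator_one hA, ← lintegral_tsum fun n => (hm n).aemeasurable] at h
  filter_upwards [ae_lt_top (hZ.measurable_tsum hind) (h ▸ hfin.ne)] with ω hω
  by_contra hinf
  have h1 : ∑' n, A.indicator (1 : E → ℝ≥0∞) (Z n ω) = ({n | Z n ω ∈ A}.encard : ℝ≥0∞) := by
    rw [← ENNReal.tsum_set_one, tsum_subtype {n | Z n ω ∈ A} (fun _ => (1 : ℝ≥0∞))]
    rfl
  rw [h1, Set.Infinite.encard_eq hinf] at hω
  simp at hω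

lemma IsPoissonEnum.ae_forall_notMem (hZ : IsPoissonEnum μ Z ν) {A : Set E}
    (hA : MeasurableSet A) (h0 : ν A = 0) : ∀ᵐ ω ∂μ, ∀ n, Z n ω ∉ A := by
  have hind : Measurable (A.indicator (1 : E → ℝ≥0∞)) := measurable_one.indicator hA
  have h := hZ.tsum_lintegral hind
  rw [lintegral_indicator_one hA, h0, ENNReal.tsum_eq_zero] at h
  refine ae_all_iff.2 fun n => ?_
  filter_upwards [(lintegral_eq_zero_iff (hind.comp (hZ.measurable n))).1 (h n)] with ω hω hmem
  simp [hmem] at hω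

/-- If no level of `T` is charged by the intensity then `T` separates the points. -/
lemma IsPoissonEnum.ae_injective (hZ : IsPoissonEnum μ Z ν) {T : E → ℝ} (hT : Measurable T)
    (h0 : ∀ t, ν (T ⁻¹' {t}) = 0) : ∀ᵐ ω ∂μ, Function.Injective fun n => T (Z n ω) := by
  have main : ∀ A, MeasurableSet A → ν A < ⊤ → ∀ᵐ ω ∂μ, ∀ n m, n ≠ m →
      Z n ω ∈ A → Z m ω ∈ A → T (Z n ω) ≠ T (Z m ω) := by
    intro A hA hAfin
    have hind : Measurable (A.indicator (1 : E → ℝ≥0∞)) := measurable_one.indicator hA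
    -- For `z ∈ A`, `w z` marks the points of `A` on the level of `z`. With `Dₙ` the exponential of
    -- minus the number of other points sharing the level of `Zₙ`, the aim is `Dₙ = 1` almost surely
    -- on `Zₙ ∈ A`. Levels are enlarged to dyadic cells, of which there are countably many for each
    -- `k`.
    let w : E → E → ℝ≥0∞ := fun z z' => (A ∩ T ⁻¹' {T z}).indicator 1 z'
    have hw : Measurable (Function.uncurry w) := by
      have : Function.uncurry w = ({q : E × E | q.2 ∈ A ∧ T q.2 = T q.1}).indicator 1 := by
        funext q
        simp only [Function.uncurry, w, indicator]
        rfl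
      rw [this]
      refine measurable_one.indicator ((measurable_snd hA).inter ?_)
      exact measurableSet_eq_fun (hT.comp measurable_snd) (hT.comp measurable_fst)
    let c : ℕ → E → ℤ := fun k z => ⌊2 ^ k * T z⌋
    have hc : ∀ k, Measurable (c k) := fun k => Int.measurable_floor.comp (by fun_prop)
    let cell : ℕ → ℤ → Set E := fun k j => A ∩ c k ⁻¹' {j}
    have hcell : ∀ k j, MeasurableSet (cell k j) :=
      fun k j => hA.inter (hc k (measurableSet_singleton j))
    have hk := fun k : ℕ => hZ.tsum_lintegral_mul_expNeg_others_of_countable (hc k)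
      (v := fun j => (cell k j).indicator 1) (fun j => measurable_one.indicator (hcell k j)) hind
      (fun z _ => ne_top_of_le_ne_top ENNReal.one_ne_top (indicator_le_self' (by simp) _))
    have hsum : ∑' n, ∫⁻ ω, A.indicator 1 (Z n ω) ∂μ = ν A := by
      rw [hZ.tsum_lintegral hind, lintegral_indicator_one hA]
    let D : ℕ → Ω → ℝ≥0∞ := fun n ω => expNeg (∑' m, if m = n then 0 else w (Z n ω) (Z m ω))
    have hDm : ∀ n, Measurable (D n) := fun n =>
      ENNReal.measurable_expNeg.comp (measurable_tsum_others hZ.measurable hw n)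
    have h_int : ∀ k z, ∫⁻ z', (1 - expNeg ((cell k (c k z)).indicator 1 z')) ∂ν =
        (1 - expNeg 1) * ν (cell k (c k z)) := fun k z => by
      rw [← lintegral_indicator_const (hcell k _)]
      refine lintegral_congr fun z' => ?_
      by_cases hz : z' ∈ cell k (c k z) <;> simp [hz]
    have hlim : Tendsto (fun k => ∫⁻ z, A.indicator 1 z *
        expNeg (∫⁻ z', (1 - expNeg ((cell k (c k z)).indicator 1 z')) ∂ν) ∂ν) atTop
        (𝓝 (∫⁻ z, A.indicator 1 z * expNeg 0 ∂ν)) := by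
      simp_rw [h_int]
      refine tendsto_lintegral_of_dominated_convergence (A.indicator 1)
        (fun k => ?_) (fun k => ae_of_all _ fun z => mul_le_of_le_one_right'
          (ENNReal.expNeg_le_one _)) (by rw [lintegral_indicator_one hA]; exact hAfin.ne)
        (ae_of_all _ fun z => ?_)
      · refine hind.mul (ENNReal.measurable_expNeg.comp (measurable_const.mul ?_))
        exact (measurable_from_top (f := fun j : ℤ => ν (cell k j))).comp (hc k)
      · refine ENNReal.Tendsto.const_mul ((ENNReal.continuous_expNeg.tendsto _).comp ?_)
          (Or.inr (ne_top_of_le_ne_top ENNReal.one_ne_top (indicator_le_self' (by simp) _)))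
        rw [← mul_zero (1 - expNeg 1)]
        refine ENNReal.Tendsto.const_mul ?_ (Or.inr (by simp))
        -- The cell of `z` lies in `B k`, and the sets `B k` shrink to the part of the level of `z`
        -- in `A`, which is null; so the mass of the cell tends to `0`.
        let B : ℕ → Set E := fun k => A ∩ T ⁻¹' (Metric.closedBall (T z) ((2 : ℝ) ^ k)⁻¹)
        have hB : Tendsto (fun k => ν (B k)) atTop (𝓝 (ν (⋂ k, B k))) := by
          refine tendsto_measure_iInter_atTop (fun k => ?_) (fun k l hkl => ?_) ⟨0, ?_⟩
          · exact (hA.inter (hT measurableSet_closedBall)).nullMeasurableSet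
          · refine inter_subset_inter_right _
              (preimage_mono (Metric.closedBall_subset_closedBall ?_))
            gcongr
            norm_num
          · exact ((measure_mono inter_subset_left).trans_lt hAfin).ne
        have hB0 : ν (⋂ k, B k) = 0 := by
          refine measure_mono_null (fun z' hz' => ?_) (h0 (T z))
          have h2 : Tendsto (fun k : ℕ => ((2 : ℝ) ^ k)⁻¹) atTop (𝓝 0) :=
            tendsto_inv_atTop_zero.comp (tendsto_pow_atTop_atTop_of_one_lt (by norm_num))
          have h3 : Dist.dist (T z') (T z) ≤ 0 :=
            ge_of_tendsto' h2 fun k => (mem_iInter.1 hz' k).2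
          exact dist_le_zero.1 h3
        rw [hB0] at hB
        refine tendsto_of_tendsto_of_tendsto_of_le_of_le tendsto_const_nhds hB
          (fun _ => zero_le) fun k => measure_mono ?_
        rintro z' ⟨hz'A, hz'⟩
        refine ⟨hz'A, ?_⟩
        have h3 : ⌊2 ^ k * T z'⌋ = ⌊2 ^ k * T z⌋ := hz'
        have h4 := Int.abs_sub_lt_one_of_floor_eq_floor h3
        rw [mem_preimage, Metric.mem_closedBall, Real.dist_eq]
        rw [← mul_sub, abs_mul, abs_of_pos (by positivity)] at h4
        rw [← one_div, le_div_iff₀ (by positivity), mul_comm]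
        exact h4.le
    -- A level lies in its cell, so `Dₙ` dominates the functional built from cells, whose total
    -- tends to `ν A`. But `ν A` is also the total of the `P(Zₙ ∈ A)`, so no term can lose any mass.
    have hge : ν A ≤ ∑' n, ∫⁻ ω, A.indicator 1 (Z n ω) * D n ω ∂μ := by
      have e : ∫⁻ z, A.indicator 1 z * expNeg 0 ∂ν = ν A := by
        simp [lintegral_indicator_one hA]
      rw [← e]
      refine le_of_tendsto' hlim fun k => ?_
      rw [← hk k]
      refine ENNReal.tsum_le_tsum fun n => lintegral_mono fun ω => ?_
      refine mul_le_mul' le_rfl (ENNReal.expNeg_antitone (ENNReal.tsum_le_tsum fun m => ?_))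
      split_ifs
      · exact le_rfl
      · refine indicator_le_indicator_of_subset (inter_subset_inter_right _ fun z' hz' => ?_)
          (fun _ => zero_le) _
        have h3 : T z' = T (Z n ω) := hz'
        simp [c, h3]
    have hle : ∀ n ω, A.indicator (1 : E → ℝ≥0∞) (Z n ω) * D n ω ≤ A.indicator 1 (Z n ω) :=
      fun n ω => mul_le_of_le_one_right' (ENNReal.expNeg_le_one _)
    have heq : ∀ n, ∀ᵐ ω ∂μ,
        A.indicator (1 : E → ℝ≥0∞) (Z n ω) * D n ω = A.indicator 1 (Z n ω) := fun n => by
      have hn : ∫⁻ ω, A.indicator 1 (Z n ω) ∂μ ≠ ⊤ :=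
        ne_top_of_le_ne_top (hsum ▸ hAfin.ne) (ENNReal.le_tsum n)
      refine ae_eq_of_ae_le_of_lintegral_le (ae_of_all _ (hle n))
        (ne_top_of_le_ne_top hn (lintegral_mono (hle n)))
        (hind.comp (hZ.measurable n)).aemeasurable ?_
      by_contra hlt
      push Not at hlt
      have := ENNReal.tsum_lt_tsum (i := n)
        (ne_top_of_le_ne_top (hsum ▸ hAfin.ne)
          (ENNReal.tsum_le_tsum fun n => lintegral_mono (hle n)))
        (fun n => lintegral_mono (hle n)) hlt
      rw [hsum] at this
      exact absurd hge (not_le.2 this)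
    filter_upwards [ae_all_iff.2 heq] with ω hω n m hnm hnA hmA hT
    have h1 := hω n
    simp only [hnA, indicator_of_mem, Pi.one_apply, one_mul, D] at h1
    rw [ENNReal.expNeg_eq_one_iff, ENNReal.tsum_eq_zero] at h1
    have h2 := h1 m
    have h3 : Z m ω ∈ A ∩ T ⁻¹' {T (Z n ω)} := ⟨hmA, hT.symm⟩
    simp [hnm.symm, w, h3] at h2
  filter_upwards [ae_all_iff.2 fun j => main _ (measurableSet_spanningSets ν j)
    (measure_spanningSets_lt_top ν j)] with ω hω n m hnm
  by_contra hne
  let j := max (spanningSetsIndex ν (Z n ω)) (spanningSetsIndex ν (Z m ω))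
  exact hω j n m hne
    (monotone_spanningSets ν (le_max_left _ _) (mem_spanningSetsIndex ν _))
    (monotone_spanningSets ν (le_max_right _ _) (mem_spanningSetsIndex ν _)) hnm

end Poisson

/-! ### Radial integration in the plane -/

lemma lintegral_comp_norm_plane {f : ℝ → ℝ≥0∞} (hf : Measurable f) :
    ∫⁻ x : Plane, f ‖x‖ = ∫⁻ r in Ioi (0 : ℝ), ENNReal.ofReal (2 * Real.pi * r) * f r := by
  have hdim : Module.finrank ℝ Plane = 2 := by simp
  have hmp := (volume : Measure Plane).measurePreserving_homeomorphUnitSphereProd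
  -- The surface measure has mass `dim · area of the unit disc = 2 · π`.
  have hsph : (volume : Measure Plane).toSphere univ = ENNReal.ofReal (2 * Real.pi) := by
    rw [Measure.toSphere_apply_univ, hdim, EuclideanSpace.volume_ball_fin_two,
      ENNReal.ofReal_mul (by norm_num)]
    simp [ENNReal.ofReal, Real.toNNReal_of_nonneg Real.pi_pos.le]
  calc ∫⁻ x : Plane, f ‖x‖
      = ∫⁻ x : ({(0 : Plane)}ᶜ : Set Plane), f ‖x.1‖ ∂(volume.comap Subtype.val) := by
        rw [lintegral_subtype_comap (measurableSet_singleton _).compl fun x : Plane => f ‖x‖,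
          restrict_compl_singleton]
    _ = ∫⁻ q, f q.2 ∂((volume : Measure Plane).toSphere.prod (.volumeIoiPow 1)) := by
        rw [hdim] at hmp
        rw [← hmp.lintegral_comp (f := fun q => f q.2) (by fun_prop)]
        simp
    _ = ENNReal.ofReal (2 * Real.pi) * ∫⁻ r : Ioi (0 : ℝ), f r ∂(.volumeIoiPow 1) := by
        rw [lintegral_prod _ (by fun_prop)]
        simp only [lintegral_const, hsph, mul_comm]
    _ = ENNReal.ofReal (2 * Real.pi) * ∫⁻ r in Ioi (0 : ℝ), ENNReal.ofReal r * f r := by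
        rw [Measure.volumeIoiPow, lintegral_withDensity_eq_lintegral_mul _ (by fun_prop)
          (by fun_prop), ← lintegral_subtype_comap measurableSet_Ioi]
        simp
    _ = _ := by
        rw [← lintegral_const_mul _ (by fun_prop)]
        refine lintegral_congr fun r => ?_
        rw [← mul_assoc, ← ENNReal.ofReal_mul (by positivity)]

/-- The intensity of the distances from a fixed point to a homogeneous Poisson process. -/
noncomputable def radialIntensity (Λ : ℝ) : Measure ℝ :=
  (volume.restrict (Ioi 0)).withDensity fun r => ENNReal.ofReal (2 * Real.pi * Λ * r)

/-- Translation invariance removes `y`, then polar coordinates apply: every receiver sees the same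
law of distances. -/
lemma map_norm_sub_volume {Λ : ℝ} (hΛ : 0 ≤ Λ) (y : Plane) :
    (ENNReal.ofReal Λ • (volume : Measure Plane)).map (fun x => ‖x - y‖) = radialIntensity Λ := by
  refine Measure.ext_of_lintegral _ fun f hf => ?_
  rw [lintegral_map hf (by fun_prop), lintegral_smul_measure,
    lintegral_sub_right_eq_self (fun x : Plane => f ‖x‖) y, lintegral_comp_norm_plane hf,
    radialIntensity, lintegral_withDensity_eq_lintegral_mul _ (by fun_prop) hf, smul_eq_mul,
    ← lintegral_const_mul _ (by fun_prop)]
  refine lintegral_congr fun r => ?_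
  rw [Pi.mul_apply, ← mul_assoc, ← ENNReal.ofReal_mul hΛ]
  congr 2; ring

instance (Λ : ℝ) : SigmaFinite (radialIntensity Λ) := by
  unfold radialIntensity
  infer_instance

/-- For each fixed shift Lebesgue measure is invariant, and averaging over the shift changes
nothing. Hence every tier has the intensity of tier 0, whatever the displacement law. -/
lemma map_add_prod_volume (c : ℝ≥0∞) (κ : Measure Plane) [IsProbabilityMeasure κ] :
    ((c • (volume : Measure Plane)).prod κ).map (fun q => q.1 + q.2) = c • volume := by
  refine Measure.ext_of_lintegral _ fun f hf => ?_
  rw [lintegral_map hf (by fun_prop), Measure.prod_smul_left, lintegral_smul_measure,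
    lintegral_smul_measure, lintegral_prod_symm _ (by fun_prop)]
  simp_rw [lintegral_add_right_eq_self]
  simp

/-! ### The law of the links -/

namespace Network

variable {Ω : Type*} {k : ℕ → ℕ} {N : Network Ω k}

lemma φ_eq_add_sum (N : Network Ω k) (j n : ℕ) (ω : Ω) :
    N.φ j n ω = N.X₀ n ω + ∑ l : Fin j, N.D l n (N.sel l n) ω := by
  induction j with
  | zero => simp [φ]
  | succ j ih =>
    change N.φ j n ω + N.D j n (N.sel j n) ω = _
    rw [ih, Fin.sum_univ_castSucc, add_assoc]
    rfl

variable [MeasurableSpace Ω] {μ : Measure Ω} {p : NetworkParams}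
  {F : Measure ℝ} {i : ℕ}

/-- The position of the transmitter of hop `i + 1` relative to its ancestor in tier `0`. -/
def offset (N : Network Ω k) (i n : ℕ) (ω : Ω) : Plane := ∑ l : Fin i, N.D l n (N.sel l n) ω

lemma IsModel.measurable_offset (hN : N.IsModel μ p F i) (n : ℕ) :
    Measurable (N.offset i n) :=
  Finset.measurable_sum _ fun l _ => hN.measurable_D l l.2 n _

lemma IsModel.measurable_φ (hN : N.IsModel μ p F i) (n : ℕ) : Measurable (N.φ i n) := by
  have : N.φ i n = fun ω => N.X₀ n ω + N.offset i n ω := funext fun ω => N.φ_eq_add_sum i n ω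
  rw [this]
  exact (hN.tier_zero.measurable n).add (hN.measurable_offset n)

/-- Different `n` use disjoint families of displacements, so the offsets are independent; the common
displacement law makes them identically distributed. They can therefore serve as independent marks
of tier 0. -/
lemma IsModel.map_offset [IsProbabilityMeasure μ] (hN : N.IsModel μ p F i) :
    μ.map (fun ω n => N.offset i n ω) =
      Measure.infinitePi fun _ : ℕ => μ.map (N.offset i 0) := by
  let W : ℕ × Fin i → Ω → Plane := fun q => N.D q.2 q.1 (N.sel q.2 q.1)
  have hW : ∀ q, Measurable (W q) := fun q => hN.measurable_D q.2 q.2.2 _ _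
  have hinj : Function.Injective fun q : ℕ × Fin i =>
      (⟨q.2, (q.1, N.sel q.2 q.1)⟩ : Σ j : Fin i, ℕ × Fin (k j)) := by
    rintro ⟨n, j⟩ ⟨n', j'⟩ h
    simp only [Sigma.mk.injEq] at h
    obtain ⟨rfl, h⟩ := h
    simp only [heq_eq_eq, Prod.mk.injEq] at h
    rw [h.1]
  have hind : iIndepFun W μ := hN.iIndep_D.precomp hinj
  have hprob : ∀ n j, IsProbabilityMeasure (μ.map (W (n, j))) := fun n j =>
    Measure.isProbabilityMeasure_map (hW _).aemeasurable
  have h1 : μ.map (fun ω n j => W (n, j) ω) =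
      Measure.infinitePi fun n => Measure.infinitePi fun j => μ.map (W (n, j)) := by
    rw [← Measure.infinitePi_map_curry, ← hind.map_fun_eq_infinitePi_map hW,
      Measure.map_map (by fun_prop) (measurable_pi_lambda _ hW)]
    rfl
  have hlaw : ∀ n j, μ.map (W (n, j)) = p.displacementLaw := fun n j => hN.law_D j j.2 _ _
  have hsum : Measurable fun x : Fin i → Plane => ∑ j, x j := by fun_prop
  have h2 : ∀ n, μ.map (N.offset i n) =
      (Measure.infinitePi fun j => μ.map (W (n, j))).map fun x => ∑ j, x j := fun n => by
    rw [← (hind.precomp (Prod.mk_right_injective n)).map_fun_eq_infinitePi_map fun j => hW (n, j),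
      Measure.map_map hsum (measurable_pi_lambda _ fun j => hW (n, j))]
    rfl
  have h3 : ∀ n, μ.map (N.offset i n) = μ.map (N.offset i 0) := fun n => by
    rw [h2, h2]; simp_rw [hlaw]
  have h4 : μ.map (fun ω n => N.offset i n ω) =
      (μ.map (fun ω n j => W (n, j) ω)).map fun x n => ∑ j, x n j := by
    rw [Measure.map_map (by fun_prop)
      (measurable_pi_lambda _ fun n => measurable_pi_lambda _ fun j => hW (n, j))]
    rfl
  rw [h4, h1, Measure.infinitePi_map_pi _ (fun _ => hsum)]
  simp_rw [← h2, h3]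

/-- The transmitters of every hop form a homogeneous Poisson process. -/
lemma IsModel.isPoissonEnum_φ [IsProbabilityMeasure μ] (hN : N.IsModel μ p F i) :
    IsPoissonEnum μ (N.φ i) (ENNReal.ofReal p.Λ₀ • volume) := by
  have hX := hN.tier_zero.isPoissonEnum p.Λ₀_pos.le
  have hprob : IsProbabilityMeasure (μ.map (N.offset i 0)) :=
    Measure.isProbabilityMeasure_map (hN.measurable_offset 0).aemeasurable
  have hmX : Measurable fun ω n => N.X₀ n ω := measurable_pi_lambda _ hN.tier_zero.measurable
  have hmS : Measurable fun ω n => N.offset i n ω := measurable_pi_lambda _ hN.measurable_offset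
  have hind : IndepFun (fun ω n => N.X₀ n ω) (fun ω n => N.offset i n ω) μ := by
    refine hN.indep_D.comp (φ := id) (ψ := fun x n => ∑ l : Fin i, x ⟨l, (n, N.sel l n)⟩)
      measurable_id ?_
    fun_prop
  have hm := hX.marked hN.measurable_offset (μ.map (N.offset i 0)) (by
    rw [(indepFun_iff_map_prod_eq_prod_map_map hmX.aemeasurable hmS.aemeasurable).1 hind,
      hN.map_offset])
  have := hm.mapped (T := fun q : Plane × Plane => q.1 + q.2) (by fun_prop)
  rw [map_add_prod_volume] at this
  have e : N.φ i = fun n ω => N.X₀ n ω + N.offset i n ω :=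
    funext fun n => funext fun ω => N.φ_eq_add_sum i n ω
  rwa [e]

/-- The law of the marks `(U, h, G)` of a link. -/
noncomputable def markLaw (p : NetworkParams) (F : Measure ℝ) (k : ℕ) : Measure (ℝ × ℝ × ℝ) :=
  (volume.restrict (Icc (0 : ℝ) 1)).prod (F.prod (p.gainLaw k))

/-- The marks `(U, h, G)` of a link. -/
def marks (N : Network Ω k) (n : ℕ) (ω : Ω) : ℝ × ℝ × ℝ := (N.U n ω, N.h n ω, N.G n ω)

lemma IsModel.measurable_marks (hN : N.IsModel μ p F i) (n : ℕ) : Measurable (N.marks n) :=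
  (hN.measurable_U n).prodMk ((hN.measurable_h n).prodMk (hN.measurable_G n))

lemma IsModel.isProbabilityMeasure_markLaw [IsProbabilityMeasure μ] (hN : N.IsModel μ p F i) :
    IsProbabilityMeasure (markLaw p F (k i)) := by
  rw [markLaw, ← hN.law_marks 0]
  exact Measure.isProbabilityMeasure_map (hN.measurable_marks 0).aemeasurable

lemma IsModel.map_φ_marks [IsProbabilityMeasure μ] (hN : N.IsModel μ p F i) :
    μ.map (fun ω => ((fun n => N.φ i n ω), fun n => N.marks n ω)) =
      (μ.map fun ω n => N.φ i n ω).prod (Measure.infinitePi fun _ => markLaw p F (k i)) := by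
  have hmφ : Measurable fun ω n => N.φ i n ω := measurable_pi_lambda _ hN.measurable_φ
  have hmM : Measurable fun ω n => N.marks n ω := measurable_pi_lambda _ hN.measurable_marks
  have hind : IndepFun (fun ω n => N.φ i n ω) (fun ω n => N.marks n ω) μ := by
    have h := hN.indep_marks.comp (φ := fun x n => x.1 n + ∑ l : Fin i, x.2 ⟨l, (n, N.sel l n)⟩)
      (ψ := id) (by fun_prop) measurable_id
    have e : (fun ω n => N.φ i n ω) = (fun x n => x.1 n + ∑ l : Fin i, x.2 ⟨l, (n, N.sel l n)⟩) ∘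
        fun ω => ((fun n => N.X₀ n ω),
          (fun (q : Σ j : Fin i, ℕ × Fin (k j)) => N.D q.1 q.2.1 q.2.2 ω)) := by
      funext ω n
      exact N.φ_eq_add_sum i n ω
    rw [e]
    exact h
  rw [(indepFun_iff_map_prod_eq_prod_map_map hmφ.aemeasurable hmM.aemeasurable).1 hind]
  congr 1
  have := hN.iIndep_marks.map_fun_eq_infinitePi_map hN.measurable_marks
  have e : (fun n => μ.map (N.marks n)) = fun _ => markLaw p F (k i) := funext hN.law_marks
  rwa [e] at this

/-- The link from the `n`-th transmitter: its length together with its marks. -/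
noncomputable def link (N : Network Ω k) (i : ℕ) (y : Plane) (n : ℕ) (ω : Ω) : ℝ × ℝ × ℝ × ℝ :=
  (N.dist i y n ω, N.marks n ω)

/-- The links form a Poisson process. -/
lemma IsModel.isPoissonEnum_link [IsProbabilityMeasure μ] (hN : N.IsModel μ p F i) (y : Plane) :
    IsPoissonEnum μ (N.link i y) ((radialIntensity p.Λ₀).prod (markLaw p F (k i))) := by
  have := hN.isProbabilityMeasure_markLaw
  have h := (hN.isPoissonEnum_φ.marked hN.measurable_marks _ hN.map_φ_marks).mapped
    (T := Prod.map (fun x : Plane => ‖x - y‖) (id : ℝ × ℝ × ℝ → ℝ × ℝ × ℝ)) (by fun_prop)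
  rwa [← Measure.map_prod_map _ _ (by fun_prop) measurable_id,
    map_norm_sub_volume p.Λ₀_pos.le, Measure.map_id] at h

end Network

/-! ### Path loss of a link -/

namespace NetworkParams

variable (p : NetworkParams)

/-- The link `z = (r, U, h, G)` is line-of-sight. -/
def linkLos (z : ℝ × ℝ × ℝ × ℝ) : Prop := z.2.1 < p.PL z.1

open Classical in
/-- The path loss of the link `z = (r, U, h, G)`. -/
noncomputable def linkLoss (z : ℝ × ℝ × ℝ × ℝ) : ℝ :=
  p.β * |z.1| ^ (-(if p.linkLos z then p.αL else p.αN))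

open Classical in
/-- The exponent contributed by the link `z` to the event that no path loss exceeds `a`, together
with the Laplace transform of the interference at `c / a`. -/
noncomputable def shadow (c a : ℝ) (z : ℝ × ℝ × ℝ × ℝ) : ℝ≥0∞ :=
  if a < p.linkLoss z then ⊤
  else ENNReal.ofReal (c * (z.2.2.1 * z.2.2.2 * p.linkLoss z)) / ENNReal.ofReal a

lemma measurableSet_linkLos : MeasurableSet {z | p.linkLos z} :=
  measurableSet_lt (by fun_prop) (p.PL_measurable.comp measurable_fst)

@[fun_prop]
lemma measurable_linkLoss : Measurable p.linkLoss := by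
  refine measurable_const.mul (Measurable.pow (by fun_prop) (Measurable.neg ?_))
  exact Measurable.ite p.measurableSet_linkLos measurable_const measurable_const

/-- The absolute value in `linkLoss` makes this true for negative first coordinates as well, as the
Campbell formula requires of a level function. -/
lemma linkLoss_nonneg (z) : 0 ≤ p.linkLoss z :=
  mul_nonneg p.β_pos.le (Real.rpow_nonneg (abs_nonneg _) _)

lemma linkLoss_of_los {r : ℝ} (hr : 0 ≤ r) {m : ℝ × ℝ × ℝ} (h : m.1 < p.PL r) :
    p.linkLoss (r, m) = p.β * r ^ (-p.αL) := by
  have : p.linkLos (r, m) := h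
  simp [linkLoss, this, abs_of_nonneg hr]

lemma linkLoss_of_not_los {r : ℝ} (hr : 0 ≤ r) {m : ℝ × ℝ × ℝ} (h : ¬ m.1 < p.PL r) :
    p.linkLoss (r, m) = p.β * r ^ (-p.αN) := by
  have : ¬ p.linkLos (r, m) := h
  simp [linkLoss, this, abs_of_nonneg hr]

lemma measurable_shadow (c : ℝ) : Measurable (Function.uncurry (p.shadow c)) := by
  refine Measurable.ite (measurableSet_lt measurable_fst
    (p.measurable_linkLoss.comp measurable_snd)) measurable_const ?_
  have := p.measurable_linkLoss
  fun_prop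

lemma shadow_ne_top (c a : ℝ) (z) (h : p.linkLoss z < a) : p.shadow c a z ≠ ⊤ := by
  rw [shadow, if_neg (not_lt.2 h.le)]
  have ha : 0 < a := (p.linkLoss_nonneg z).trans_lt h
  exact ENNReal.div_ne_top ENNReal.ofReal_ne_top (by simpa using ha)

lemma shadow_antitone (c : ℝ) (z) : Antitone fun a => p.shadow c a z := by
  intro a b hab
  simp only [shadow]
  by_cases h : a < p.linkLoss z
  · simp [h]
  · rw [if_neg h, if_neg fun h' => h (hab.trans_lt h')]
    gcongr

/-- A link blocks the level `a` only if its loss strictly exceeds `a`, so `loss ≤ a` persists to the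
right of `a`, while continuity from the left can fail at `a = loss`. This is why levels are
approximated from above. -/
lemma continuousWithinAt_shadow (c : ℝ) (z) (a : ℝ) :
    ContinuousWithinAt (fun a => p.shadow c a z) (Ioi a) a := by
  by_cases h : a < p.linkLoss z
  · refine ContinuousAt.continuousWithinAt (ContinuousAt.congr (f := fun _ => ⊤)
      continuousAt_const ?_)
    filter_upwards [Iio_mem_nhds h] with b hb
    simp [shadow, show b < p.linkLoss z from hb]
  · have hc : ContinuousWithinAt (fun b => ENNReal.ofReal (c * (z.2.2.1 * z.2.2.2 * p.linkLoss z)) /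
        ENNReal.ofReal b) (Ioi a) a := by
      refine ContinuousAt.continuousWithinAt ?_
      exact ENNReal.Tendsto.const_div (ENNReal.continuous_ofReal.tendsto _)
        (Or.inr ENNReal.ofReal_ne_top)
    refine hc.congr (fun b hb => ?_) ?_
    · rw [shadow, if_neg fun h' => h ((mem_Ioi.1 hb).trans h')]
    · rw [shadow, if_neg h]

end NetworkParams

/-! ### The intensity of the path losses -/

lemma radialIntensity_Iio_lt_top {Λ : ℝ} (hΛ : 0 ≤ Λ) (R : ℝ) :
    radialIntensity Λ (Iio R) < ⊤ := by
  rw [← map_norm_sub_volume hΛ 0, Measure.map_apply (by fun_prop) measurableSet_Iio]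
  have : (fun x : Plane => ‖x - 0‖) ⁻¹' Iio R = Metric.ball 0 R := by ext; simp
  rw [this, Measure.smul_apply, smul_eq_mul]
  exact ENNReal.mul_lt_top ENNReal.ofReal_lt_top measure_ball_lt_top

lemma radialIntensity_Iic_zero (Λ : ℝ) : radialIntensity Λ (Iic 0) = 0 := by
  refine (withDensity_absolutelyContinuous _ _) ?_
  rw [Measure.restrict_apply measurableSet_Iic, Iic_inter_Ioi, Ioc_self, measure_empty]

lemma radialIntensity_eq_zero_of_subsingleton (Λ : ℝ) {S : Set ℝ} (hS : MeasurableSet S)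
    (h : (S ∩ Ioi 0).Subsingleton) : radialIntensity Λ S = 0 := by
  refine (withDensity_absolutelyContinuous _ _) ?_
  rw [Measure.restrict_apply hS]
  exact h.measure_zero _

lemma subsingleton_powerLoss {β α : ℝ} (hβ : 0 < β) (hα : 0 < α) (t : ℝ) :
    ({r : ℝ | β * |r| ^ (-α) = t} ∩ Ioi 0).Subsingleton := by
  rintro r ⟨hr, hr0⟩ s ⟨hs, hs0⟩
  have hr0 : 0 < r := hr0
  have hs0 : 0 < s := hs0
  have h : β * |r| ^ (-α) = β * |s| ^ (-α) := Eq.trans hr (Eq.symm hs)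
  rw [abs_of_pos hr0, abs_of_pos hs0] at h
  have h' := mul_left_cancel₀ hβ.ne' h
  exact (Real.rpow_left_inj hr0.le hs0.le (neg_ne_zero.2 hα.ne')).1 h'

namespace NetworkParams

variable (p : NetworkParams) (κ : Measure (ℝ × ℝ × ℝ)) [IsProbabilityMeasure κ]

/-- For each of the two exponents the loss is injective in the distance, so a level meets the
positive axis in at most two radii. This gives almost sure uniqueness of the best link. -/
lemma linkLoss_level_null (t : ℝ) :
    ((radialIntensity p.Λ₀).prod κ) (p.linkLoss ⁻¹' {t}) = 0 := by
  let S : ℝ → Set ℝ := fun α => {r : ℝ | p.β * |r| ^ (-α) = t}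
  have hS : ∀ α, 0 < α → radialIntensity p.Λ₀ (S α) = 0 := fun α hα =>
    radialIntensity_eq_zero_of_subsingleton _
      (measurableSet_eq_fun (by fun_prop) measurable_const)
      (subsingleton_powerLoss p.β_pos hα t)
  refine measure_mono_null (t := (S p.αL ∪ S p.αN) ×ˢ univ) (fun z hz => ?_) ?_
  · refine ⟨?_, mem_univ _⟩
    have hz' : p.linkLoss z = t := hz
    by_cases h : p.linkLos z
    · left; simpa [S, linkLoss, h] using hz'
    · right; simpa [S, linkLoss, h] using hz'
  · rw [Measure.prod_prod, measure_union_null (hS _ p.αL_pos) (hS _ p.αN_pos), zero_mul]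

lemma linkLoss_gt_lt_top {ε : ℝ} (hε : 0 < ε) :
    ((radialIntensity p.Λ₀).prod κ) {z | ε < p.linkLoss z} < ⊤ := by
  -- The radius at which a link with exponent `α` has path loss exactly `ε`.
  let R : ℝ → ℝ := fun α => (ε / p.β) ^ (-α)⁻¹
  have hR : ∀ α, 0 < α → ∀ r : ℝ, 0 < r → ε < p.β * r ^ (-α) → r < R α := by
    intro α hα r hr h
    have h1 : ε / p.β < r ^ (-α) := by
      rw [div_lt_iff₀ p.β_pos]; linarith
    have h2 := Real.rpow_lt_rpow_of_neg (div_pos hε p.β_pos) h1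
      (inv_lt_zero.2 (neg_lt_zero.2 hα))
    rwa [← Real.rpow_mul hr.le, mul_inv_cancel₀ (neg_ne_zero.2 hα.ne'), Real.rpow_one] at h2
  refine lt_of_le_of_lt (measure_mono (t := (Iio (max (R p.αL) (R p.αN)) ∪ Iic 0) ×ˢ univ)
    fun z hz => ⟨?_, mem_univ _⟩) ?_
  · by_cases h0 : z.1 ≤ 0
    · exact Or.inr h0
    · left
      push Not at h0
      have hz' : ε < p.linkLoss z := hz
      by_cases h : p.linkLos z
      · refine lt_max_of_lt_left (hR _ p.αL_pos _ h0 ?_)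
        simpa [linkLoss, h, abs_of_pos h0] using hz'
      · refine lt_max_of_lt_right (hR _ p.αN_pos _ h0 ?_)
        simpa [linkLoss, h, abs_of_pos h0] using hz'
  · rw [Measure.prod_prod, measure_univ, mul_one]
    refine (measure_union_le _ _).trans_lt ?_
    rw [radialIntensity_Iic_zero, add_zero]
    exact radialIntensity_Iio_lt_top p.Λ₀_pos.le _

end NetworkParams

/-! ### Evaluation of the intensity integrals -/

/-- The event `U < q` has probability `q` for uniform `U`; this splits the links into LOS and NLOS.
-/
lemma lintegral_uniform_prod_ite {S : Type*} [MeasurableSpace S] (κ : Measure S)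
    [IsProbabilityMeasure κ] {q : ℝ} (hq0 : 0 ≤ q) (hq1 : q ≤ 1) {f g : S → ℝ≥0∞}
    (hf : Measurable f) (hg : Measurable g) :
    ∫⁻ m, (if m.1 < q then f m.2 else g m.2) ∂((volume.restrict (Icc (0 : ℝ) 1)).prod κ) =
      ENNReal.ofReal q * ∫⁻ s, f s ∂κ + ENNReal.ofReal (1 - q) * ∫⁻ s, g s ∂κ := by
  have hm : Measurable fun m : ℝ × S => if m.1 < q then f m.2 else g m.2 :=
    Measurable.ite (measurableSet_lt measurable_fst measurable_const) (by fun_prop) (by fun_prop)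
  rw [lintegral_prod _ hm.aemeasurable]
  have h1 : ∀ u : ℝ, ∫⁻ s, (if u < q then f s else g s) ∂κ =
      (Iio q).indicator (fun _ => ∫⁻ s, f s ∂κ) u +
        (Ici q).indicator (fun _ => ∫⁻ s, g s ∂κ) u := by
    intro u
    by_cases hu : u < q
    · simp [hu]
    · simp [hu, not_lt.1 hu]
  simp only [h1]
  rw [lintegral_add_left (measurable_const.indicator measurableSet_Iio),
    lintegral_indicator_const measurableSet_Iio, lintegral_indicator_const measurableSet_Ici,
    Measure.restrict_apply measurableSet_Iio, Measure.restrict_apply measurableSet_Ici]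
  have e1 : Iio q ∩ Icc 0 1 = Ico 0 q := by
    ext x; simp only [mem_inter_iff, mem_Iio, mem_Icc, mem_Ico]
    constructor
    · rintro ⟨a, b, c⟩; exact ⟨b, a⟩
    · rintro ⟨a, b⟩; exact ⟨b, a, by linarith⟩
  have e2 : Ici q ∩ Icc 0 1 = Icc q 1 := by
    ext x; simp only [mem_inter_iff, mem_Ici, mem_Icc]
    constructor
    · rintro ⟨a, b, c⟩; exact ⟨a, c⟩
    · rintro ⟨a, b⟩; exact ⟨a, by linarith, b⟩
  rw [e1, e2, Real.volume_Ico, Real.volume_Icc, sub_zero, mul_comm, mul_comm (∫⁻ s, g s ∂κ)]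

namespace NetworkParams

variable (p : NetworkParams)

lemma PN_nonneg {r : ℝ} (hr : 0 ≤ r) : 0 ≤ p.PN r := sub_nonneg.2 (p.PL_le_one r hr)

lemma PN_le_one {r : ℝ} (hr : 0 ≤ r) : p.PN r ≤ 1 := by
  unfold PN; linarith [p.PL_nonneg r hr]

@[fun_prop]
lemma measurable_PN : Measurable p.PN := measurable_const.sub p.PL_measurable

lemma gainLaw_ae_nonneg (k : ℕ) : ∀ᵐ g ∂(p.gainLaw k), 0 ≤ g := by
  have h1 : 0 ≤ p.GA ^ 2 := by positivity
  have h2 : 0 ≤ p.GA * p.gA := mul_nonneg p.GA_pos.le p.gA_nonneg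
  have h3 : 0 ≤ p.gA ^ 2 := by positivity
  rw [ae_iff, gainLaw]
  simp [h1, h2, h3]

variable (F : Measure ℝ) (k : ℕ)

/-- The mean exponent of an interferer at distance `t`, all links having exponent `α`. -/
noncomputable def meanShadow (c a α t : ℝ) : ℝ≥0∞ :=
  ∫⁻ q : ℝ × ℝ, (1 - ENNReal.expNeg (if a < p.β * t ^ (-α) then ⊤
    else ENNReal.ofReal (c * (q.1 * q.2 * (p.β * t ^ (-α)))) / ENNReal.ofReal a))
    ∂(F.prod (p.gainLaw k))

lemma gainTransform_eq_toReal {α s t : ℝ} :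
    p.gainTransform F k α s t =
      (∫⁻ q : ℝ × ℝ, ENNReal.ofReal (Real.exp (-(s * p.β * q.1 * q.2 * t ^ (-α))))
        ∂(F.prod (p.gainLaw k))).toReal := by
  rw [gainTransform, integral_eq_lintegral_of_nonneg_ae (ae_of_all _ fun q => Real.exp_nonneg _)
    (Measurable.aestronglyMeasurable (by fun_prop))]

lemma ae_nonneg_fading_gain (hF : F (Iio 0) = 0) :
    ∀ᵐ q ∂(F.prod (p.gainLaw k)), 0 ≤ q.1 ∧ 0 ≤ q.2 := by
  have h1 : ∀ᵐ h ∂F, 0 ≤ h := by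
    rw [ae_iff]; simpa [Iio, not_le] using hF
  have h2 := p.gainLaw_ae_nonneg k
  filter_upwards [Measure.quasiMeasurePreserving_fst.ae h1,
    Measure.quasiMeasurePreserving_snd.ae h2] with q hq1 hq2 using ⟨hq1, hq2⟩

variable [IsProbabilityMeasure F] [IsProbabilityMeasure (p.gainLaw k)]

lemma lintegral_shadow_mark (c a : ℝ) {t : ℝ} (ht : 0 ≤ t) :
    ∫⁻ m, (1 - ENNReal.expNeg (p.shadow c a (t, m))) ∂(Network.markLaw p F k) =
      ENNReal.ofReal (p.PL t) * p.meanShadow F k c a p.αL t +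
      ENNReal.ofReal (p.PN t) * p.meanShadow F k c a p.αN t := by
  rw [Network.markLaw, meanShadow, meanShadow, PN, ← lintegral_uniform_prod_ite _
    (p.PL_nonneg t ht) (p.PL_le_one t ht) (by split_ifs <;> fun_prop) (by split_ifs <;> fun_prop)]
  refine lintegral_congr fun m => ?_
  by_cases h : m.1 < p.PL t
  · simp only [shadow, p.linkLoss_of_los ht h, if_pos h]
  · simp only [shadow, p.linkLoss_of_not_los ht h, if_neg h]

lemma meanShadow_of_lt {c a α t : ℝ} (h : a < p.β * t ^ (-α)) : p.meanShadow F k c a α t = 1 := by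
  simp [meanShadow, h]

lemma meanShadow_of_le (hF : F (Iio 0) = 0) {c a α t : ℝ} (hc : 0 ≤ c) (ha : 0 < a) (ht : 0 < t)
    (h : p.β * t ^ (-α) ≤ a) :
    p.meanShadow F k c a α t = ENNReal.ofReal (1 - p.gainTransform F k α (c / a) t) := by
  have hle : ∫⁻ q : ℝ × ℝ, ENNReal.ofReal (Real.exp (-(c / a * p.β * q.1 * q.2 * t ^ (-α))))
      ∂(F.prod (p.gainLaw k)) ≤ 1 := by
    calc _ ≤ ∫⁻ q : ℝ × ℝ, 1 ∂(F.prod (p.gainLaw k)) := by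
          refine lintegral_mono_ae ?_
          filter_upwards [p.ae_nonneg_fading_gain F k hF] with q hq
          rw [ENNReal.ofReal_le_one, Real.exp_le_one_iff, neg_nonpos]
          have := p.β_pos
          have := hq.1
          have := hq.2
          positivity
      _ = 1 := by simp
  rw [p.gainTransform_eq_toReal F k, ENNReal.ofReal_sub _ ENNReal.toReal_nonneg,
    ENNReal.ofReal_one, ENNReal.ofReal_toReal (ne_top_of_le_ne_top ENNReal.one_ne_top hle),
    meanShadow]
  simp only [if_neg (not_lt.2 h)]
  have e : ∀ᵐ q ∂(F.prod (p.gainLaw k)),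
      1 - ENNReal.expNeg (ENNReal.ofReal (c * (q.1 * q.2 * (p.β * t ^ (-α)))) / ENNReal.ofReal a) =
      1 - ENNReal.ofReal (Real.exp (-(c / a * p.β * q.1 * q.2 * t ^ (-α)))) := by
    filter_upwards [p.ae_nonneg_fading_gain F k hF] with q hq
    have := p.β_pos
    have := hq.1
    have := hq.2
    rw [← ENNReal.ofReal_div_of_pos ha, ENNReal.expNeg_ofReal (by positivity)]
    congr 4; ring
  rw [lintegral_congr_ae e, lintegral_sub (by fun_prop)
    (ne_top_of_le_ne_top ENNReal.one_ne_top hle)]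
  · simp
  · filter_upwards [p.ae_nonneg_fading_gain F k hF] with q hq
    rw [ENNReal.ofReal_le_one, Real.exp_le_one_iff, neg_nonpos]
    have := p.β_pos
    have := hq.1
    have := hq.2
    positivity

lemma lintegral_ofReal_Ioc_eq_interval {P : ℝ → ℝ} (hPm : Measurable P)
    (hP0 : ∀ r, 0 ≤ r → 0 ≤ P r) (hP1 : ∀ r, 0 ≤ r → P r ≤ 1) {Λ ρ : ℝ} (hΛ : 0 ≤ Λ) (hρ : 0 ≤ ρ) :
    ∫⁻ r in Ioc 0 ρ, ENNReal.ofReal (2 * Real.pi * Λ * r) * ENNReal.ofReal (P r) =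
      ENNReal.ofReal (2 * Real.pi * Λ * ∫ r in (0 : ℝ)..ρ, P r * r) := by
  have h_int : IntegrableOn (fun r => P r * r) (Ioc 0 ρ) := by
    refine Measure.integrableOn_of_bounded (M := ρ) measure_Ioc_lt_top.ne
      (by fun_prop) ?_
    filter_upwards [ae_restrict_mem measurableSet_Ioc] with r hr
    rw [Real.norm_eq_abs, abs_of_nonneg (mul_nonneg (hP0 r hr.1.le) hr.1.le)]
    nlinarith [hP1 r hr.1.le, hr.1, hr.2, hP0 r hr.1.le]
  rw [intervalIntegral.integral_of_le hρ, ← integral_const_mul,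
    ofReal_integral_eq_lintegral_ofReal (h_int.const_mul _)]
  · refine setLIntegral_congr_fun measurableSet_Ioc fun r hr => ?_
    rw [← ENNReal.ofReal_mul (by have := hr.1.le; positivity)]
    congr 1; ring
  · filter_upwards [ae_restrict_mem measurableSet_Ioc] with r hr
    exact mul_nonneg (by positivity) (mul_nonneg (hP0 r hr.1.le) hr.1.le)

/-- The void factor and the interference factor of the links with exponent `α`, which are present
with probability `P`. -/
lemma expNeg_lintegral_meanShadow (hF : F (Iio 0) = 0) {P : ℝ → ℝ} (hPm : Measurable P)
    (hP0 : ∀ r, 0 ≤ r → 0 ≤ P r) (hP1 : ∀ r, 0 ≤ r → P r ≤ 1) {c α ρ : ℝ} (hc : 0 ≤ c)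
    (hα : 0 < α) (hρ : 0 < ρ) :
    ENNReal.expNeg (∫⁻ t in Ioi 0, ENNReal.ofReal (2 * Real.pi * p.Λ₀ * t) *
      (ENNReal.ofReal (P t) * p.meanShadow F k c (p.β * ρ ^ (-α)) α t)) =
    ENNReal.ofReal (Real.exp (-(2 * Real.pi * p.Λ₀ * ∫ r in (0 : ℝ)..ρ, P r * r)) *
      expNeg (ENNReal.ofReal (2 * Real.pi * p.Λ₀) * ∫⁻ r in Ioi ρ,
        ENNReal.ofReal ((1 - p.gainTransform F k α (c / (p.β * ρ ^ (-α))) r) * P r * r))) := by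
  -- The radius `ρ` is where the loss equals the level. Closer links block surely and give the void
  -- probability; farther ones contribute `1 - 𝒢`.
  have hβ := p.β_pos
  have hΛ := p.Λ₀_pos
  have hunion : Ioi (0 : ℝ) = Ioc 0 ρ ∪ Ioi ρ := (Ioc_union_Ioi_eq_Ioi hρ.le).symm
  rw [hunion, lintegral_union measurableSet_Ioi (Set.disjoint_left.2 fun x hx hx' =>
    not_lt.2 hx.2 hx'), ENNReal.expNeg_add, ENNReal.ofReal_mul (Real.exp_nonneg _),
    ENNReal.ofReal_expNeg]
  congr 1
  · rw [← ENNReal.expNeg_ofReal, ← lintegral_ofReal_Ioc_eq_interval hPm hP0 hP1 hΛ.le hρ.le]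
    · congr 1
      -- At `t = ρ` the loss equals the level without exceeding it; this endpoint is null.
      rw [← restrict_Ioo_eq_restrict_Ioc]
      refine setLIntegral_congr_fun measurableSet_Ioo fun t ht => ?_
      rw [p.meanShadow_of_lt F k, mul_one]
      exact mul_lt_mul_of_pos_left (Real.rpow_lt_rpow_of_neg ht.1 ht.2 (neg_lt_zero.2 hα)) hβ
    · refine mul_nonneg (by positivity) (intervalIntegral.integral_nonneg hρ.le fun r hr => ?_)
      exact mul_nonneg (hP0 r hr.1) hr.1
  · congr 1
    rw [← lintegral_const_mul' _ _ ENNReal.ofReal_ne_top]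
    refine setLIntegral_congr_fun measurableSet_Ioi fun t ht => ?_
    have ht0 : 0 < t := hρ.trans ht
    rw [p.meanShadow_of_le F k hF hc (by positivity) ht0, mul_comm (ENNReal.ofReal (P t)),
      mul_assoc _ (P t) t, ENNReal.ofReal_mul (p := 2 * Real.pi * p.Λ₀) (by positivity)]
    · rw [ENNReal.ofReal_mul' (mul_nonneg (hP0 t ht0.le) ht0.le), ENNReal.ofReal_mul (hP0 t ht0.le)]
      ring
    · refine mul_le_mul_of_nonneg_left ?_ hβ.le
      exact Real.rpow_le_rpow_of_nonpos hρ (le_of_lt ht) (neg_nonpos.2 hα.le)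

/-- The exponent at path loss level `a`. -/
noncomputable def levelExponent (c a : ℝ) : ℝ≥0∞ :=
  ∫⁻ z, (1 - ENNReal.expNeg (p.shadow c a z)) ∂((radialIntensity p.Λ₀).prod (Network.markLaw p F k))

lemma measurable_meanShadow (c a α : ℝ) : Measurable (p.meanShadow F k c a α) := by
  refine Measurable.lintegral_prod_right ?_
  refine measurable_const.sub (ENNReal.measurable_expNeg.comp (Measurable.ite ?_ ?_ ?_))
  · exact measurableSet_lt measurable_const (by fun_prop)
  · exact measurable_const
  · fun_prop

lemma levelExponent_eq (c a : ℝ) :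
    p.levelExponent F k c a =
      (∫⁻ t in Ioi 0, ENNReal.ofReal (2 * Real.pi * p.Λ₀ * t) *
        (ENNReal.ofReal (p.PL t) * p.meanShadow F k c a p.αL t)) +
      ∫⁻ t in Ioi 0, ENNReal.ofReal (2 * Real.pi * p.Λ₀ * t) *
        (ENNReal.ofReal (p.PN t) * p.meanShadow F k c a p.αN t) := by
  have hm : Measurable fun z => 1 - ENNReal.expNeg (p.shadow c a z) :=
    measurable_const.sub (ENNReal.measurable_expNeg.comp
      ((p.measurable_shadow c).comp (measurable_prodMk_left (x := a))))
  have hL := p.measurable_meanShadow F k c a p.αL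
  have hPL := p.PL_measurable
  have : SFinite (Network.markLaw p F k) := by unfold Network.markLaw; infer_instance
  rw [levelExponent, lintegral_prod _ hm.aemeasurable, radialIntensity,
    lintegral_withDensity_eq_lintegral_mul _ (by fun_prop) hm.lintegral_prod_right',
    ← lintegral_add_left (by fun_prop)]
  refine setLIntegral_congr_fun measurableSet_Ioi fun t ht => ?_
  dsimp only [Pi.mul_apply]
  rw [p.lintegral_shadow_mark F k c a (le_of_lt ht), mul_add]

lemma expNeg_levelExponent_los (hF : F (Iio 0) = 0) {c r : ℝ} (hc : 0 ≤ c) (hr : 0 < r) :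
    ENNReal.expNeg (p.levelExponent F k c (p.β * r ^ (-p.αL))) =
      ENNReal.ofReal (p.voidL r * p.voidN (r ^ (p.αL / p.αN)) *
        p.laplaceL F k r (c / (p.β * r ^ (-p.αL)))) := by
  have hρ : 0 < r ^ (p.αL / p.αN) := Real.rpow_pos_of_pos hr _
  -- An NLOS link at distance `r ^ (αL / αN)` has the same path loss as a LOS link at distance `r`.
  have e : p.β * r ^ (-p.αL) = p.β * (r ^ (p.αL / p.αN)) ^ (-p.αN) := by
    rw [← Real.rpow_mul hr.le]
    congr 2
    have := p.αN_pos.ne'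
    field_simp
  have h1 := p.expNeg_lintegral_meanShadow F k hF p.PL_measurable p.PL_nonneg p.PL_le_one hc
    p.αL_pos hr
  have h2 := p.expNeg_lintegral_meanShadow F k hF p.measurable_PN (fun r hr => p.PN_nonneg hr)
    (fun r hr => p.PN_le_one hr) hc p.αN_pos hρ
  rw [← e] at h2
  rw [levelExponent_eq, ENNReal.expNeg_add, h1, h2, ← ENNReal.ofReal_mul]
  · congr 1
    simp only [voidL, voidN, laplaceL, expL, expN]
    ring
  · refine mul_nonneg (Real.exp_nonneg _) ?_
    unfold expNeg
    split_ifs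
    · exact le_rfl
    · exact Real.exp_nonneg _

lemma expNeg_levelExponent_nlos (hF : F (Iio 0) = 0) {c r : ℝ} (hc : 0 ≤ c) (hr : 0 < r) :
    ENNReal.expNeg (p.levelExponent F k c (p.β * r ^ (-p.αN))) =
      ENNReal.ofReal (p.voidN r * p.voidL (r ^ (p.αN / p.αL)) *
        p.laplaceN F k r (c / (p.β * r ^ (-p.αN)))) := by
  have hρ : 0 < r ^ (p.αN / p.αL) := Real.rpow_pos_of_pos hr _
  have e : p.β * r ^ (-p.αN) = p.β * (r ^ (p.αN / p.αL)) ^ (-p.αL) := by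
    rw [← Real.rpow_mul hr.le]
    congr 2
    have := p.αL_pos.ne'
    field_simp
  have h1 := p.expNeg_lintegral_meanShadow F k hF p.PL_measurable p.PL_nonneg p.PL_le_one hc
    p.αL_pos hρ
  have h2 := p.expNeg_lintegral_meanShadow F k hF p.measurable_PN (fun r hr => p.PN_nonneg hr)
    (fun r hr => p.PN_le_one hr) hc p.αN_pos hr
  rw [← e] at h1
  rw [levelExponent_eq, ENNReal.expNeg_add, h1, h2, ← ENNReal.ofReal_mul]
  · congr 1
    simp only [voidL, voidN, laplaceN, expL, expN]
    ring
  · refine mul_nonneg (Real.exp_nonneg _) ?_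
    unfold expNeg
    split_ifs
    · exact le_rfl
    · exact Real.exp_nonneg _

end NetworkParams

/-! ### Resampling one coordinate -/

/-- Both measures agree on cylinders: if the cylinder constrains coordinate `n`, that factor is
supplied by the fresh copy instead, and otherwise the update is invisible. -/
lemma infinitePi_prod_map_update {S : Type*} [MeasurableSpace S] (κ : Measure S)
    [IsProbabilityMeasure κ] (n : ℕ) :
    ((Measure.infinitePi fun _ : ℕ => κ).prod κ).map (fun q => Function.update q.1 n q.2) =
      Measure.infinitePi fun _ : ℕ => κ := by
  classical
  have hm : Measurable fun q : (ℕ → S) × S => Function.update q.1 n q.2 := by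
    refine measurable_pi_lambda _ fun m => ?_
    by_cases h : m = n
    · subst h; simpa using measurable_snd
    · simp only [Function.update_of_ne h]; fun_prop
  refine Measure.eq_infinitePi _ fun s t ht => ?_
  have hpi : MeasurableSet (Set.pi (s : Set ℕ) t) :=
    MeasurableSet.pi s.countable_toSet fun _ _ => ht _
  rw [Measure.map_apply hm hpi]
  by_cases hn : n ∈ s
  · have e : (fun q : (ℕ → S) × S => Function.update q.1 n q.2) ⁻¹' Set.pi s t =
        Set.pi (s.erase n : Finset ℕ) t ×ˢ t n := by
      ext q
      simp only [mem_preimage, Set.mem_pi, Finset.mem_coe, mem_prod, Finset.mem_erase]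
      constructor
      · intro h
        refine ⟨fun m hm => ?_, by simpa using h n hn⟩
        simpa [Function.update_of_ne hm.1] using h m hm.2
      · rintro ⟨h1, h2⟩ m hm
        by_cases hmn : m = n
        · subst hmn; simpa using h2
        · simpa [Function.update_of_ne hmn] using h1 m ⟨hmn, hm⟩
    rw [e, Measure.prod_prod, Measure.infinitePi_pi _ fun _ _ => ht _, Finset.prod_erase_mul _ _ hn]
  · have e : (fun q : (ℕ → S) × S => Function.update q.1 n q.2) ⁻¹' Set.pi s t =
        Set.pi (s : Finset ℕ) t ×ˢ univ := by
      ext q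
      simp only [mem_preimage, Set.mem_pi, Finset.mem_coe, mem_prod, mem_univ, and_true]
      refine forall₂_congr fun m hm => ?_
      rw [Function.update_of_ne (ne_of_mem_of_not_mem hm hn)]
    rw [e, Measure.prod_prod, Measure.infinitePi_pi _ fun _ _ => ht _, measure_univ, mul_one]

/-- The tail of the exponential law. Here Rayleigh fading turns a threshold event into an
exponential functional of the interference; infinite `T` gives `0` on both sides. -/
lemma expMeasure_one_lt_ofReal_mul {b : ℝ} (hb : 0 < b) (T : ℝ≥0∞) :
    expMeasure 1 {h | T < ENNReal.ofReal (h * b)} = expNeg (T / ENNReal.ofReal b) := by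
  have : IsProbabilityMeasure (expMeasure 1) := isProbabilityMeasure_expMeasure zero_lt_one
  by_cases hT : T = ⊤
  · subst hT
    simp [ENNReal.top_div]
  · obtain ⟨t, ht, rfl⟩ : ∃ t : ℝ, 0 ≤ t ∧ T = ENNReal.ofReal t :=
      ⟨T.toReal, ENNReal.toReal_nonneg, (ENNReal.ofReal_toReal hT).symm⟩
    have e : {h : ℝ | ENNReal.ofReal t < ENNReal.ofReal (h * b)} = (Iic (t / b))ᶜ := by
      ext h
      rw [compl_Iic, mem_Ioi, div_lt_iff₀ hb]
      change ENNReal.ofReal t < ENNReal.ofReal (h * b) ↔ _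
      rw [ENNReal.ofReal_lt_ofReal_iff']
      exact ⟨fun h => h.1, fun h => ⟨h, ht.trans_lt h⟩⟩
    have htb : 0 ≤ t / b := by positivity
    rw [e, prob_compl_eq_one_sub measurableSet_Iic, ← ofReal_cdf, cdf_expMeasure_eq zero_lt_one,
      if_pos htb, ← ENNReal.ofReal_div_of_pos hb, ENNReal.expNeg_ofReal htb,
      ← ENNReal.ofReal_one, ← ENNReal.ofReal_sub]
    · congr 1; ring_nf
    · rw [sub_nonneg, Real.exp_le_one_iff]; linarith

/-! ### Functionals of the sequence of links -/

namespace NetworkParams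

variable (p : NetworkParams)

/-- No link has a larger path loss than the `n`-th one. -/
def Best (n : ℕ) (z : ℕ → ℝ × ℝ × ℝ × ℝ) : Prop := ∀ m, p.linkLoss (z m) ≤ p.linkLoss (z n)

/-- The power received from all links but the `n`-th one. -/
noncomputable def others (n : ℕ) (z : ℕ → ℝ × ℝ × ℝ × ℝ) : ℝ≥0∞ :=
  ∑' m, if m = n then 0
    else ENNReal.ofReal ((z m).2.2.1 * (z m).2.2.2 * p.linkLoss (z m))

lemma measurableSet_best (n : ℕ) : MeasurableSet {z | p.Best n z} := by
  have : {z | p.Best n z} = ⋂ m, {z | p.linkLoss (z m) ≤ p.linkLoss (z n)} := by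
    ext z; simp [Best]
  rw [this]
  exact MeasurableSet.iInter fun m => measurableSet_le (by fun_prop) (by fun_prop)

@[fun_prop]
lemma measurable_others (n : ℕ) : Measurable (p.others n) := by
  refine Measurable.tsum fun m => ?_
  split_ifs
  · exact measurable_const
  · fun_prop

/-- The serving rule sees only length and type of a link, so resampling fading and gain does not
change which link is best. -/
lemma linkLoss_congr (r u h g h' g' : ℝ) : p.linkLoss (r, u, h, g) = p.linkLoss (r, u, h', g') :=
  rfl

lemma others_update (n : ℕ) (z : ℕ → ℝ × ℝ × ℝ × ℝ) (a : ℝ × ℝ × ℝ × ℝ) :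
    p.others n (Function.update z n a) = p.others n z := by
  refine tsum_congr fun m => ?_
  split_ifs with h
  · rfl
  · rw [Function.update_of_ne h]

lemma best_update (n : ℕ) (z : ℕ → ℝ × ℝ × ℝ × ℝ) (r u h g : ℝ) :
    p.Best n (Function.update z n (r, u, h, g)) ↔
      ∀ m, m ≠ n → p.linkLoss (z m) ≤ p.linkLoss (r, u, 0, 0) := by
  constructor
  · intro hb m hm
    have := hb m
    rwa [Function.update_of_ne hm, Function.update_self, p.linkLoss_congr r u h g 0 0] at this
  · intro hb m
    by_cases hm : m = n
    · subst hm; exact le_rfl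
    · rw [Function.update_of_ne hm, Function.update_self, p.linkLoss_congr r u h g 0 0]
      exact hb m hm

open Classical in
-- The exponent is infinite as soon as some other link has a larger loss. Otherwise it is the sum of
-- the finite terms, that is, the scaled interference.
lemma expNeg_tsum_shadow {c : ℝ} (hc : 0 ≤ c) (n : ℕ) (z : ℕ → ℝ × ℝ × ℝ × ℝ) :
    ENNReal.expNeg (∑' m, if m = n then 0 else p.shadow c (p.linkLoss (z n)) (z m)) =
      if p.Best n z then
        ENNReal.expNeg (ENNReal.ofReal c * p.others n z / ENNReal.ofReal (p.linkLoss (z n)))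
      else 0 := by
  split_ifs with h
  · congr 1
    rw [others, ← ENNReal.tsum_mul_left, div_eq_mul_inv, ← ENNReal.tsum_mul_right]
    refine tsum_congr fun m => ?_
    by_cases hm : m = n
    · simp [hm]
    · simp only [hm, if_false]
      rw [shadow, if_neg (not_lt.2 (h m)), ENNReal.ofReal_mul hc, div_eq_mul_inv]
  · rw [ENNReal.expNeg_eq_zero_iff]
    simp only [Best, not_forall, not_le] at h
    obtain ⟨m, hm⟩ := h
    have hmn : m ≠ n := by rintro rfl; exact lt_irrefl _ hm
    refine ENNReal.tsum_eq_top_of_eq_top ⟨m, ?_⟩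
    simp [hmn, shadow, hm]

end NetworkParams

/-! ### Resampling the marks and integrating out Rayleigh fading -/

namespace Network

variable {Ω : Type*} {k : ℕ → ℕ} {N : Network Ω k} [MeasurableSpace Ω] {μ : Measure Ω}
  [IsProbabilityMeasure μ] {p : NetworkParams} {F : Measure ℝ} {i : ℕ}

/-- The sequence of all links. -/
noncomputable def links (N : Network Ω k) (i : ℕ) (y : Plane) (ω : Ω) : ℕ → ℝ × ℝ × ℝ × ℝ :=
  fun n => N.link i y n ω

lemma IsModel.measurable_links (hN : N.IsModel μ p F i) (y : Plane) :
    Measurable (N.links i y) :=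
  measurable_pi_lambda _ (hN.isPoissonEnum_link y).measurable

/-- The marks of the `n`-th link may be replaced by an independent copy. -/
lemma IsModel.lintegral_resample (hN : N.IsModel μ p F i) (y : Plane) (n : ℕ)
    {Ψ : (ℕ → ℝ × ℝ × ℝ × ℝ) → ℝ≥0∞} (hΨ : Measurable Ψ) :
    ∫⁻ ω, Ψ (N.links i y ω) ∂μ = ∫⁻ ω, ∫⁻ a, Ψ (Function.update (N.links i y ω) n
      (N.dist i y n ω, a)) ∂(markLaw p F (k i)) ∂μ := by
  have := hN.isProbabilityMeasure_markLaw
  have hmφ : Measurable fun ω n => N.φ i n ω := measurable_pi_lambda _ hN.measurable_φ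
  have hmM : Measurable fun ω n => N.marks n ω := measurable_pi_lambda _ hN.measurable_marks
  have hupd : ∀ {S : Type} [MeasurableSpace S],
      Measurable fun q : (ℕ → S) × S => Function.update q.1 n q.2 := by
    intro S _
    refine measurable_pi_lambda _ fun m => ?_
    by_cases h : m = n
    · subst h; simpa using measurable_snd
    · simp only [Function.update_of_ne h]; fun_prop
  let L : (ℕ → Plane) × (ℕ → ℝ × ℝ × ℝ) → ℕ → ℝ × ℝ × ℝ × ℝ := fun q m => (‖q.1 m - y‖, q.2 m)
  have hL : Measurable L := by fun_prop
  have hlinks : ∀ ω, N.links i y ω = L (fun n => N.φ i n ω, fun n => N.marks n ω) := fun ω => rfl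
  have hLu : ∀ x m a, L (x, Function.update m n a) =
      Function.update (L (x, m)) n (‖x n - y‖, a) := fun x m a => by
    funext j
    by_cases h : j = n
    · subst h; simp [L]
    · simp [L, Function.update_of_ne h]
  have hΨu : Measurable fun q : ((ℕ → Plane) × (ℕ → ℝ × ℝ × ℝ)) × (ℝ × ℝ × ℝ) =>
      Ψ (Function.update (L q.1) n (‖q.1.1 n - y‖, q.2)) := by
    refine hΨ.comp (hupd.comp (Measurable.prodMk ?_ ?_))
    · exact hL.comp measurable_fst
    · fun_prop
  have hΨL : Measurable fun q => Ψ (L q) := hΨ.comp hL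
  calc ∫⁻ ω, Ψ (N.links i y ω) ∂μ
      = ∫⁻ q, Ψ (L q) ∂((μ.map fun ω n => N.φ i n ω).prod
          (Measure.infinitePi fun _ => markLaw p F (k i))) := by
        rw [← hN.map_φ_marks, lintegral_map hΨL (hmφ.prodMk hmM)]
        rfl
    _ = ∫⁻ x, ∫⁻ m, ∫⁻ a, Ψ (Function.update (L (x, m)) n (‖x n - y‖, a)) ∂(markLaw p F (k i))
          ∂(Measure.infinitePi fun _ => markLaw p F (k i)) ∂(μ.map fun ω n => N.φ i n ω) := by
        rw [lintegral_prod _ hΨL.aemeasurable]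
        refine lintegral_congr fun x => ?_
        have hx : Measurable fun m => Ψ (L (x, m)) := hΨL.comp measurable_prodMk_left
        have hxu : Measurable fun q : (ℕ → ℝ × ℝ × ℝ) × (ℝ × ℝ × ℝ) =>
            Ψ (L (x, Function.update q.1 n q.2)) := hx.comp hupd
        conv_lhs => rw [← infinitePi_prod_map_update (markLaw p F (k i)) n]
        rw [lintegral_map hx hupd, lintegral_prod _ hxu.aemeasurable]
        simp_rw [hLu]
    _ = ∫⁻ q, ∫⁻ a, Ψ (Function.update (L q) n (‖q.1 n - y‖, a)) ∂(markLaw p F (k i))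
          ∂((μ.map fun ω n => N.φ i n ω).prod
            (Measure.infinitePi fun _ => markLaw p F (k i))) := by
        rw [lintegral_prod _ hΨu.lintegral_prod_right'.aemeasurable]
    _ = _ := by
        rw [← hN.map_φ_marks, lintegral_map hΨu.lintegral_prod_right' (hmφ.prodMk hmM)]
        rfl

/-- The mass is read off from the law of the marks, a probability measure that factors with two
other probability measures. -/
lemma IsModel.isProbabilityMeasure_gainLaw [IsProbabilityMeasure F] (hN : N.IsModel μ p F i) :
    IsProbabilityMeasure (p.gainLaw (k i)) := by
  have h := hN.isProbabilityMeasure_markLaw.measure_univ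
  have e : (univ : Set (ℝ × ℝ × ℝ)) = univ ×ˢ (univ ×ˢ univ) := by simp
  have hfin : IsFiniteMeasure (p.gainLaw (k i)) := by
    refine ⟨?_⟩
    simp [NetworkParams.gainLaw, ENNReal.add_lt_top]
  rw [markLaw, e, Measure.prod_prod, Measure.prod_prod] at h
  exact ⟨by simpa using h⟩

/-- Under Rayleigh fading, the fading of the `n`-th link can be integrated out. -/
lemma IsModel.lintegral_rayleigh (hN : N.IsModel μ p (expMeasure 1) i) (y : Plane) (n : ℕ)
    {B : ℝ → ℝ → Prop} (hB : MeasurableSet {q : ℝ × ℝ | B q.1 q.2})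
    (hB0 : ∀ r u, B r u → 0 < r) (τ : ℝ) :
    μ {ω | p.Best n (N.links i y ω) ∧ B (N.dist i y n ω) (N.U n ω) ∧
      ENNReal.ofReal τ * (ENNReal.ofReal (p.σ ^ 2) + p.others n (N.links i y ω)) <
        ENNReal.ofReal (N.h n ω * (p.GA ^ 2 * p.linkLoss (N.link i y n ω)))} =
    ∫⁻ ω, {ω | p.Best n (N.links i y ω) ∧ B (N.dist i y n ω) (N.U n ω)}.indicator (fun ω =>
      expNeg (ENNReal.ofReal τ * (ENNReal.ofReal (p.σ ^ 2) + p.others n (N.links i y ω)) /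
        ENNReal.ofReal (p.GA ^ 2 * p.linkLoss (N.link i y n ω)))) ω ∂μ := by
  classical
  have : IsProbabilityMeasure (expMeasure 1) := isProbabilityMeasure_expMeasure zero_lt_one
  have : IsProbabilityMeasure (p.gainLaw (k i)) := hN.isProbabilityMeasure_gainLaw
  let T : (ℕ → ℝ × ℝ × ℝ × ℝ) → ℝ≥0∞ := fun z =>
    ENNReal.ofReal τ * (ENNReal.ofReal (p.σ ^ 2) + p.others n z)
  have hT : Measurable T := by fun_prop
  let S : Set (ℕ → ℝ × ℝ × ℝ × ℝ) := {z | p.Best n z ∧ B (z n).1 (z n).2.1}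
  have hS : MeasurableSet S := by
    refine (p.measurableSet_best n).inter ?_
    exact hB.preimage (f := fun z : ℕ → ℝ × ℝ × ℝ × ℝ => ((z n).1, (z n).2.1)) (by fun_prop)
  let S' : Set (ℕ → ℝ × ℝ × ℝ × ℝ) :=
    {z | T z < ENNReal.ofReal ((z n).2.2.1 * (p.GA ^ 2 * p.linkLoss (z n)))}
  have hS' : MeasurableSet S' := measurableSet_lt hT (by fun_prop)
  let Ψ₁ : (ℕ → ℝ × ℝ × ℝ × ℝ) → ℝ≥0∞ := (S ∩ S').indicator 1
  let Ψ₂ : (ℕ → ℝ × ℝ × ℝ × ℝ) → ℝ≥0∞ := S.indicator fun z =>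
    expNeg (T z / ENNReal.ofReal (p.GA ^ 2 * p.linkLoss (z n)))
  have hΨ₁ : Measurable Ψ₁ := measurable_one.indicator (hS.inter hS')
  have hΨ₂ : Measurable Ψ₂ := Measurable.indicator (by fun_prop) hS
  have hml := hN.measurable_links y
  have e1 : μ {ω | p.Best n (N.links i y ω) ∧ B (N.dist i y n ω) (N.U n ω) ∧
      ENNReal.ofReal τ * (ENNReal.ofReal (p.σ ^ 2) + p.others n (N.links i y ω)) <
        ENNReal.ofReal (N.h n ω * (p.GA ^ 2 * p.linkLoss (N.link i y n ω)))} =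
      ∫⁻ ω, Ψ₁ (N.links i y ω) ∂μ := by
    have : ∫⁻ ω, Ψ₁ (N.links i y ω) ∂μ = μ (N.links i y ⁻¹' (S ∩ S')) := by
      rw [← lintegral_indicator_one (hml (hS.inter hS'))]
      rfl
    rw [this]
    congr 1
    ext ω
    exact and_assoc.symm
  rw [e1]
  change _ = ∫⁻ ω, Ψ₂ (N.links i y ω) ∂μ
  -- With fresh marks at link `n`, all other links and the new `U` and `G` can be frozen: as
  -- functions of the new `h`, `Ψ₁` is a threshold indicator or zero, and `Ψ₂` is constant.
  rw [hN.lintegral_resample y n hΨ₁, hN.lintegral_resample y n hΨ₂]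
  refine lintegral_congr fun ω => ?_
  generalize N.links i y ω = z
  generalize N.dist i y n ω = r
  have hupd : Measurable fun a : ℝ × ℝ × ℝ => Function.update z n (r, a) := by
    refine measurable_pi_lambda _ fun m => ?_
    by_cases h : m = n
    · subst h; simpa using measurable_prodMk_left
    · simp only [Function.update_of_ne h]; fun_prop
  have hΨ₁u : Measurable fun a => Ψ₁ (Function.update z n (r, a)) := hΨ₁.comp hupd
  have hΨ₂u : Measurable fun a => Ψ₂ (Function.update z n (r, a)) := hΨ₂.comp hupd
  rw [markLaw, lintegral_prod _ hΨ₁u.aemeasurable, lintegral_prod _ hΨ₂u.aemeasurable]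
  refine lintegral_congr fun u => ?_
  have hΨ₁u' : Measurable fun a : ℝ × ℝ => Ψ₁ (Function.update z n (r, u, a)) :=
    hΨ₁u.comp measurable_prodMk_left
  have hΨ₂u' : Measurable fun a : ℝ × ℝ => Ψ₂ (Function.update z n (r, u, a)) :=
    hΨ₂u.comp measurable_prodMk_left
  rw [lintegral_prod_symm _ hΨ₁u'.aemeasurable, lintegral_prod_symm _ hΨ₂u'.aemeasurable]
  refine lintegral_congr fun g => ?_
  have hTu : ∀ a, T (Function.update z n a) = T z := fun a => by
    simp only [T, p.others_update]
  have hSu : ∀ h, Function.update z n (r, u, h, g) ∈ S ↔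
      (∀ m, m ≠ n → p.linkLoss (z m) ≤ p.linkLoss (r, u, 0, 0)) ∧ B r u := fun h => by
    change p.Best n (Function.update z n (r, u, h, g)) ∧ _ ↔ _
    rw [p.best_update, Function.update_self]
  by_cases hG : (∀ m, m ≠ n → p.linkLoss (z m) ≤ p.linkLoss (r, u, 0, 0)) ∧ B r u
  -- Positive length makes the path loss positive, which the exponential tail formula needs.
  · have hb : 0 < p.GA ^ 2 * p.linkLoss (r, u, 0, 0) := by
      have hr := hB0 r u hG.2
      have := p.GA_pos
      have := p.β_pos
      unfold NetworkParams.linkLoss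
      have : 0 < |r| := abs_pos.2 hr.ne'
      positivity
    have h1 : ∀ h, Ψ₁ (Function.update z n (r, u, h, g)) =
        {h | T z < ENNReal.ofReal (h * (p.GA ^ 2 * p.linkLoss (r, u, 0, 0)))}.indicator 1 h :=
      fun h => by
        have : Function.update z n (r, u, h, g) ∈ S ∩ S' ↔
            h ∈ {h | T z < ENNReal.ofReal (h * (p.GA ^ 2 * p.linkLoss (r, u, 0, 0)))} := by
          rw [mem_inter_iff, hSu, and_iff_right hG]
          change T _ < ENNReal.ofReal _ ↔ T z < _
          rw [hTu, Function.update_self, p.linkLoss_congr r u h g 0 0]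
        change (S ∩ S').indicator 1 _ = _
        by_cases hh : h ∈ {h | T z < ENNReal.ofReal (h * (p.GA ^ 2 * p.linkLoss (r, u, 0, 0)))}
        · rw [indicator_of_mem (this.2 hh), indicator_of_mem hh, Pi.one_apply, Pi.one_apply]
        · rw [indicator_of_notMem (fun hm => hh (this.1 hm)), indicator_of_notMem hh]
    have h2 : ∀ h, Ψ₂ (Function.update z n (r, u, h, g)) =
        expNeg (T z / ENNReal.ofReal (p.GA ^ 2 * p.linkLoss (r, u, 0, 0))) := fun h => by
      simp only [Ψ₂]
      rw [indicator_of_mem ((hSu h).2 hG), hTu, Function.update_self, p.linkLoss_congr r u h g 0 0]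
    simp only [h1, h2]
    rw [lintegral_indicator_one, expMeasure_one_lt_ofReal_mul hb]
    · simp
    · exact measurableSet_lt measurable_const (by fun_prop)
  · have h1 : ∀ h, Ψ₁ (Function.update z n (r, u, h, g)) = 0 := fun h =>
      indicator_of_notMem (fun hm => hG ((hSu h).1 hm.1)) _
    have h2 : ∀ h, Ψ₂ (Function.update z n (r, u, h, g)) = 0 := fun h =>
      indicator_of_notMem (fun hm => hG ((hSu h).1 hm)) _
    simp only [h1, h2]

end Network

/-! ### The density of the distance of the best link -/

namespace NetworkParams

open Classical

variable (p : NetworkParams)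

/-- The probability that a link of length `r` is LOS (`b = True`) or NLOS (`b = False`). -/
noncomputable def linkProb (b : Prop) (r : ℝ) : ℝ := if b then p.PL r else p.PN r

/-- The path loss exponent of LOS (`b = True`) or NLOS (`b = False`) links. -/
noncomputable def linkExp (b : Prop) : ℝ := if b then p.αL else p.αN

/-- The factor in front of the conditional coverage probability. -/
noncomputable def weight (b : Prop) (r : ℝ) : ℝ := if b then p.weightL r else p.weightN r

/-- The closed form of the conditional coverage probability. -/
noncomputable def cover (F : Measure ℝ) (τ : ℝ) (k : ℕ) (b : Prop) (r : ℝ) : ℝ :=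
  if b then p.coverL F τ r k else p.coverN F τ r k

lemma measurable_linkProb (b : Prop) : Measurable (p.linkProb b) := by
  by_cases hb : b
  · have : p.linkProb b = p.PL := funext fun r => if_pos hb
    exact this ▸ p.PL_measurable
  · have : p.linkProb b = p.PN := funext fun r => if_neg hb
    exact this ▸ p.measurable_PN

lemma linkLoss_of_iff {b : Prop} {r : ℝ} (hr : 0 ≤ r) {m : ℝ × ℝ × ℝ} (h : m.1 < p.PL r ↔ b) :
    p.linkLoss (r, m) = p.β * r ^ (-p.linkExp b) := by
  by_cases hb : b
  · rw [p.linkLoss_of_los hr (h.2 hb), linkExp, if_pos hb]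
  · rw [p.linkLoss_of_not_los hr (fun hl => hb (h.1 hl)), linkExp, if_neg hb]

variable (F : Measure ℝ) (k : ℕ)

/-- The convention at `P_N = 0` makes the quotient equal to the void probability for every `r > 0`,
so no case distinction survives. -/
lemma weightL_eq {r : ℝ} (hr : 0 < r) :
    p.weightL r =
      2 * Real.pi * p.Λ₀ * r * (p.PL r * (p.voidL r * p.voidN (r ^ (p.αL / p.αN)))) := by
  have hρ := (Real.rpow_pos_of_pos hr (p.αL / p.αN)).ne'
  have : p.quotN (r ^ (p.αL / p.αN)) = p.voidN (r ^ (p.αL / p.αN)) := by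
    unfold quotN
    split_ifs with h
    · rfl
    · have := p.Λ₀_pos.ne'
      have := Real.pi_pos.ne'
      unfold fN
      generalize r ^ (p.αL / p.αN) = ρ at *
      field_simp
  rw [weightL, this, fL]
  ring

lemma weightN_eq {r : ℝ} (hr : 0 < r) :
    p.weightN r =
      2 * Real.pi * p.Λ₀ * r * (p.PN r * (p.voidN r * p.voidL (r ^ (p.αN / p.αL)))) := by
  have hρ := (Real.rpow_pos_of_pos hr (p.αN / p.αL)).ne'
  have : p.quotL (r ^ (p.αN / p.αL)) = p.voidL (r ^ (p.αN / p.αL)) := by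
    unfold quotL
    split_ifs with h
    · rfl
    · have := p.Λ₀_pos.ne'
      have := Real.pi_pos.ne'
      unfold fL
      generalize r ^ (p.αN / p.αL) = ρ at *
      field_simp
  rw [weightN, this, fN]
  ring

lemma weight_nonneg (b : Prop) {r : ℝ} (hr : 0 < r) : 0 ≤ p.weight b r := by
  have h0 : 0 ≤ 2 * Real.pi * p.Λ₀ * r := by have := p.Λ₀_pos; positivity
  unfold weight
  split_ifs
  · rw [p.weightL_eq hr]
    exact mul_nonneg h0 (mul_nonneg (p.PL_nonneg r hr.le)
      (mul_nonneg (Real.exp_nonneg _) (Real.exp_nonneg _)))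
  · rw [p.weightN_eq hr]
    exact mul_nonneg h0 (mul_nonneg (p.PN_nonneg hr.le)
      (mul_nonneg (Real.exp_nonneg _) (Real.exp_nonneg _)))

lemma expNeg_nonneg (x : ℝ≥0∞) : 0 ≤ expNeg x := by
  unfold expNeg
  split_ifs
  · exact le_rfl
  · exact Real.exp_nonneg _

lemma cover_nonneg (τ : ℝ) (b : Prop) (r : ℝ) : 0 ≤ p.cover F τ k b r := by
  unfold cover
  split_ifs <;>
  exact mul_nonneg (Real.exp_nonneg _) (mul_nonneg (expNeg_nonneg _) (expNeg_nonneg _))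

/-- The Laplace transform of the interference when the best link is LOS (`b = True`) or NLOS
(`b = False`). -/
noncomputable def laplace (b : Prop) (r s : ℝ) : ℝ :=
  if b then p.laplaceL F k r s else p.laplaceN F k r s

lemma cover_eq (τ : ℝ) (b : Prop) {r : ℝ} (hr : 0 < r) :
    p.cover F τ k b r =
      Real.exp (-(τ / p.GA ^ 2 * p.σ ^ 2 / (p.β * r ^ (-p.linkExp b)))) *
        p.laplace F k b r (τ / p.GA ^ 2 / (p.β * r ^ (-p.linkExp b))) := by
  have hβ := p.β_pos.ne'
  have hG := p.GA_pos.ne'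
  have h1 : ∀ α : ℝ, τ / p.GA ^ 2 / (p.β * r ^ (-α)) = r ^ α * τ / (p.GA ^ 2 * p.β) := fun α => by
    have := (Real.rpow_pos_of_pos hr α).ne'
    rw [Real.rpow_neg hr.le]
    field_simp
  have h2 : ∀ α : ℝ, τ / p.GA ^ 2 * p.σ ^ 2 / (p.β * r ^ (-α)) =
      r ^ α * τ * p.σ ^ 2 / (p.GA ^ 2 * p.β) := fun α => by
    have := (Real.rpow_pos_of_pos hr α).ne'
    rw [Real.rpow_neg hr.le]
    field_simp
  unfold cover linkExp laplace
  split_ifs <;> simp only [coverL, coverN, h1, h2]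

/-- The density of the length of the best link, where it is LOS (`b = True`) or NLOS
(`b = False`), weighted by a function `K` of its path loss and by the Laplace transform of the
interference. -/
noncomputable def levelDensity (c : ℝ) (K : ℝ → ℝ≥0∞) (b : Prop) (r : ℝ) : ℝ≥0∞ :=
  ENNReal.ofReal (2 * Real.pi * p.Λ₀ * r) * (ENNReal.ofReal (p.linkProb b r) *
    (K (p.β * r ^ (-p.linkExp b)) *
      ENNReal.expNeg (p.levelExponent F k c (p.β * r ^ (-p.linkExp b)))))

variable [IsProbabilityMeasure F] [IsProbabilityMeasure (p.gainLaw k)]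

lemma measurable_levelExponent (c : ℝ) : Measurable (p.levelExponent F k c) := by
  have : SFinite (Network.markLaw p F k) := by unfold Network.markLaw; infer_instance
  refine Measurable.lintegral_prod_right ?_
  exact measurable_const.sub (ENNReal.measurable_expNeg.comp (p.measurable_shadow c))

lemma measurable_levelDensity (c : ℝ) {K : ℝ → ℝ≥0∞} (hK : Measurable K) (b : Prop) :
    Measurable (p.levelDensity F k c K b) := by
  have h1 := p.measurable_linkProb b
  have h2 := p.measurable_levelExponent F k c
  have h3 : Measurable fun r : ℝ => p.β * r ^ (-p.linkExp b) := by fun_prop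
  refine Measurable.mul (by fun_prop) (Measurable.mul (by fun_prop) ?_)
  exact (hK.comp h3).mul (ENNReal.measurable_expNeg.comp (h2.comp h3))

lemma lintegral_link_mul_expNeg (c : ℝ) {K : ℝ → ℝ≥0∞} (hK : Measurable K) (b : Prop)
    {A : Set ℝ} (hA : MeasurableSet A) :
    ∫⁻ z, {z | (z.1 ∈ A ∧ 0 < z.1) ∧ (p.linkLos z ↔ b)}.indicator (fun z => K (p.linkLoss z)) z *
        ENNReal.expNeg (p.levelExponent F k c (p.linkLoss z))
        ∂((radialIntensity p.Λ₀).prod (Network.markLaw p F k)) =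
      ∫⁻ r in A, p.levelDensity F k c K b r ∂(volume.restrict (Ioi 0)) := by
  have : SFinite (Network.markLaw p F k) := by unfold Network.markLaw; infer_instance
  have hmb : MeasurableSet {z : ℝ × ℝ × ℝ × ℝ | (z.1 ∈ A ∧ 0 < z.1) ∧ (p.linkLos z ↔ b)} := by
    refine MeasurableSet.inter (measurable_fst (hA.inter measurableSet_Ioi)) ?_
    exact measurableSet_setOfPred.2
      ((measurableSet_setOfPred.1 p.measurableSet_linkLos).iff measurable_const)
  have hm : Measurable fun z => {z : ℝ × ℝ × ℝ × ℝ | (z.1 ∈ A ∧ 0 < z.1) ∧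
      (p.linkLos z ↔ b)}.indicator (fun z => K (p.linkLoss z)) z *
        ENNReal.expNeg (p.levelExponent F k c (p.linkLoss z)) :=
    ((hK.comp p.measurable_linkLoss).indicator hmb).mul (ENNReal.measurable_expNeg.comp
      ((p.measurable_levelExponent F k c).comp p.measurable_linkLoss))
  rw [← lintegral_indicator hA, lintegral_prod _ hm.aemeasurable, radialIntensity,
    lintegral_withDensity_eq_lintegral_mul _ (by fun_prop) hm.lintegral_prod_right']
  refine setLIntegral_congr_fun measurableSet_Ioi fun r hr => ?_
  have hr : 0 < r := hr
  dsimp only [Pi.mul_apply]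
  by_cases hrA : r ∈ A
  · rw [indicator_of_mem hrA, levelDensity]
    congr 1
    set X := K (p.β * r ^ (-p.linkExp b)) *
      ENNReal.expNeg (p.levelExponent F k c (p.β * r ^ (-p.linkExp b)))
    -- At fixed length the integrand depends on the marks only through `U < PL r`, since the path
    -- loss is determined by length and type.
    have h_int : ∀ m : ℝ × ℝ × ℝ, {z : ℝ × ℝ × ℝ × ℝ | (z.1 ∈ A ∧ 0 < z.1) ∧
        (p.linkLos z ↔ b)}.indicator (fun z => K (p.linkLoss z)) (r, m) *
        ENNReal.expNeg (p.levelExponent F k c (p.linkLoss (r, m))) =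
        if m.1 < p.PL r then (if b then X else 0) else (if b then 0 else X) := by
      intro m
      by_cases hmr : m.1 < p.PL r ↔ b
      · have hmem : (r, m) ∈ {z : ℝ × ℝ × ℝ × ℝ | (z.1 ∈ A ∧ 0 < z.1) ∧ (p.linkLos z ↔ b)} :=
          ⟨⟨hrA, hr⟩, hmr⟩
        rw [indicator_of_mem hmem, p.linkLoss_of_iff hr.le hmr]
        by_cases hb : b
        · rw [if_pos (hmr.2 hb), if_pos hb]
        · rw [if_neg (fun h => hb (hmr.1 h)), if_neg hb]
      · rw [indicator_of_notMem (fun h => hmr h.2), zero_mul]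
        by_cases hb : b
        · rw [if_neg (fun h => hmr (by simp [h, hb])), if_pos hb]
        · rw [if_pos (by_contra fun h => hmr (by simp [h, hb])), if_neg hb]
    simp only [h_int]
    rw [Network.markLaw, lintegral_uniform_prod_ite _ (p.PL_nonneg r hr.le) (p.PL_le_one r hr.le)
      measurable_const measurable_const]
    by_cases hb : b <;> simp [hb, linkProb, PN]
  · rw [indicator_of_notMem hrA]
    have : ∀ m : ℝ × ℝ × ℝ, {z : ℝ × ℝ × ℝ × ℝ | (z.1 ∈ A ∧ 0 < z.1) ∧
        (p.linkLos z ↔ b)}.indicator (fun z => K (p.linkLoss z)) (r, m) = 0 := fun m =>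
      indicator_of_notMem (fun h => hrA h.1.1) _
    simp [this]

lemma laplace_zero (b : Prop) (r : ℝ) : p.laplace F k b r 0 = 1 := by
  have h : ∀ α t, p.gainTransform F k α 0 t = 1 := fun α t => by simp [gainTransform]
  have h0 : expNeg 0 = 1 := by simp [expNeg]
  unfold laplace laplaceL laplaceN expL expN
  split_ifs <;> simp [h, h0]

lemma levelDensity_eq (hF : F (Iio 0) = 0) {c : ℝ} (hc : 0 ≤ c) {K : ℝ → ℝ≥0∞} {κ : ℝ}
    (hκ : 0 ≤ κ) (b : Prop) {r : ℝ} (hr : 0 < r)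
    (hK : K (p.β * r ^ (-p.linkExp b)) = ENNReal.ofReal κ) :
    p.levelDensity F k c K b r = ENNReal.ofReal (p.weight b r *
      (κ * p.laplace F k b r (c / (p.β * r ^ (-p.linkExp b))))) := by
  have h0 : 0 ≤ 2 * Real.pi * p.Λ₀ * r := by have := p.Λ₀_pos; positivity
  rw [levelDensity, hK]
  unfold linkProb linkExp weight laplace
  split_ifs
  · rw [p.expNeg_levelExponent_los F k hF hc hr, ← ENNReal.ofReal_mul hκ,
      ← ENNReal.ofReal_mul (p.PL_nonneg r hr.le), ← ENNReal.ofReal_mul h0, p.weightL_eq hr]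
    congr 1; ring
  · rw [p.expNeg_levelExponent_nlos F k hF hc hr, ← ENNReal.ofReal_mul hκ,
      ← ENNReal.ofReal_mul (p.PN_nonneg hr.le), ← ENNReal.ofReal_mul h0, p.weightN_eq hr]
    congr 1; ring

/-- At `c = 0` the interference drops out and only the void probabilities remain: the weight is the
density of the length of the best link. -/
lemma levelDensity_zero (hF : F (Iio 0) = 0) (b : Prop) {r : ℝ} (hr : 0 < r) :
    p.levelDensity F k 0 1 b r = ENNReal.ofReal (p.weight b r) := by
  rw [p.levelDensity_eq F k hF le_rfl zero_le_one b hr (by simp), zero_div, laplace_zero]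
  simp

/-- Coverage by a link of loss `a` evaluates the Laplace transform at `τ / (GA² a)`, so `c = τ /
GA²`; the noise depends on the link only through `a` and is carried by `K`. -/
lemma levelDensity_cover (hF : F (Iio 0) = 0) {τ : ℝ} (hτ : 0 ≤ τ) (b : Prop) {r : ℝ}
    (hr : 0 < r) :
    p.levelDensity F k (τ / p.GA ^ 2)
      (fun a => ENNReal.expNeg (ENNReal.ofReal (τ / p.GA ^ 2 * p.σ ^ 2) / ENNReal.ofReal a)) b r =
      ENNReal.ofReal (p.weight b r * p.cover F τ k b r) := by
  have hβ := p.β_pos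
  have hpos : 0 < p.β * r ^ (-p.linkExp b) := by positivity
  rw [p.levelDensity_eq F k hF (by positivity) (Real.exp_nonneg
    (-(τ / p.GA ^ 2 * p.σ ^ 2 / (p.β * r ^ (-p.linkExp b))))) b hr, p.cover_eq F k τ b hr]
  rw [← ENNReal.ofReal_div_of_pos hpos, ENNReal.expNeg_ofReal (by positivity)]

end NetworkParams

/-! ### The serving transmitter -/

lemma measurable_sInf_nat {Ω : Type*} [MeasurableSpace Ω] {P : ℕ → Ω → Prop}
    (hP : ∀ n, MeasurableSet {ω | P n ω}) : Measurable fun ω => sInf {n | P n ω} := by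
  refine measurable_of_Iic fun n => ?_
  -- The last set appears because `sInf ∅ = 0`.
  have : (fun ω => sInf {n | P n ω}) ⁻¹' Iic n =
      (⋃ m ∈ Iic n, {ω | P m ω}) ∪ (⋃ m, {ω | P m ω})ᶜ := by
    ext ω
    simp only [mem_preimage, mem_Iic, mem_union, mem_iUnion, exists_prop, mem_compl_iff, not_exists]
    constructor
    · intro h
      by_cases hne : {n | P n ω}.Nonempty
      · exact Or.inl ⟨_, h, Nat.sInf_mem hne⟩
      · exact Or.inr fun m hm => hne ⟨m, hm⟩
    · rintro (⟨m, hm, hPm⟩ | h)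
      · exact (Nat.sInf_le (show m ∈ {n | P n ω} from hPm)).trans hm
      · have : {n | P n ω} = ∅ := eq_empty_of_forall_notMem h
        rw [this, Nat.sInf_empty]
        exact Nat.zero_le _
  rw [this]
  exact (MeasurableSet.biUnion (to_countable _) fun m _ => hP m).union
    (MeasurableSet.iUnion hP).compl

lemma Measurable.apply_nat {Ω β : Type*} [MeasurableSpace Ω] [MeasurableSpace β] {f : ℕ → Ω → β}
    (hf : ∀ n, Measurable (f n)) {s : Ω → ℕ} (hs : Measurable s) :
    Measurable fun ω => f (s ω) ω := by
  have : Measurable fun q : ℕ × Ω => f q.1 q.2 := measurable_from_prod_countable_right hf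
  exact this.comp (hs.prodMk measurable_id)

namespace Network

variable {Ω : Type*} {k : ℕ → ℕ} {N : Network Ω k} {p : NetworkParams} {i : ℕ}

lemma pathLoss_eq (y : Plane) (n : ℕ) (ω : Ω) :
    N.pathLoss p i y n ω = p.linkLoss (N.link i y n ω) := by
  have : |(N.link i y n ω).1| = N.dist i y n ω := abs_of_nonneg (norm_nonneg _)
  rw [pathLoss, NetworkParams.linkLoss, this]
  rfl

lemma serving_eq (y : Plane) (ω : Ω) :
    N.serving p i y ω = sInf {n | p.Best n (N.links i y ω)} := by
  simp only [serving, pathLoss_eq]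
  rfl

lemma interference_eq (y : Plane) (ω : Ω) :
    N.interference p i y ω = p.others (N.serving p i y ω) (N.links i y ω) := by
  classical
  rw [interference, NetworkParams.others]
  refine tsum_congr fun n => ?_
  rw [pathLoss_eq]
  congr

/-- Cross multiplication survives the degenerate denominators: for `∞` both sides fail since `τ >
0`, and for `0` both say that the received signal is positive. -/
lemma lt_SINR_iff (y : Plane) {τ : ℝ} (hτ : 0 < τ) (ω : Ω) :
    ENNReal.ofReal τ < N.SINR p i y ω ↔
      ENNReal.ofReal τ * (ENNReal.ofReal (p.σ ^ 2) +
          p.others (N.serving p i y ω) (N.links i y ω)) <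
        ENNReal.ofReal (N.h (N.serving p i y ω) ω *
          (p.GA ^ 2 * p.linkLoss (N.link i y (N.serving p i y ω) ω))) := by
  rw [SINR, interference_eq, pathLoss_eq, mul_assoc]
  generalize ENNReal.ofReal (p.σ ^ 2) + _ = x
  have hτ' : ENNReal.ofReal τ ≠ 0 := by simpa using hτ
  by_cases hx : x = ⊤
  · simp [hx, ENNReal.mul_top hτ']
  · rw [ENNReal.lt_div_iff_mul_lt (Or.inr ENNReal.ofReal_ne_top) (Or.inl hx)]

variable [MeasurableSpace Ω] {μ : Measure Ω} [IsProbabilityMeasure μ] {F : Measure ℝ}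

lemma IsModel.measurableSet_best (hN : N.IsModel μ p F i) (y : Plane) (n : ℕ) :
    MeasurableSet {ω | p.Best n (N.links i y ω)} :=
  hN.measurable_links y (p.measurableSet_best n)

lemma IsModel.measurable_serving (hN : N.IsModel μ p F i) (y : Plane) :
    Measurable (N.serving p i y) := by
  rw [show N.serving p i y = fun ω => sInf {n | p.Best n (N.links i y ω)} from
    funext (serving_eq y)]
  exact measurable_sInf_nat (hN.measurableSet_best y)

lemma IsModel.measurable_link (hN : N.IsModel μ p F i) (y : Plane) (n : ℕ) :
    Measurable (N.link i y n) := (hN.isPoissonEnum_link y).measurable n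

lemma IsModel.measurable_dist (hN : N.IsModel μ p F i) (y : Plane) (n : ℕ) :
    Measurable (N.dist i y n) := measurable_fst.comp (hN.measurable_link y n)

lemma IsModel.measurable_los (hN : N.IsModel μ p F i) (y : Plane) (n : ℕ) :
    Measurable (N.los p i y n) :=
  measurableSet_setOfPred.1 (hN.measurable_link y n p.measurableSet_linkLos)

lemma IsModel.measurable_servingDist (hN : N.IsModel μ p F i) (y : Plane) :
    Measurable (N.servingDist p i y) :=
  Measurable.apply_nat (hN.measurable_dist y) (hN.measurable_serving y)

lemma IsModel.measurable_servingLos (hN : N.IsModel μ p F i) (y : Plane) :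
    Measurable (N.servingLos p i y) :=
  Measurable.apply_nat (hN.measurable_los y) (hN.measurable_serving y)

lemma IsModel.measurable_SINR (hN : N.IsModel μ p F i) (y : Plane) :
    Measurable (N.SINR p i y) := by
  have h1 : Measurable fun ω => ENNReal.ofReal (N.h (N.serving p i y ω) ω * p.GA ^ 2 *
      N.pathLoss p i y (N.serving p i y ω) ω) := by
    refine Measurable.apply_nat (f := fun n ω => ENNReal.ofReal (N.h n ω * p.GA ^ 2 *
      N.pathLoss p i y n ω)) (fun n => ?_) (hN.measurable_serving y)
    simp only [pathLoss_eq]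
    have := hN.measurable_h n
    have := hN.measurable_link y n
    fun_prop
  have h2 : Measurable (N.interference p i y) := by
    rw [show N.interference p i y = fun ω => p.others (N.serving p i y ω) (N.links i y ω) from
      funext (interference_eq y)]
    exact Measurable.apply_nat (f := fun n ω => p.others n (N.links i y ω))
      (fun n => (p.measurable_others n).comp (hN.measurable_links y)) (hN.measurable_serving y)
  exact h1.div (measurable_const.add h2)

lemma IsModel.ae_dist_pos (hN : N.IsModel μ p F i) (y : Plane) :
    ∀ᵐ ω ∂μ, ∀ n, 0 < N.dist i y n ω := by
  have := hN.isProbabilityMeasure_markLaw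
  have h := (hN.isPoissonEnum_link y).ae_forall_notMem
    (A := Iic 0 ×ˢ univ) (measurableSet_Iic.prod MeasurableSet.univ)
    (by rw [Measure.prod_prod, radialIntensity_Iic_zero, zero_mul])
  filter_upwards [h] with ω hω n
  by_contra hn
  exact hω n ⟨not_lt.1 hn, mem_univ _⟩

/-- Almost surely the serving transmitter is the unique one with the largest path loss. -/
lemma IsModel.ae_best_iff (hN : N.IsModel μ p F i) (y : Plane) :
    ∀ᵐ ω ∂μ, ∀ n, p.Best n (N.links i y ω) ↔ N.serving p i y ω = n := by
  have := hN.isProbabilityMeasure_markLaw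
  have hP := hN.isPoissonEnum_link y
  have hfin : ∀ᵐ ω ∂μ, ∀ j : ℕ, {n | (1 : ℝ) / (j + 1) < p.linkLoss (N.link i y n ω)}.Finite :=
    ae_all_iff.2 fun j => hP.ae_finite (A := {z | (1 : ℝ) / (j + 1) < p.linkLoss z})
      (measurableSet_lt measurable_const p.measurable_linkLoss)
      (p.linkLoss_gt_lt_top _ Nat.one_div_pos_of_nat)
  filter_upwards [hfin, hP.ae_injective p.measurable_linkLoss (p.linkLoss_level_null _),
    hN.ae_dist_pos y] with ω hω hinj hpos
  have h0 : 0 < p.linkLoss (N.link i y 0 ω) :=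
    mul_pos p.β_pos (Real.rpow_pos_of_pos (abs_pos.2 (hpos 0).ne') _)
  -- Only finitely many links exceed a level below the loss of link `0`, so a maximum is attained;
  -- injectivity of the losses makes it unique.
  obtain ⟨j, hj⟩ := exists_nat_one_div_lt h0
  obtain ⟨n₀, -, hn₀⟩ := exists_max_image _ (fun n => p.linkLoss (N.link i y n ω)) (hω j) ⟨0, hj⟩
  have hbest : p.Best n₀ (N.links i y ω) := by
    intro m
    by_cases hm : (1 : ℝ) / (j + 1) < p.linkLoss (N.link i y m ω)
    · exact hn₀ m hm
    · exact (not_lt.1 hm).trans (hj.le.trans (hn₀ 0 hj))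
  have hserv : p.Best (N.serving p i y ω) (N.links i y ω) := by
    rw [serving_eq]
    exact Nat.sInf_mem (s := {n | p.Best n (N.links i y ω)}) ⟨n₀, hbest⟩
  refine fun n => ⟨fun hn => ?_, fun hn => hn ▸ hserv⟩
  exact hinj (le_antisymm (hn _) (hserv n))

/-- Almost surely exactly one index is best, so a statement about the random serving index becomes a
sum over all indices, which is what the Campbell formula evaluates. -/
lemma IsModel.measure_serving (hN : N.IsModel μ p F i) (y : Plane) {S : ℕ → Set Ω}
    (hS : ∀ n, MeasurableSet (S n)) :
    μ {ω | ω ∈ S (N.serving p i y ω)} = ∑' n, μ ({ω | p.Best n (N.links i y ω)} ∩ S n) := by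
  have hm : ∀ n, MeasurableSet {ω | N.serving p i y ω = n} := fun n =>
    hN.measurable_serving y (measurableSet_singleton n)
  have e : {ω | ω ∈ S (N.serving p i y ω)} = ⋃ n, {ω | N.serving p i y ω = n} ∩ S n := by
    ext ω
    simp
  rw [e, measure_iUnion _ fun n => (hm n).inter (hS n)]
  · refine tsum_congr fun n => measure_congr ?_
    filter_upwards [hN.ae_best_iff y] with ω hω
    exact propext (and_congr_left fun _ => (hω n).symm)
  · intro n m hnm
    exact disjoint_left.2 fun ω h h' => hnm (h.1.symm.trans h'.1)

/-- The Campbell formula for the best link. -/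
lemma IsModel.tsum_lintegral_best (hN : N.IsModel μ p F i) (y : Plane) {c : ℝ} (hc : 0 ≤ c)
    {u : ℝ × ℝ × ℝ × ℝ → ℝ≥0∞} (hu : Measurable u) :
    ∑' n, ∫⁻ ω, {ω | p.Best n (N.links i y ω)}.indicator (fun ω => u (N.link i y n ω) *
      expNeg (ENNReal.ofReal c * p.others n (N.links i y ω) /
        ENNReal.ofReal (p.linkLoss (N.link i y n ω)))) ω ∂μ =
    ∫⁻ z, u z * expNeg (p.levelExponent F (k i) c (p.linkLoss z))
      ∂((radialIntensity p.Λ₀).prod (markLaw p F (k i))) := by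
  classical
  have := hN.isProbabilityMeasure_markLaw
  have h := (hN.isPoissonEnum_link y).tsum_lintegral_mul_expNeg_others_of_level
    p.measurable_linkLoss p.linkLoss_nonneg (p.measurable_shadow c)
    (fun a z => p.shadow_ne_top c a z) (p.shadow_antitone c)
    (fun z a _ => p.continuousWithinAt_shadow c z a) hu
  refine Eq.trans (tsum_congr fun n => lintegral_congr fun ω => ?_) h
  have hs := p.expNeg_tsum_shadow hc n (N.links i y ω)
  change _ = u (N.link i y n ω) * expNeg (∑' m, if m = n then 0
    else p.shadow c (p.linkLoss (N.links i y ω n)) (N.links i y ω m))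
  rw [hs]
  by_cases hb : p.Best n (N.links i y ω)
  · rw [indicator_of_mem (show ω ∈ {ω | p.Best n (N.links i y ω)} from hb), if_pos hb]
    rfl
  · rw [indicator_of_notMem (show ω ∉ {ω | p.Best n (N.links i y ω)} from hb), if_neg hb, mul_zero]

variable [IsProbabilityMeasure F]

/-- The joint law of the length and of the type of the serving link. -/
lemma IsModel.measure_serving_dist_los (hN : N.IsModel μ p F i) (y : Plane) (b : Prop)
    {A : Set ℝ} (hA : MeasurableSet A) :
    μ {ω | N.servingDist p i y ω ∈ A ∧ (N.servingLos p i y ω ↔ b)} =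
      ∫⁻ r in A, p.levelDensity F (k i) 0 1 b r ∂(volume.restrict (Ioi 0)) := by
  have := hN.isProbabilityMeasure_gainLaw
  have hmb : MeasurableSet {z : ℝ × ℝ × ℝ × ℝ | (z.1 ∈ A ∧ 0 < z.1) ∧ (p.linkLos z ↔ b)} :=
    MeasurableSet.inter (measurable_fst (hA.inter measurableSet_Ioi)) (measurableSet_setOfPred.2
      ((measurableSet_setOfPred.1 p.measurableSet_linkLos).iff measurable_const))
  have hS := fun n => hN.measurable_link y n hmb
  rw [← p.lintegral_link_mul_expNeg F (k i) 0 measurable_one b hA,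
    ← hN.tsum_lintegral_best y le_rfl (Measurable.indicator (by fun_prop) hmb)]
  refine Eq.trans (measure_congr ?_) ((hN.measure_serving y hS).trans (tsum_congr fun n => ?_))
  · filter_upwards [hN.ae_dist_pos y] with ω hω
    exact propext (and_congr_left fun _ => (and_iff_left (hω _)).symm)
  · rw [← lintegral_indicator_one ((hN.measurableSet_best y n).inter (hS n))]
    refine lintegral_congr fun ω => ?_
    by_cases hb : ω ∈ {ω | p.Best n (N.links i y ω)}
    · rw [indicator_of_mem hb]
      by_cases hz : N.link i y n ω ∈ {z | (z.1 ∈ A ∧ 0 < z.1) ∧ (p.linkLos z ↔ b)}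
      · rw [indicator_of_mem hz, indicator_of_mem (mem_inter hb hz)]
        simp
      · rw [indicator_of_notMem hz, indicator_of_notMem fun h => hz h.2, zero_mul]
    · rw [indicator_of_notMem hb, indicator_of_notMem fun h => hb h.1]

lemma IsModel.map_servingDist (hN : N.IsModel μ p F i) (y : Plane) (b : Prop) :
    (μ.restrict {ω | N.servingLos p i y ω ↔ b}).map (N.servingDist p i y) =
      (volume.restrict (Ioi 0)).withDensity (p.levelDensity F (k i) 0 1 b) := by
  ext A hA
  rw [Measure.map_apply (hN.measurable_servingDist y) hA,
    Measure.restrict_apply (hN.measurable_servingDist y hA), withDensity_apply _ hA,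
    ← hN.measure_serving_dist_los y b hA]
  rfl

/-- Disintegration of the coverage event over the length and the type of the serving link. -/
lemma IsModel.measure_lt_SINR (hN : N.IsModel μ p F i) (y : Plane) (τ : ℝ) (b : Prop)
    {A : Set ℝ} (hA : MeasurableSet A) :
    μ {ω | (N.servingDist p i y ω ∈ A ∧ (N.servingLos p i y ω ↔ b)) ∧
        ENNReal.ofReal τ < N.SINR p i y ω} =
      ∫⁻ r in A, p.levelDensity F (k i) 0 1 b r *
        condDistrib (N.SINR p i y) (fun ω => (N.servingDist p i y ω, N.servingLos p i y ω)) μ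
          (r, b) (Ioi (ENNReal.ofReal τ)) ∂(volume.restrict (Ioi 0)) := by
  have := hN.isProbabilityMeasure_gainLaw
  have hD := hN.measurable_servingDist y
  have hL := hN.measurable_servingLos y
  have hLb : MeasurableSet {ω | N.servingLos p i y ω ↔ b} :=
    measurableSet_setOfPred.2 (hL.iff measurable_const)
  set κ := condDistrib (N.SINR p i y)
    (fun ω => (N.servingDist p i y ω, N.servingLos p i y ω)) μ
  have hκ : Measurable fun r : ℝ => κ (r, b) (Ioi (ENNReal.ofReal τ)) :=
    (Kernel.measurable_coe κ measurableSet_Ioi).comp measurable_prodMk_right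
  have h := setLIntegral_preimage_condDistrib (μ := μ) (hD.prodMk hL)
    (hN.measurable_SINR y).aemeasurable (measurableSet_Ioi (a := ENNReal.ofReal τ))
    (hA.prod (measurableSet_singleton b))
  have e : (fun ω => (N.servingDist p i y ω, N.servingLos p i y ω)) ⁻¹' (A ×ˢ {b}) =
      N.servingDist p i y ⁻¹' A ∩ {ω | N.servingLos p i y ω ↔ b} := by
    ext ω
    exact and_congr_right fun _ => eq_iff_iff
  calc _ = ∫⁻ ω in N.servingDist p i y ⁻¹' A ∩ {ω | N.servingLos p i y ω ↔ b},
        κ (N.servingDist p i y ω, N.servingLos p i y ω) (Ioi (ENNReal.ofReal τ)) ∂μ := by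
        rw [← e, h, e]
        rfl
    _ = ∫⁻ ω in N.servingDist p i y ⁻¹' A ∩ {ω | N.servingLos p i y ω ↔ b},
        κ (N.servingDist p i y ω, b) (Ioi (ENNReal.ofReal τ)) ∂μ := by
        refine setLIntegral_congr_fun ((hD hA).inter hLb) fun ω hω => ?_
        have : N.servingLos p i y ω = b := propext hω.2
        simp only [this]
    _ = ∫⁻ r in A, κ (r, b) (Ioi (ENNReal.ofReal τ))
          ∂((μ.restrict {ω | N.servingLos p i y ω ↔ b}).map (N.servingDist p i y)) := by
        rw [setLIntegral_map hA hκ hD, Measure.restrict_restrict (hD hA)]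
    _ = _ := by
        rw [hN.map_servingDist y b, setLIntegral_withDensity_eq_setLIntegral_mul _
          (p.measurable_levelDensity F (k i) 0 measurable_one b) hκ hA]
        rfl

end Network

/-- Separates the noise, a function of the loss `l` alone, from the interference, which has the form
of `shadow` with `c = τ / g`. -/
lemma expNeg_mul_add_div {τ s g l : ℝ} (hτ : 0 ≤ τ) (hg : 0 < g) (x : ℝ≥0∞) :
    expNeg (ENNReal.ofReal τ * (ENNReal.ofReal s + x) / ENNReal.ofReal (g * l)) =
      expNeg (ENNReal.ofReal (τ / g * s) / ENNReal.ofReal l) *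
        expNeg (ENNReal.ofReal (τ / g) * x / ENNReal.ofReal l) := by
  have hg0 : ENNReal.ofReal g ≠ 0 := by simpa using hg
  rw [← ENNReal.expNeg_add]
  congr 1
  rw [ENNReal.ofReal_mul hg.le, ENNReal.ofReal_mul (div_nonneg hτ hg.le),
    ENNReal.ofReal_div_of_pos hg]
  simp only [div_eq_mul_inv]
  rw [ENNReal.mul_inv (Or.inl hg0) (Or.inl ENNReal.ofReal_ne_top)]
  ring

/-! ### The serving link on the coverage event under Rayleigh fading -/

namespace Network

variable {Ω : Type*} {k : ℕ → ℕ} {N : Network Ω k} {p : NetworkParams} {i : ℕ}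
  [MeasurableSpace Ω] {μ : Measure Ω} [IsProbabilityMeasure μ]

/-- The joint law of the length and of the type of the serving link on the coverage event, under
Rayleigh fading. -/
lemma IsModel.measure_lt_SINR_rayleigh (hN : N.IsModel μ p (expMeasure 1) i) (y : Plane) {τ : ℝ}
    (hτ : 0 < τ) (b : Prop) {A : Set ℝ} (hA : MeasurableSet A) :
    μ {ω | (N.servingDist p i y ω ∈ A ∧ (N.servingLos p i y ω ↔ b)) ∧
        ENNReal.ofReal τ < N.SINR p i y ω} =
      ∫⁻ r in A, p.levelDensity (expMeasure 1) (k i) (τ / p.GA ^ 2)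
        (fun a => expNeg (ENNReal.ofReal (τ / p.GA ^ 2 * p.σ ^ 2) / ENNReal.ofReal a)) b r
        ∂(volume.restrict (Ioi 0)) := by
  have : IsProbabilityMeasure (expMeasure 1) := isProbabilityMeasure_expMeasure zero_lt_one
  have := hN.isProbabilityMeasure_gainLaw
  have hG := p.GA_pos
  have hmb : MeasurableSet {z : ℝ × ℝ × ℝ × ℝ | (z.1 ∈ A ∧ 0 < z.1) ∧ (p.linkLos z ↔ b)} :=
    MeasurableSet.inter (measurable_fst (hA.inter measurableSet_Ioi)) (measurableSet_setOfPred.2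
      ((measurableSet_setOfPred.1 p.measurableSet_linkLos).iff measurable_const))
  have hB : MeasurableSet {q : ℝ × ℝ | (q.1 ∈ A ∧ 0 < q.1) ∧ (q.2 < p.PL q.1 ↔ b)} :=
    hmb.preimage (f := fun q : ℝ × ℝ => (q.1, q.2, (0 : ℝ), (0 : ℝ))) (by fun_prop)
  let S : ℕ → Set Ω := fun n => {ω | ((N.dist i y n ω ∈ A ∧ 0 < N.dist i y n ω) ∧
    (N.U n ω < p.PL (N.dist i y n ω) ↔ b)) ∧
    ENNReal.ofReal τ * (ENNReal.ofReal (p.σ ^ 2) + p.others n (N.links i y ω)) <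
      ENNReal.ofReal (N.h n ω * (p.GA ^ 2 * p.linkLoss (N.link i y n ω)))}
  have hS : ∀ n, MeasurableSet (S n) := fun n => by
    have h1 := hN.measurable_link y n
    have h2 := hN.measurable_links y
    have h3 := hN.measurable_h n
    have h4 : MeasurableSet {ω | ENNReal.ofReal τ * (ENNReal.ofReal (p.σ ^ 2) +
        p.others n (N.links i y ω)) <
        ENNReal.ofReal (N.h n ω * (p.GA ^ 2 * p.linkLoss (N.link i y n ω)))} :=
      measurableSet_lt (by fun_prop) (by fun_prop)
    exact (h1 hmb).inter h4
  rw [← p.lintegral_link_mul_expNeg (expMeasure 1) (k i) _ (by fun_prop) b hA,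
    ← hN.tsum_lintegral_best y (by positivity) (Measurable.indicator (by fun_prop) hmb)]
  refine Eq.trans (measure_congr ?_) ((hN.measure_serving y hS).trans (tsum_congr fun n => ?_))
  · filter_upwards [hN.ae_dist_pos y] with ω hω
    refine propext (and_congr (and_congr_left fun _ => (and_iff_left (hω _)).symm) ?_)
    exact lt_SINR_iff y hτ ω
  -- The conditions on length and type involve only the distance and `U`, so the fading of link `n`
  -- can be integrated out in their presence.
  · refine (hN.lintegral_rayleigh y n
      (B := fun r u => (r ∈ A ∧ 0 < r) ∧ (u < p.PL r ↔ b)) hB (fun r u h => h.1.2) τ).trans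
      (lintegral_congr fun ω => ?_)
    by_cases hb : ω ∈ {ω | p.Best n (N.links i y ω)}
    · rw [indicator_of_mem hb]
      by_cases hz : N.link i y n ω ∈ {z | (z.1 ∈ A ∧ 0 < z.1) ∧ (p.linkLos z ↔ b)}
      · rw [indicator_of_mem hz]
        exact (indicator_of_mem (show ω ∈ {ω | p.Best n (N.links i y ω) ∧
          (N.dist i y n ω ∈ A ∧ 0 < N.dist i y n ω) ∧
            (N.U n ω < p.PL (N.dist i y n ω) ↔ b)} from ⟨hb, hz⟩) _).trans
          (expNeg_mul_add_div hτ.le (by positivity) _)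
      · rw [indicator_of_notMem hz, indicator_of_notMem fun h => hz h.2, zero_mul]
    · rw [indicator_of_notMem hb, indicator_of_notMem fun h => hb h.1]

end Network

/-! ### The coverage probability -/

lemma integrableOn_and_integral_of_lintegral {f : ℝ → ℝ} {g : ℝ → ℝ≥0∞} {s : Set ℝ}
    (hs : MeasurableSet s) (hg : Measurable g) (hfg : ∀ r ∈ s, g r = ENNReal.ofReal (f r))
    (hf : ∀ r ∈ s, 0 ≤ f r) (hfin : ∫⁻ r in s, g r ≠ ⊤) :
    IntegrableOn f s ∧ ∫ r in s, f r = (∫⁻ r in s, g r).toReal := by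
  have e : ∀ r ∈ s, (g r).toReal = f r := fun r hr => by
    rw [hfg r hr, ENNReal.toReal_ofReal (hf r hr)]
  refine ⟨IntegrableOn.congr_fun (integrable_toReal_of_lintegral_ne_top hg.aemeasurable hfin)
    e hs, ?_⟩
  rw [← setIntegral_congr_fun hs e, integral_toReal hg.aemeasurable
    (ae_lt_top hg hfin)]

namespace Network

variable {Ω : Type*} {k : ℕ → ℕ} {N : Network Ω k} {p : NetworkParams} {i : ℕ}
  [MeasurableSpace Ω] {μ : Measure Ω} [IsProbabilityMeasure μ] {F : Measure ℝ}
  [IsProbabilityMeasure F]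

lemma levelDensity_mul_condDistrib (hN : N.IsModel μ p F i) (hF : F (Iio 0) = 0) (y : Plane)
    (τ : ℝ) (b : Prop) {r : ℝ} (hr : 0 < r) :
    p.levelDensity F (k i) 0 1 b r *
      condDistrib (N.SINR p i y) (fun ω => (N.servingDist p i y ω, N.servingLos p i y ω)) μ
        (r, b) (Ioi (ENNReal.ofReal τ)) =
      ENNReal.ofReal (p.weight b r * N.condCoverage p i y μ τ r b) := by
  have := hN.isProbabilityMeasure_gainLaw
  rw [p.levelDensity_zero F (k i) hF b hr, ENNReal.ofReal_mul (p.weight_nonneg b hr),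
    condCoverage, ofReal_measureReal]

/-- The disintegration over all lengths: the integrand is nonnegative and its integral is a
probability, so integrability is automatic. -/
lemma IsModel.integral_weight_mul_condCoverage (hN : N.IsModel μ p F i) (hF : F (Iio 0) = 0)
    (y : Plane) (τ : ℝ) (b : Prop) :
    IntegrableOn (fun r => p.weight b r * N.condCoverage p i y μ τ r b) (Ioi 0) ∧
      ∫ r in Ioi 0, p.weight b r * N.condCoverage p i y μ τ r b =
        μ.real {ω | (N.servingLos p i y ω ↔ b) ∧ ENNReal.ofReal τ < N.SINR p i y ω} := by
  have := hN.isProbabilityMeasure_gainLaw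
  have h := hN.measure_lt_SINR y τ b MeasurableSet.univ
  simp only [mem_univ, true_and, Measure.restrict_univ] at h
  rw [measureReal_def, h]
  refine integrableOn_and_integral_of_lintegral measurableSet_Ioi ?_
    (fun r hr => levelDensity_mul_condDistrib hN hF y τ b hr)
    (fun r hr => mul_nonneg (p.weight_nonneg b hr) measureReal_nonneg)
    (h ▸ measure_ne_top _ _)
  exact (p.measurable_levelDensity F (k i) 0 measurable_one b).mul
    ((Kernel.measurable_coe _ measurableSet_Ioi).comp measurable_prodMk_right)

lemma IsModel.coverage_eq (hN : N.IsModel μ p F i) (hF : F (Iio 0) = 0) (y : Plane) (τ : ℝ) :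
    N.coverage p i y μ τ =
      (∫ r in Ioi 0, p.weight True r * N.condCoverage p i y μ τ r True) +
      ∫ r in Ioi 0, p.weight False r * N.condCoverage p i y μ τ r False := by
  rw [(hN.integral_weight_mul_condCoverage hF y τ True).2,
    (hN.integral_weight_mul_condCoverage hF y τ False).2, coverage,
    ← measureReal_inter_add_sdiff (s := {ω | ENNReal.ofReal τ < N.SINR p i y ω})
      (measurableSet_setOfPred.2 (hN.measurable_servingLos y))]
  congr 2 <;> ext ω <;> simp [and_comm]

/-- Over every Borel set of lengths both sides integrate to the probability of coverage by a serving
link of that length and type: one by disintegration, the other by the Rayleigh computation. The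
conditional law is determined only almost everywhere, and only where the weight does not vanish, so
the weight is kept as a factor. -/
lemma IsModel.ae_weight_mul_condCoverage_eq (hN : N.IsModel μ p (expMeasure 1) i) (y : Plane)
    {τ : ℝ} (hτ : 0 < τ) (b : Prop) :
    ∀ᵐ r ∂volume.restrict (Ioi (0 : ℝ)), p.weight b r * N.condCoverage p i y μ τ r b =
      p.weight b r * p.cover (expMeasure 1) τ (k i) b r := by
  have : IsProbabilityMeasure (expMeasure 1) := isProbabilityMeasure_expMeasure zero_lt_one
  have := hN.isProbabilityMeasure_gainLaw
  have hF : expMeasure 1 (Iio 0) = 0 := by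
    refine measure_mono_null Iio_subset_Iic_self ?_
    rw [← ofReal_cdf, cdf_expMeasure_eq zero_lt_one]
    simp
  have h := ae_eq_of_forall_setLIntegral_eq_of_sigmaFinite
    (μ := volume.restrict (Ioi (0 : ℝ)))
    ((p.measurable_levelDensity (expMeasure 1) (k i) 0 measurable_one b).mul
      ((Kernel.measurable_coe (condDistrib (N.SINR p i y)
        (fun ω => (N.servingDist p i y ω, N.servingLos p i y ω)) μ)
        (measurableSet_Ioi (a := ENNReal.ofReal τ))).comp (measurable_prodMk_right (y := b))))
    (p.measurable_levelDensity (expMeasure 1) (k i) (τ / p.GA ^ 2)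
      (K := fun a => expNeg (ENNReal.ofReal (τ / p.GA ^ 2 * p.σ ^ 2) / ENNReal.ofReal a))
      (by fun_prop) b)
    (fun A hA _ => (hN.measure_lt_SINR y τ b hA).symm.trans
      (hN.measure_lt_SINR_rayleigh y hτ b hA))
  filter_upwards [h, ae_restrict_mem measurableSet_Ioi] with r hr hr0
  have hr0 : 0 < r := hr0
  have hw := p.weight_nonneg b hr0
  rw [Pi.mul_apply, Function.comp_apply, levelDensity_mul_condDistrib hN hF y τ b hr0,
    p.levelDensity_cover (expMeasure 1) (k i) hF hτ.le b hr0] at hr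
  exact (ENNReal.ofReal_eq_ofReal_iff (mul_nonneg hw measureReal_nonneg)
    (mul_nonneg hw (p.cover_nonneg _ _ _ _ _))).1 hr

end Network

theorem theorem2 {Ω : Type*} [MeasurableSpace Ω] (μ : Measure Ω) [IsProbabilityMeasure μ]
    (p : NetworkParams) (k : ℕ → ℕ) (i : ℕ) (hθ : p.θA * k i ≤ 2 * Real.pi)
    (F : Measure ℝ) [IsProbabilityMeasure F] (hF : F (Iio 0) = 0)
    (N : Network Ω k) (hN : N.IsModel μ p F i) (y : Plane) (τ : ℝ) (hτ : 0 < τ) :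
    (IntegrableOn (fun r => p.weightL r * N.condCoverage p i y μ τ r True) (Ioi 0) ∧
      IntegrableOn (fun r => p.weightN r * N.condCoverage p i y μ τ r False) (Ioi 0) ∧
      N.coverage p i y μ τ =
        (∫ r in Ioi (0 : ℝ), p.weightL r * N.condCoverage p i y μ τ r True) +
        ∫ r in Ioi (0 : ℝ), p.weightN r * N.condCoverage p i y μ τ r False) ∧
    (F = expMeasure 1 →
      (∀ᵐ r ∂volume.restrict (Ioi (0 : ℝ)), 0 < p.weightL r →
        N.condCoverage p i y μ τ r True = p.coverL F τ r (k i)) ∧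
      (∀ᵐ r ∂volume.restrict (Ioi (0 : ℝ)), 0 < p.weightN r →
        N.condCoverage p i y μ τ r False = p.coverN F τ r (k i)) ∧
      IntegrableOn (fun r => p.weightL r * p.coverL F τ r (k i)) (Ioi 0) ∧
      IntegrableOn (fun r => p.weightN r * p.coverN F τ r (k i)) (Ioi 0) ∧
      N.coverage p i y μ τ =
        (∫ r in Ioi (0 : ℝ), p.weightL r * p.coverL F τ r (k i)) +
        ∫ r in Ioi (0 : ℝ), p.weightN r * p.coverN F τ r (k i)) := by

  have hL : ∀ r, p.weight True r = p.weightL r := fun r => if_pos trivial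
  have hNL : ∀ r, p.weight False r = p.weightN r := fun r => if_neg not_false
  have hcL : ∀ r, p.cover F τ (k i) True r = p.coverL F τ r (k i) := fun r => if_pos trivial
  have hcN : ∀ r, p.cover F τ (k i) False r = p.coverN F τ r (k i) := fun r => if_neg not_false
  have iL := (hN.integral_weight_mul_condCoverage hF y τ True).1
  have iN := (hN.integral_weight_mul_condCoverage hF y τ False).1
  have hcov := hN.coverage_eq hF y τ
  simp only [hL, hNL] at iL iN hcov
  refine ⟨⟨iL, iN, hcov⟩, ?_⟩
  rintro rfl
  have aL := hN.ae_weight_mul_condCoverage_eq y hτ True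
  have aN := hN.ae_weight_mul_condCoverage_eq y hτ False
  simp only [hL, hNL, hcL, hcN] at aL aN
  refine ⟨?_, ?_, iL.congr aL, iN.congr aN, ?_⟩
  · filter_upwards [aL] with r hr hw
    exact mul_left_cancel₀ hw.ne' hr
  · filter_upwards [aN] with r hr hw
    exact mul_left_cancel₀ hw.ne' hr
  · rw [hcov, integral_congr_ae aL, integral_congr_ae aN]
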